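/- Let $c\in\mathbb R$ with $|c|>1$. Functions are complex-valued on $\mathbb R$ and identified when equal almost everywhere, unless said otherwise. For $q\in\mathbb R$ and real $r\ge 0$ let $H_q^r=\{f\in H^r(\mathbb R): \cosh^q(\cdot)f\in H^r(\mathbb R)\}$ with norm $\|f\|_{r,q}=\|\cosh^q(\cdot) f\|_{H^r}$, and let $E_q^r$, $O_q^r$ be its subspaces of even and odd functions. For $q\in\mathbb R$ and $r\in\mathbb N$ let $W_q^{r,\infty}=\{f\in L^1_{\mathrm{loc}}: e^{-q\cdot}f\in W^{r,\infty}(\mathbb R)\}$ and $L_q^\infty=W_q^{0,\infty}$. Write $(Af)(x)=f(x+1)+f(x-1)$. Assume the following. (H1) There are $q_\varsigma>0$ and a real-valued $\varsigma\in E_{q_\varsigma}^2$ with $c^2\varsigma''+(2-A)(\varsigma+\varsigma^2)=0$. (H3) With $$\mathcal L_cf=c^2f''+(2+A)f+2(2+A)(\varsigma f),\qquad \mathcal L_c^*f=c^2f''+(2+A)f+2\varsigma\,(2+A)f,$$ there is $q_{\mathcal L}\in(0,\min\{q_\varsigma/2,1\})$ such that $\mathcal L_c^*$ is invertible (a bijection)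 from $W_{-q_{\mathcal L}}^{2,\infty}$ to $L_{-q_{\mathcal L}}^\infty$. Then: (i) For all $r\ge0$ and $q\ge q_{\mathcal L}$, $\mathcal L_c$ maps $O_q^{r+2}$ into $O_q^r$ and is injective there. Moreover, there is exactly one $\omega_c>0$ with $-c^2\omega_c^2+2+2\cos\omega_c=0$, and there are $\vartheta_c\in\mathbb R$ and a nonzero odd real-valued function $\gamma_c\in W^{2,\infty}(\mathbb R)$ (represented by its $C^1$ representative) with $\mathcal L_c^*\gamma_c=0$ such that: (ii) For all $r\ge0$, $q\in[q_{\mathcal L},1)$ and $g\in O_q^r$, the equation $\mathcal L_cf=g$ has a solution $f\in O_q^{r+2}$ if and only if $\int_{-\infty}^\infty g(x)\gamma_c(x)\,dx=0$. (iii) $\displaystyle\lim_{x\to\infty}|\gamma_c(x)-\sin(\omega_c(x+\vartheta_c))|=\lim_{x\to\infty}|\gamma_c'(x)-\omega_c\cos(\omega_c(x+\vartheta_c))|=0.$ (iv) For all $q>0$ and $r\ge0$ and all $g\in O_q^r$, the function $g\gamma_c$ is integrable, and the functional $\iota_c[g]=\int_{-\infty}^\infty g(x)\gamma_c(x)\,dx$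 is bounded on $O_q^r$: there is $C>0$ (which may depend on $c,q,r$, as well as on $\varsigma$ and $\gamma_c$) with $|\iota_c[g]|\le C\|g\|_{r,q}$ for all $g\in O_q^r$. -/

import Mathlib

open MeasureTheory Filter Topology

noncomputable section

namespace JostSolution

/-! Functions on the line are represented by plain functions `ℝ → ℂ`; every membership and every
equation below is insensitive to changes on null sets. -/

/-- `g` is the `n`-th weak derivative of `f` on `ℝ`: both are locally integrable and
`∫ f φ⁽ⁿ⁾ = (-1)ⁿ ∫ g φ` for all smooth compactly supported `φ`. -/
def HasWeakDeriv (n : ℕ) (f g : ℝ → ℂ) : Prop :=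
  LocallyIntegrable f volume ∧ LocallyIntegrable g volume ∧
    ∀ φ : ℝ → ℝ, ContDiff ℝ (⊤ : ℕ∞) φ → HasCompactSupport φ →
      ∫ x, ((iteratedDeriv n φ x : ℝ) : ℂ) * f x = (-1 : ℂ) ^ n * ∫ x, (φ x : ℂ) * g x

open Classical in
/-- The `n`-th weak derivative (unique up to null sets); the zero function if there is none. -/
def weakDeriv (n : ℕ) (f : ℝ → ℂ) : ℝ → ℂ :=
  if h : ∃ g, HasWeakDeriv n f g then h.choose else 0

/-- Evenness, up to null sets. -/
def AEEven (f : ℝ → ℂ) : Prop := ∀ᵐ x : ℝ, f (-x) = f x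

/-- Oddness, up to null sets. -/
def AEOdd (f : ℝ → ℂ) : Prop := ∀ᵐ x : ℝ, f (-x) = -f x

/-- `f ∈ H^r(ℝ)`, the `L²`-based Sobolev space of real order `r ≥ 0`. -/
def MemH (r : ℝ) (f : ℝ → ℂ) : Prop :=
  ∃ h : MemLp f 2 (volume : Measure ℝ),
    TemperedDistribution.MemSobolev r 2 (Lp.toTemperedDistribution (h.toLp f))

open Classical in
/-- The `L²` Fourier transform `k ↦ ∫ f(x) e^{-2πikx} dx`. -/
def fourierL2 (f : ℝ → ℂ) : ℝ → ℂ :=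
  if h : MemLp f 2 (volume : Measure ℝ) then
    (Lp.fourierTransformₗᵢ ℝ ℂ (h.toLp f) : ℝ → ℂ) else 0

/-- The `H^r(ℝ)` norm `(∫ (1 + ξ²)^r |f̂(ξ)|² dξ)^{1/2}`, with `f̂` the unitary Fourier transform;
here `ξ = 2πk`. -/
def normH (r : ℝ) (f : ℝ → ℂ) : ℝ :=
  Real.sqrt (∫ k : ℝ, (1 + (2 * Real.pi * k) ^ 2) ^ r * ‖fourierL2 f k‖ ^ 2)

/-- The function `cosh(x)^q f(x)`. -/
def coshMul (q : ℝ) (f : ℝ → ℂ) : ℝ → ℂ := fun x => ((Real.cosh x ^ q : ℝ) : ℂ) * f x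

/-- `f ∈ H_q^r`: both `f` and `cosh^q f` are in `H^r(ℝ)`. -/
def MemHq (q r : ℝ) (f : ℝ → ℂ) : Prop := MemH r f ∧ MemH r (coshMul q f)

/-- The norm of `H_q^r`. -/
def normHq (q r : ℝ) (f : ℝ → ℂ) : ℝ := normH r (coshMul q f)

/-- `E_q^r`, the even functions in `H_q^r`. -/
def MemE (q r : ℝ) (f : ℝ → ℂ) : Prop := MemHq q r f ∧ AEEven f

/-- `O_q^r`, the odd functions in `H_q^r`. -/
def MemO (q r : ℝ) (f : ℝ → ℂ) : Prop := MemHq q r f ∧ AEOdd f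

/-- `W^{r,∞}(ℝ)`: the weak derivatives of orders `0, …, r` exist and are essentially bounded. -/
def MemWInf (r : ℕ) (f : ℝ → ℂ) : Prop :=
  ∀ k ≤ r, ∃ g, HasWeakDeriv k f g ∧ MemLp g ⊤ (volume : Measure ℝ)

/-- The one-sided exponentially weighted space `W_q^{r,∞} = {f : e^{-q·} f ∈ W^{r,∞}}`;
`L_q^∞` is the case `r = 0`. -/
def MemWqInf (q : ℝ) (r : ℕ) (f : ℝ → ℂ) : Prop :=
  MemWInf r (fun x => (Real.exp (-q * x) : ℂ) * f x)

/-- `A = S¹ + S⁻¹`, the sum of the shifts by `1` and by `-1`. -/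
def opA (f : ℝ → ℂ) : ℝ → ℂ := fun x => f (x + 1) + f (x - 1)

/-- `B_c f = c² f'' + (2 + A) f`. -/
def opB (c : ℝ) (f : ℝ → ℂ) : ℝ → ℂ :=
  fun x => (c : ℂ) ^ 2 * weakDeriv 2 f x + (2 * f x + opA f x)

/-- `L_c f = c² f'' + (2 + A) f + 2 (2 + A)(ς f)`. -/
def opL (c : ℝ) (ς : ℝ → ℝ) (f : ℝ → ℂ) : ℝ → ℂ :=
  fun x => opB c f x +
    2 * (2 * ((ς x : ℂ) * f x) + opA (fun y => (ς y : ℂ) * f y) x)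

/-- The `L²`-adjoint `L_c^* f = c² f'' + (2 + A) f + 2 ς (2 + A) f`. -/
def opLstar (c : ℝ) (ς : ℝ → ℝ) (f : ℝ → ℂ) : ℝ → ℂ :=
  fun x => opB c f x + 2 * (ς x : ℂ) * (2 * f x + opA f x)

/-- The symbol of `B_c` on the real line. -/
def symbolB (c k : ℝ) : ℝ := -c ^ 2 * k ^ 2 + 2 + 2 * Real.cos k

/-- `ω` is the critical frequency of `B_c`: the unique positive zero of its symbol. -/
def IsCriticalFrequency (c ω : ℝ) : Prop :=
  0 < ω ∧ symbolB c ω = 0 ∧ ∀ ω' : ℝ, 0 < ω' → symbolB c ω' = 0 → ω' = ω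

/-- `ς` is a real-valued, exponentially localized (at rate `qς`) even solution of the monatomic
travelling wave equation `c² ς'' + (2 - A)(ς + ς²) = 0`. -/
def IsSolitaryWave (c qς : ℝ) (ς : ℝ → ℝ) : Prop :=
  0 < qς ∧ MemE qς 2 (fun x => (ς x : ℂ)) ∧
    ∀ᵐ x : ℝ, (c : ℂ) ^ 2 * weakDeriv 2 (fun y => (ς y : ℂ)) x +
      (2 * ((ς x : ℂ) + (ς x : ℂ) ^ 2) - opA (fun y => (ς y : ℂ) + (ς y : ℂ) ^ 2) x) = 0

/-- `L_c^*` is invertible, i.e. a bijection (modulo null sets), from `W_{-q}^{2,∞}` to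
`L_{-q}^∞`. -/
def AdjointInvertible (c : ℝ) (ς : ℝ → ℝ) (q : ℝ) : Prop :=
  (∀ f, MemWqInf (-q) 2 f → MemWqInf (-q) 0 (opLstar c ς f)) ∧
  (∀ f₁ f₂, MemWqInf (-q) 2 f₁ → MemWqInf (-q) 2 f₂ →
    opLstar c ς f₁ =ᵐ[volume] opLstar c ς f₂ → f₁ =ᵐ[volume] f₂) ∧
  (∀ g, MemWqInf (-q) 0 g → ∃ f, MemWqInf (-q) 2 f ∧ opLstar c ς f =ᵐ[volume] g)

end JostSolution

end

/-! Write `m = 1 + 2ς`. Then `L_c f = c²f'' + (2 + A)(m f)` and `L_c^* f = c²f'' + m (2 + A) f`, so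
`L_c (2 + A) = (2 + A) L_c^*`. This intertwining carries the assumed invertibility of `L_c^*` over
to `L_c`: among functions that are `O(e^{-qx})` on the whole line, decaying at `+∞` but free to grow
at `-∞`, `L_c` is injective and `L_c u = g` can be solved (`AdjointSolvable.repL_unique`,
`AdjointSolvable.repL_solve`). Injectivity on the weighted Sobolev spaces is a special case.

The constant-coefficient part factors as `B_c = (c² + k*)(∂² + ω²)`, where `k` is an even kernel
supported in `[-1, 1]` (`helm_eq`). Since `ω < 3/2`, the kernel is nonnegative, and its exponential
moment at rate one is smaller than `c²` (`kernConst_lt`). A Neumann iteration therefore inverts `c²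
+ k*` on functions growing at most like `e^{|x|}` and bounds `u'' + ω²u` by `f` and `e^{-|x|} * f`
whenever `B_c u = f` (`helm_bound`). Hence `u` is a combination `a e^{iωx} + b e^{-iωx}` up to a
tail of `f` (`exists_asymptotics`). Because `ς` is localized, the same holds for moderate solutions
of `L_c u = g` and `L_c^* u = 0`.

Correcting `e^{iωx}` by a decaying function gives a Jost solution `J` of `L_c^* J = 0`. The pair
`(L_c, L_c^*)` has a nonlocal Wronskian, `flux`, with limit `2i(c²ω + sin ω)(aβ - bα)` in terms of
the amplitudes. Pairing `J` with `(2 + A)` of its conjugate shows that `J` is not even, so its odd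
part yields a real odd solution `γ ≠ 0`. The amplitudes of `γ` are `α` and its conjugate, and `α ≠
0` by uniqueness; normalizing to `|α| = 1/2` gives the shifted sine.

Integrating the derivative of the flux gives Green's identity, and with it the necessity of `∫ gγ =
0`. Conversely, let `u` solve `L_c u = g` with decay at `+∞`. Then `-u(-x)` is another solution, and
`∫ gγ = 0` forces its amplitudes at `+∞` to be proportional to those of `γ`. Subtracting a multiple
of `(2 + A)γ` gives a solution decaying at `+∞`, which must be `u`. So `u(x) + u(-x)` is both even
and odd, hence zero: `u` is odd and decays at both ends. Its decay rate and its regularity are then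
raised to those dictated by `g` (`LinearSetting.memLp_coshMul`, `memH_of_repL`). The bound on the
functional is Cauchy–Schwarz against the bounded function `γ`. -/

open MeasureTheory Filter Topology

/-! ### Absolutely continuous functions on the line -/

noncomputable section

namespace JostSolution

/-- `u` is absolutely continuous with a.e. derivative `w`. -/
def AC (u w : ℝ → ℂ) : Prop :=
  LocallyIntegrable w volume ∧ ∀ a b, u b - u a = ∫ x in a..b, w x

theorem locInt_intervalIntegrable {w : ℝ → ℂ} (h : LocallyIntegrable w volume) (a b : ℝ) :
    IntervalIntegrable w volume a b :=
  (h.integrableOn_isCompact isCompact_uIcc).intervalIntegrable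

namespace AC

variable {u v w z : ℝ → ℂ}

theorem intervalIntegrable (h : AC u w) (a b : ℝ) : IntervalIntegrable w volume a b :=
  locInt_intervalIntegrable h.1 a b

theorem eq_add (h : AC u w) (a x : ℝ) : u x = u a + ∫ t in a..x, w t := by
  rw [← h.2 a x]; ring

theorem continuous (h : AC u w) : Continuous u := by
  have : u = fun x => u 0 + ∫ t in (0 : ℝ)..x, w t := funext fun x => h.eq_add 0 x
  rw [this]
  exact continuous_const.add
    (intervalIntegral.continuous_primitive (fun a b => h.intervalIntegrable a b) 0)

theorem locallyIntegrable (h : AC u w) : LocallyIntegrable u volume :=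
  h.continuous.locallyIntegrable

theorem congr (h : AC u w) (hw : w =ᵐ[volume] z) : AC u z := by
  refine ⟨?_, fun a b => ?_⟩
  · intro x
    obtain ⟨s, hs, hi⟩ := h.1 x
    exact ⟨s, hs, hi.congr (ae_restrict_of_ae hw)⟩
  · rw [h.2 a b]
    exact intervalIntegral.integral_congr_ae (hw.mono fun x hx _ => hx)

theorem of_hasDerivAt (h : ∀ x, HasDerivAt u (w x) x) (hw : Continuous w) : AC u w :=
  ⟨hw.locallyIntegrable, fun a b =>
    (intervalIntegral.integral_eq_sub_of_hasDerivAt (fun x _ => h x)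
      (hw.intervalIntegrable a b)).symm⟩

theorem hasDerivAt (h : AC u w) (hw : Continuous w) (x : ℝ) : HasDerivAt u (w x) x := by
  have : u = fun x => u 0 + ∫ t in (0 : ℝ)..x, w t := funext fun x => h.eq_add 0 x
  rw [this]
  exact (intervalIntegral.integral_hasDerivAt_right (h.intervalIntegrable 0 x)
    hw.stronglyMeasurable.stronglyMeasurableAtFilter hw.continuousAt).const_add _

theorem primitive (hw : LocallyIntegrable w volume) (x₀ : ℝ) (k : ℂ) :
    AC (fun x => k + ∫ t in x₀..x, w t) w := by
  refine ⟨hw, fun a b => ?_⟩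
  have := intervalIntegral.integral_add_adjacent_intervals
    (locInt_intervalIntegrable hw x₀ a) (locInt_intervalIntegrable hw a b)
  linear_combination -this

theorem const (k : ℂ) : AC (fun _ => k) (fun _ => 0) :=
  of_hasDerivAt (fun x => hasDerivAt_const x k) continuous_const

theorem add (h : AC u w) (h' : AC v z) : AC (fun x => u x + v x) (fun x => w x + z x) := by
  refine ⟨h.1.add h'.1, fun a b => ?_⟩
  rw [intervalIntegral.integral_add (h.intervalIntegrable a b) (h'.intervalIntegrable a b),
    ← h.2, ← h'.2]
  ring

theorem const_mul (h : AC u w) (k : ℂ) : AC (fun x => k * u x) (fun x => k * w x) := by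
  refine ⟨h.1.smul k, fun a b => ?_⟩
  rw [intervalIntegral.integral_const_mul, ← h.2]
  ring

theorem neg (h : AC u w) : AC (fun x => -u x) (fun x => -w x) := by
  simpa using h.const_mul (-1)

theorem sub (h : AC u w) (h' : AC v z) : AC (fun x => u x - v x) (fun x => w x - z x) := by
  simpa [sub_eq_add_neg] using h.add h'.neg

theorem comp_add (h : AC u w) (s : ℝ) : AC (fun x => u (x + s)) (fun x => w (x + s)) := by
  refine ⟨?_, fun a b => ?_⟩
  · rw [locallyIntegrable_iff]
    intro k hk
    have := (h.1.integrableOn_isCompact (hk.image (continuous_add_const s)))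
    have h2 := (measurePreserving_add_right volume s).integrableOn_image
      (measurableEmbedding_addRight s) (s := k) (f := w)
    exact h2.mp this
  · rw [intervalIntegral.integral_comp_add_right, ← h.2]

theorem comp_sub (h : AC u w) (s : ℝ) : AC (fun x => u (x - s)) (fun x => w (x - s)) := by
  simpa [sub_eq_add_neg] using h.comp_add (-s)

theorem comp_neg (h : AC u w) : AC (fun x => u (-x)) (fun x => -w (-x)) := by
  refine ⟨?_, fun a b => ?_⟩
  · refine LocallyIntegrable.neg ?_
    rw [locallyIntegrable_iff]
    intro k hk
    have := (h.1.integrableOn_isCompact (hk.image continuous_neg))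
    have h2 := (Measure.measurePreserving_neg (volume : Measure ℝ)).integrableOn_image
      (Homeomorph.neg ℝ).measurableEmbedding (s := k) (f := w)
    exact h2.mp this
  · rw [intervalIntegral.integral_neg, intervalIntegral.integral_comp_neg, ← h.2]
    ring

theorem clm {L : ℂ →L[ℝ] ℂ} (h : AC u w) : AC (fun x => L (u x)) (fun x => L (w x)) := by
  refine ⟨?_, fun a b => ?_⟩
  · intro x
    obtain ⟨s, hs, hi⟩ := h.1 x
    exact ⟨s, hs, L.integrable_comp hi⟩
  · rw [L.intervalIntegral_comp_comm (h.intervalIntegrable a b), ← h.2, map_sub]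

theorem conj (h : AC u w) :
    AC (fun x => (starRingEnd ℂ) (u x)) (fun x => (starRingEnd ℂ) (w x)) :=
  h.clm (L := (Complex.conjCLE : ℂ →L[ℝ] ℂ))

/-- Lebesgue differentiation on each `[-n, n]`, glued over countably many `n`. -/
theorem ae_hasDerivAt (h : AC u w) : ∀ᵐ x, HasDerivAt u (w x) x := by
  have key : ∀ n : ℕ, ∀ᵐ x, x ∈ Set.uIcc (-(n : ℝ)) n → HasDerivAt u (w x) x := by
    intro n
    filter_upwards [(h.intervalIntegrable (-(n : ℝ)) n).ae_hasDerivAt_integral] with x hx hxn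
    have h1 := hx hxn (-(n : ℝ)) (by simp)
    have : u = fun x => u (-(n : ℝ)) + ∫ t in (-(n : ℝ))..x, w t :=
      funext fun x => h.eq_add _ x
    rw [this]
    exact h1.const_add _
  rw [← ae_all_iff] at key
  filter_upwards [key] with x hx
  obtain ⟨n, hn⟩ := exists_nat_ge |x|
  exact hx n (by
    rw [Set.uIcc_of_le (by linarith [abs_nonneg x])]
    exact abs_le.mp hn)

theorem unique (h : AC u w) (h' : AC u z) : w =ᵐ[volume] z := by
  filter_upwards [h.ae_hasDerivAt, h'.ae_hasDerivAt] with x h1 h2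
  exact h1.unique h2

theorem real_mul {f g : ℝ → ℝ} {a b : ℝ} (hf : IntervalIntegrable f volume a b)
    (hg : IntervalIntegrable g volume a b) {p q : ℝ → ℝ}
    (hp : ∀ x, p x = p a + ∫ t in a..x, f t) (hq : ∀ x, q x = q a + ∫ t in a..x, g t) :
    ∫ x in a..b, (f x * q x + p x * g x) = p b * q b - p a * q a := by
  have hp' : p = fun x => p a + ∫ t in a..x, f t := funext hp
  have hq' : q = fun x => q a + ∫ t in a..x, g t := funext hq
  have ca : ∀ k : ℝ, AbsolutelyContinuousOnInterval (fun _ : ℝ => k) a b := fun k =>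
    contDiffOn_const.absolutelyContinuousOnInterval
  have hpa : AbsolutelyContinuousOnInterval p a b := by
    rw [hp']
    exact (ca _).add (hf.absolutelyContinuousOnInterval_intervalIntegral Set.left_mem_uIcc)
  have hqa : AbsolutelyContinuousOnInterval q a b := by
    rw [hq']
    exact (ca _).add (hg.absolutelyContinuousOnInterval_intervalIntegral Set.left_mem_uIcc)
  rw [← hpa.integral_deriv_mul_eq_sub hqa]
  apply intervalIntegral.integral_congr_ae
  filter_upwards [hf.ae_hasDerivAt_integral, hg.ae_hasDerivAt_integral] with x h1 h2 hx
  have hx' := Set.uIoc_subset_uIcc hx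
  have e1 : deriv p x = f x := by
    rw [hp']; exact ((h1 hx' a Set.left_mem_uIcc).const_add _).deriv
  have e2 : deriv q x = g x := by
    rw [hq']; exact ((h2 hx' a Set.left_mem_uIcc).const_add _).deriv
  rw [e1, e2]

theorem locInt_mul_cont {f g : ℝ → ℂ} (hf : LocallyIntegrable f volume) (hg : Continuous g) :
    LocallyIntegrable (fun x => f x * g x) volume := by
  rw [locallyIntegrable_iff] at hf ⊢
  intro k hk
  exact (hf k hk).mul_continuousOn hg.continuousOn hk

/-- The complex rule is assembled from four instances of `real_mul`, one for each pairing of real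
and imaginary parts. -/
theorem mul (h : AC u w) (h' : AC v z) :
    AC (fun x => u x * v x) (fun x => w x * v x + u x * z x) := by
  have li : LocallyIntegrable (fun x => w x * v x + u x * z x) volume := by
    refine (locInt_mul_cont h.1 h'.continuous).add ?_
    simpa [mul_comm] using locInt_mul_cont h'.1 h.continuous
  refine ⟨li, fun a b => ?_⟩
  have re (f : ℝ → ℂ) (hf : ∀ a b, IntervalIntegrable f volume a b) :
      ∀ a b, IntervalIntegrable (fun x => (f x).re) volume a b ∧
        (∫ x in a..b, f x).re = ∫ x in a..b, (f x).re := fun a b =>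
    ⟨⟨Complex.reCLM.integrable_comp (hf a b).1, Complex.reCLM.integrable_comp (hf a b).2⟩,
      (Complex.reCLM.intervalIntegral_comp_comm (hf a b)).symm⟩
  have im (f : ℝ → ℂ) (hf : ∀ a b, IntervalIntegrable f volume a b) :
      ∀ a b, IntervalIntegrable (fun x => (f x).im) volume a b ∧
        (∫ x in a..b, f x).im = ∫ x in a..b, (f x).im := fun a b =>
    ⟨⟨Complex.imCLM.integrable_comp (hf a b).1, Complex.imCLM.integrable_comp (hf a b).2⟩,
      (Complex.imCLM.intervalIntegral_comp_comm (hf a b)).symm⟩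
  have wr := re w h.intervalIntegrable
  have wi := im w h.intervalIntegrable
  have zr := re z h'.intervalIntegrable
  have zi := im z h'.intervalIntegrable
  have ur : ∀ x, (u x).re = (u a).re + ∫ t in a..x, (w t).re := fun x => by
    rw [← (wr a x).2, ← Complex.add_re, ← h.eq_add]
  have ui : ∀ x, (u x).im = (u a).im + ∫ t in a..x, (w t).im := fun x => by
    rw [← (wi a x).2, ← Complex.add_im, ← h.eq_add]
  have vr : ∀ x, (v x).re = (v a).re + ∫ t in a..x, (z t).re := fun x => by
    rw [← (zr a x).2, ← Complex.add_re, ← h'.eq_add]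
  have vi : ∀ x, (v x).im = (v a).im + ∫ t in a..x, (z t).im := fun x => by
    rw [← (zi a x).2, ← Complex.add_im, ← h'.eq_add]
  have rr := real_mul (wr a b).1 (zr a b).1 ur vr
  have ri := real_mul (wr a b).1 (zi a b).1 ur vi
  have ir := real_mul (wi a b).1 (zr a b).1 ui vr
  have ii := real_mul (wi a b).1 (zi a b).1 ui vi
  have cu := h.continuous
  have cv := h'.continuous
  have int : ∀ {f g p q : ℝ → ℝ}, IntervalIntegrable f volume a b →
      IntervalIntegrable g volume a b → Continuous p → Continuous q →
      IntervalIntegrable (fun x => f x * q x + p x * g x) volume a b :=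
    fun hf hg hp hq => (hf.mul_continuousOn hq.continuousOn).add
      (hg.continuousOn_mul hp.continuousOn)
  have cur : Continuous fun x => (u x).re := by fun_prop
  have cui : Continuous fun x => (u x).im := by fun_prop
  have cvr : Continuous fun x => (v x).re := by fun_prop
  have cvi : Continuous fun x => (v x).im := by fun_prop
  apply Complex.ext
  · rw [((re _ (locInt_intervalIntegrable li)) a b).2]
    have e : ∀ x, (w x * v x + u x * z x).re =
        ((w x).re * (v x).re + (u x).re * (z x).re) -
        ((w x).im * (v x).im + (u x).im * (z x).im) := fun x => by
      simp only [Complex.add_re, Complex.mul_re]; ring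
    simp_rw [e]
    rw [intervalIntegral.integral_sub (int (wr a b).1 (zr a b).1 cur cvr)
      (int (wi a b).1 (zi a b).1 cui cvi), rr, ii]
    simp only [Complex.sub_re, Complex.mul_re]; ring
  · rw [((im _ (locInt_intervalIntegrable li)) a b).2]
    have e : ∀ x, (w x * v x + u x * z x).im =
        ((w x).re * (v x).im + (u x).re * (z x).im) +
        ((w x).im * (v x).re + (u x).im * (z x).re) := fun x => by
      simp only [Complex.add_im, Complex.mul_im]; ring
    simp_rw [e]
    rw [intervalIntegral.integral_add (int (wr a b).1 (zi a b).1 cur cvi)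
      (int (wi a b).1 (zr a b).1 cui cvr), ri, ir]
    simp only [Complex.sub_im, Complex.mul_im]; ring

end AC

end JostSolution

end

/-! ### Weak derivatives and absolutely continuous representatives -/

open MeasureTheory Filter Topology

noncomputable section

namespace JostSolution

theorem locInt_mul_test {f : ℝ → ℂ} (hf : LocallyIntegrable f volume) {φ : ℝ → ℝ}
    (hφ : Continuous φ) (hc : HasCompactSupport φ) :
    Integrable (fun x => (φ x : ℂ) * f x) volume := by
  have := hf.integrable_smul_left_of_hasCompactSupport hφ hc
  simpa [Complex.real_smul] using this

theorem AC.of_test {φ : ℝ → ℝ} (hφ : ContDiff ℝ (⊤ : ℕ∞) φ) :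
    AC (fun x => (φ x : ℂ)) (fun x => ((deriv φ x : ℝ) : ℂ)) := by
  refine AC.of_hasDerivAt (fun x => ?_) ?_
  · exact ((hφ.differentiable (by simp)) x).hasDerivAt.ofReal_comp
  · exact Complex.continuous_ofReal.comp (hφ.continuous_deriv (by simp))

theorem integral_eq_zero_of_AC_compact {u w : ℝ → ℂ} (h : AC u w) (hc : HasCompactSupport u) :
    ∫ x, w x = 0 := by
  obtain ⟨R, hR⟩ := hc.isCompact.isBounded.subset_closedBall 0
  have hz : ∀ x, R < |x| → u x = 0 := fun x hx => by
    by_contra h0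
    have := hR (subset_tsupport _ h0)
    simp at this
    linarith
  have hw : ∀ᵐ x, R < |x| → w x = 0 := by
    filter_upwards [h.ae_hasDerivAt] with x hx hRx
    have h0 : HasDerivAt u 0 x := by
      refine (hasDerivAt_const x (0 : ℂ)).congr_of_eventuallyEq ?_
      filter_upwards [(isOpen_lt continuous_const continuous_abs).mem_nhds hRx] with y hy
      exact hz y hy
    exact hx.unique h0
  have e : ∫ x, w x = ∫ x in Set.Ioc (-(|R| + 1)) (|R| + 1), w x := by
    refine (setIntegral_eq_integral_of_ae_compl_eq_zero ?_).symm
    filter_upwards [hw] with x hx hxn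
    apply hx
    by_contra hle
    push Not at hle
    have h3 := abs_le.mp (hle.trans (le_abs_self R))
    exact hxn ⟨by linarith [h3.1], by linarith [h3.2]⟩
  rw [e, ← intervalIntegral.integral_of_le (by linarith [abs_nonneg R]), ← h.2,
    hz _ (by rw [abs_of_pos (by positivity)]; linarith [le_abs_self R]),
    hz _ (by rw [abs_neg, abs_of_pos (by positivity)]; linarith [le_abs_self R]), sub_zero]

theorem AC.integral_test {u w : ℝ → ℂ} (h : AC u w) {φ : ℝ → ℝ}
    (hφ : ContDiff ℝ (⊤ : ℕ∞) φ) (hc : HasCompactSupport φ) :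
    ∫ x, ((deriv φ x : ℝ) : ℂ) * u x = -∫ x, (φ x : ℂ) * w x := by
  have h1 := (AC.of_test hφ).mul h
  have h2 := integral_eq_zero_of_AC_compact h1 (by
    have : HasCompactSupport fun x => (φ x : ℂ) :=
      hc.comp_left (g := fun x : ℝ => (x : ℂ)) (by simp)
    exact this.mul_right)
  rw [integral_add (locInt_mul_test h.locallyIntegrable (hφ.continuous_deriv (by simp)) hc.deriv)
    (locInt_mul_test h.1 hφ.continuous hc)] at h2
  linear_combination h2

theorem AC.hasWeakDeriv {u w : ℝ → ℂ} (h : AC u w) : HasWeakDeriv 1 u w := by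
  refine ⟨h.locallyIntegrable, h.1, fun φ hφ hc => ?_⟩
  simp only [iteratedDeriv_one, pow_one, neg_mul, one_mul]
  exact h.integral_test hφ hc

theorem contDiff_deriv_test {φ : ℝ → ℝ} (hφ : ContDiff ℝ (⊤ : ℕ∞) φ) :
    ContDiff ℝ (⊤ : ℕ∞) (deriv φ) :=
  (contDiff_infty_iff_deriv.mp hφ).2

theorem AC.hasWeakDeriv_two {u u₁ u₂ : ℝ → ℂ} (h : AC u u₁) (h₁ : AC u₁ u₂) :
    HasWeakDeriv 2 u u₂ := by
  refine ⟨h.locallyIntegrable, h₁.1, fun φ hφ hc => ?_⟩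
  rw [iteratedDeriv_succ, iteratedDeriv_one, h.integral_test (contDiff_deriv_test hφ) hc.deriv,
    h₁.integral_test hφ hc]
  ring

theorem HasWeakDeriv.congr_left {n : ℕ} {f f' g : ℝ → ℂ} (h : HasWeakDeriv n f g)
    (e : f =ᵐ[volume] f') : HasWeakDeriv n f' g := by
  refine ⟨?_, h.2.1, fun φ hφ hc => ?_⟩
  · intro x
    obtain ⟨s, hs, hi⟩ := h.1 x
    exact ⟨s, hs, hi.congr (ae_restrict_of_ae e)⟩
  · rw [← h.2.2 φ hφ hc]
    exact integral_congr_ae (e.mono fun x hx => by simp [hx])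

theorem HasWeakDeriv.unique {n : ℕ} {f g g' : ℝ → ℂ} (h : HasWeakDeriv n f g)
    (h' : HasWeakDeriv n f g') : g =ᵐ[volume] g' := by
  refine ae_eq_of_integral_contDiff_smul_eq h.2.1 h'.2.1 fun φ hφ hc => ?_
  have := (h.2.2 φ hφ hc).symm.trans (h'.2.2 φ hφ hc)
  simp only [Complex.real_smul]
  exact mul_left_cancel₀ (pow_ne_zero _ (by norm_num)) this

theorem weakDeriv_eq {n : ℕ} {f g : ℝ → ℂ} (h : HasWeakDeriv n f g) :
    weakDeriv n f =ᵐ[volume] g := by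
  have hex : ∃ g, HasWeakDeriv n f g := ⟨g, h⟩
  rw [weakDeriv, dif_pos hex]
  exact hex.choose_spec.unique h

/-- A test function with vanishing integral is the derivative of a test function. -/
theorem exists_test_antideriv {ψ : ℝ → ℝ} (hψ : ContDiff ℝ (⊤ : ℕ∞) ψ) (hc : HasCompactSupport ψ)
    (h0 : ∫ x, ψ x = 0) :
    ∃ φ : ℝ → ℝ, ContDiff ℝ (⊤ : ℕ∞) φ ∧ HasCompactSupport φ ∧ deriv φ = ψ := by
  obtain ⟨R, hR⟩ := hc.isCompact.isBounded.subset_closedBall 0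
  have hz : ∀ x, R < |x| → ψ x = 0 := fun x hx => by
    by_contra h0
    have := hR (subset_tsupport _ h0)
    simp at this
    linarith
  set φ : ℝ → ℝ := fun x => ∫ t in (-(|R| + 1))..x, ψ t with hφ
  have hd : ∀ x, HasDerivAt φ (ψ x) x := fun x =>
    intervalIntegral.integral_hasDerivAt_right (hψ.continuous.intervalIntegrable _ _)
      hψ.continuous.stronglyMeasurable.stronglyMeasurableAtFilter hψ.continuous.continuousAt
  have hd' : deriv φ = ψ := funext fun x => (hd x).deriv
  refine ⟨φ, ?_, ?_, hd'⟩
  · rw [contDiff_infty_iff_deriv, hd']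
    exact ⟨fun x => (hd x).differentiableAt, hψ⟩
  · refine HasCompactSupport.intro (isCompact_Icc (a := -(|R| + 1)) (b := |R| + 1)) fun x hx => ?_
    rw [Set.mem_Icc, not_and_or, not_le, not_le] at hx
    have hRR := le_abs_self R
    have hR0 := abs_nonneg R
    rcases hx with hx | hx
    · refine intervalIntegral.integral_zero_ae (Eventually.of_forall fun t ht => hz t ?_)
      rw [Set.uIoc_of_ge hx.le] at ht
      have : t ≤ -(|R| + 1) := ht.2
      rw [abs_of_neg (by linarith)]; linarith
    · rw [hφ]
      simp only
      rw [intervalIntegral.integral_of_le (by linarith), ← h0]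
      refine setIntegral_eq_integral_of_forall_compl_eq_zero fun t ht => hz t ?_
      by_contra hle
      push Not at hle
      have h3 := abs_le.mp (hle.trans hRR)
      exact ht ⟨by linarith [h3.1], by linarith [h3.2]⟩

theorem exists_bump : ∃ ρ : ℝ → ℝ, ContDiff ℝ (⊤ : ℕ∞) ρ ∧ HasCompactSupport ρ ∧
    ∫ x, ρ x = 1 := by
  let b : ContDiffBump (0 : ℝ) := ⟨1, 2, by norm_num, by norm_num⟩
  exact ⟨b.normed volume, b.contDiff_normed, b.hasCompactSupport_normed, b.integral_normed⟩

/-- Test functions of mass zero are derivatives of test functions, so subtracting the mass times a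
fixed bump makes any test function a derivative. The bump is what fixes the integration constants
below. -/
theorem exists_test_decomp {ρ ψ : ℝ → ℝ} (hρ : ContDiff ℝ (⊤ : ℕ∞) ρ) (hρc : HasCompactSupport ρ)
    (hρ1 : ∫ x, ρ x = 1) (hψ : ContDiff ℝ (⊤ : ℕ∞) ψ) (hc : HasCompactSupport ψ) :
    ∃ φ : ℝ → ℝ, ContDiff ℝ (⊤ : ℕ∞) φ ∧ HasCompactSupport φ ∧
      ∀ x, deriv φ x = ψ x - (∫ y, ψ y) * ρ x := by
  have h1 : ContDiff ℝ (⊤ : ℕ∞) fun x => ψ x - (∫ y, ψ y) * ρ x :=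
    hψ.sub (contDiff_const.mul hρ)
  obtain ⟨φ, a, b, e⟩ := exists_test_antideriv h1 (hc.sub hρc.mul_left) (by
    rw [integral_sub (hψ.continuous.integrable_of_hasCompactSupport hc)
      ((hρ.continuous.integrable_of_hasCompactSupport hρc).const_mul _), integral_const_mul, hρ1]
    ring)
  exact ⟨φ, a, b, fun x => by rw [e]⟩

/-- Du Bois-Reymond: `f` minus a primitive `F` of `g` annihilates derivatives of test functions, so
it pairs with any `ψ` through `∫ ψ` alone and is constant. -/
theorem HasWeakDeriv.exists_AC {f g : ℝ → ℂ} (h : HasWeakDeriv 1 f g) :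
    ∃ u, u =ᵐ[volume] f ∧ AC u g := by
  obtain ⟨ρ, hρ, hρc, hρ1⟩ := exists_bump
  have hF := AC.primitive h.2.1 0 0
  set F : ℝ → ℂ := fun x => 0 + ∫ t in (0 : ℝ)..x, g t with hFd
  set k : ℂ := ∫ x, (ρ x : ℂ) * (f x - F x) with hk
  have hd : LocallyIntegrable (fun x => f x - F x) volume := h.1.sub hF.locallyIntegrable
  have key : f =ᵐ[volume] fun x => k + F x := by
    have : (fun x => f x - F x) =ᵐ[volume] fun _ => k := by
      refine ae_eq_of_integral_contDiff_smul_eq hd (locallyIntegrable_const k)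
        fun ψ hψ hc => ?_
      obtain ⟨φ, hφ, hφc, e⟩ := exists_test_decomp hρ hρc hρ1 hψ hc
      have h1 := h.2.2 φ hφ hφc
      have h2 := hF.integral_test hφ hφc
      simp only [iteratedDeriv_one, pow_one, neg_mul, one_mul] at h1
      have h3 : ∫ x, ((deriv φ x : ℝ) : ℂ) * (f x - F x) = 0 := by
        simp_rw [mul_sub]
        rw [integral_sub (locInt_mul_test h.1 (hφ.continuous_deriv (by simp)) hφc.deriv)
          (locInt_mul_test hF.locallyIntegrable (hφ.continuous_deriv (by simp)) hφc.deriv),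
          h1, h2, sub_self]
      simp only [Complex.real_smul]
      have h4 : ∀ x, ((deriv φ x : ℝ) : ℂ) * (f x - F x) =
          (ψ x : ℂ) * (f x - F x) - ((∫ y, ψ y : ℝ) : ℂ) * ((ρ x : ℂ) * (f x - F x)) := by
        intro x
        rw [e]
        push_cast
        ring
      simp_rw [h4] at h3
      rw [integral_sub (locInt_mul_test hd hψ.continuous hc)
        ((locInt_mul_test hd hρ.continuous hρc).const_mul _), integral_const_mul, ← hk] at h3
      rw [integral_mul_const, integral_complex_ofReal]
      linear_combination h3
    filter_upwards [this] with x hx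
    rw [← hx]; ring
  refine ⟨fun x => k + F x, key.symm, ?_⟩
  simpa using (AC.const k).add hF

/-- `HasWeakDeriv 2` says nothing about a first derivative. One is built as a primitive `G - k` of
`g`, after which the first-order lemma applies. -/
theorem HasWeakDeriv.exists_AC_two {f g : ℝ → ℂ} (h : HasWeakDeriv 2 f g) :
    ∃ u u₁, u =ᵐ[volume] f ∧ AC u u₁ ∧ AC u₁ g := by
  obtain ⟨ρ, hρ, hρc, hρ1⟩ := exists_bump
  have hG := AC.primitive h.2.1 0 0
  set G : ℝ → ℂ := fun x => 0 + ∫ t in (0 : ℝ)..x, g t with hGd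
  -- The constant forced by testing `f' = G - k` against `ρ`.
  set k : ℂ := (∫ x, ((deriv ρ x : ℝ) : ℂ) * f x) + ∫ x, (ρ x : ℂ) * G x with hk
  have hGk : AC (fun x => G x - k) g := by simpa using hG.sub (AC.const k)
  have h1 : HasWeakDeriv 1 f (fun x => G x - k) := by
    refine ⟨h.1, hGk.locallyIntegrable, fun ψ hψ hc => ?_⟩
    obtain ⟨φ, hφ, hφc, e⟩ := exists_test_decomp hρ hρc hρ1 hψ hc
    have h2 := h.2.2 φ hφ hφc
    have h3 := hG.integral_test hφ hφc
    have e2 : ∀ x, iteratedDeriv 2 φ x = deriv ψ x - (∫ y, ψ y) * deriv ρ x := by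
      intro x
      rw [iteratedDeriv_succ, iteratedDeriv_one, funext e]
      rw [deriv_fun_sub (hψ.differentiable (by simp) x)
        ((hρ.differentiable (by simp) x).const_mul _), deriv_const_mul_field]
    simp_rw [e2] at h2
    simp_rw [e] at h3
    simp only [Complex.ofReal_sub, Complex.ofReal_mul, sub_mul, mul_assoc] at h2 h3
    rw [integral_sub (locInt_mul_test h.1 (hψ.continuous_deriv (by simp)) hc.deriv)
      ((locInt_mul_test h.1 (hρ.continuous_deriv (by simp)) hρc.deriv).const_mul _),
      integral_const_mul] at h2
    rw [integral_sub (locInt_mul_test hG.locallyIntegrable hψ.continuous hc)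
      ((locInt_mul_test hG.locallyIntegrable hρ.continuous hρc).const_mul _),
      integral_const_mul] at h3
    simp only [iteratedDeriv_one, pow_one, neg_mul, one_mul, mul_sub]
    rw [integral_sub (locInt_mul_test hG.locallyIntegrable hψ.continuous hc)
      (locInt_mul_test (locallyIntegrable_const k) hψ.continuous hc), integral_mul_const,
      integral_complex_ofReal]
    rw [hk]
    linear_combination h2 + h3
  obtain ⟨u, hu, hu1⟩ := h1.exists_AC
  exact ⟨u, _, hu, hu1, hGk⟩

theorem hasWeakDeriv_zero {f : ℝ → ℂ} (hf : LocallyIntegrable f volume) : HasWeakDeriv 0 f f :=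
  ⟨hf, hf, fun φ _ _ => by simp⟩

theorem HasWeakDeriv.ae_eq_zero {f g : ℝ → ℂ} (h : HasWeakDeriv 0 f g) : g =ᵐ[volume] f :=
  h.unique (hasWeakDeriv_zero h.1)

end JostSolution

end

/-! ### Sobolev spaces of real order -/

open MeasureTheory Filter Topology

noncomputable section

namespace JostSolution

open scoped SchwartzMap LineDeriv FourierTransform

theorem MemH.memLp {r : ℝ} {f : ℝ → ℂ} (h : MemH r f) : MemLp f 2 volume := h.1

theorem MemH.congr {r : ℝ} {f g : ℝ → ℂ} (h : MemH r f) (e : f =ᵐ[volume] g) : MemH r g := by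
  obtain ⟨h1, h2⟩ := h
  refine ⟨(memLp_congr_ae e).mp h1, ?_⟩
  have : ((memLp_congr_ae e).mp h1).toLp g = h1.toLp f := MemLp.toLp_congr _ _ e.symm
  rwa [this]

theorem MemH.mono {r s : ℝ} {f : ℝ → ℂ} (h : MemH r f) (hs : s ≤ r) : MemH s f :=
  ⟨h.1, h.2.mono hs⟩

theorem memH_zero_iff {f : ℝ → ℂ} : MemH 0 f ↔ MemLp f 2 volume := by
  refine ⟨fun h => h.1, fun h => ⟨h, ?_⟩⟩
  rw [TemperedDistribution.memSobolev_zero_iff]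
  exact ⟨_, rfl⟩

theorem MemH.add {r : ℝ} {f g : ℝ → ℂ} (hf : MemH r f) (hg : MemH r g) :
    MemH r (fun x => f x + g x) := by
  obtain ⟨a, ha⟩ := hf
  obtain ⟨b, hb⟩ := hg
  refine ⟨a.add b, ?_⟩
  have := ha.add hb
  rw [← Lp.toTemperedDistributionCLM_apply, ← Lp.toTemperedDistributionCLM_apply, ← map_add,
    ← MemLp.toLp_add] at this
  exact this

theorem MemH.const_mul {r : ℝ} {f : ℝ → ℂ} (hf : MemH r f) (k : ℂ) :
    MemH r (fun x => k * f x) := by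
  obtain ⟨a, ha⟩ := hf
  refine ⟨a.const_mul k, ?_⟩
  have := ha.smul k
  rw [← Lp.toTemperedDistributionCLM_apply, ← map_smul, ← MemLp.toLp_const_smul] at this
  exact this

theorem MemH.neg {r : ℝ} {f : ℝ → ℂ} (hf : MemH r f) : MemH r (fun x => -f x) := by
  simpa using hf.const_mul (-1)

theorem MemH.sub {r : ℝ} {f g : ℝ → ℂ} (hf : MemH r f) (hg : MemH r g) :
    MemH r (fun x => f x - g x) := by
  simpa [sub_eq_add_neg] using hf.add hg.neg

theorem memLp_two_sq_integrable {f : ℝ → ℂ} (h : MemLp f 2 volume) :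
    Integrable (fun x => ‖f x‖ ^ 2) volume :=
  (memLp_two_iff_integrable_sq_norm h.1).mp h

theorem norm_le_of_AC {u w : ℝ → ℂ} (h : AC u w) (x : ℝ) :
    ‖u x‖ ≤ (∫ t in x..(x + 1), ‖u t‖) + ∫ t in x..(x + 1), ‖w t‖ := by
  have hu := h.continuous.norm.intervalIntegrable (μ := volume) x (x + 1)
  have hb : ∀ t ∈ Set.Icc x (x + 1), ‖u x‖ ≤ ‖u t‖ + ∫ t in x..(x + 1), ‖w t‖ := by
    intro t ht
    have h1 : u x = u t - ∫ s in x..t, w s := by rw [← h.2]; ring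
    have h2 : ‖∫ s in x..t, w s‖ ≤ ∫ s in x..(x + 1), ‖w s‖ := by
      refine (intervalIntegral.norm_integral_le_integral_norm ht.1).trans ?_
      exact intervalIntegral.integral_mono_interval le_rfl ht.1 ht.2
        (Eventually.of_forall fun _ => norm_nonneg _) (h.intervalIntegrable _ _).norm
    calc ‖u x‖ ≤ ‖u t‖ + ‖∫ s in x..t, w s‖ := by rw [h1]; exact norm_sub_le _ _
      _ ≤ _ := by gcongr
  have := intervalIntegral.integral_mono_on (by linarith) (intervalIntegrable_const (c := ‖u x‖))
    (hu.add intervalIntegrable_const) hb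
  rw [intervalIntegral.integral_add hu intervalIntegrable_const] at this
  simpa using this

/-- One-dimensional Sobolev embedding. Only boundedness is wanted, so `|f| ≤ 1 + |f|²` on unit
intervals stands in for Cauchy–Schwarz. -/
theorem bounded_of_AC_memLp {u w : ℝ → ℂ} (h : AC u w) (hu : MemLp u 2 volume)
    (hw : MemLp w 2 volume) : ∃ C, ∀ x, ‖u x‖ ≤ C := by
  have key : ∀ {f : ℝ → ℂ}, LocallyIntegrable f volume → MemLp f 2 volume → ∀ x : ℝ,
      ∫ t in x..(x + 1), ‖f t‖ ≤ 1 + ∫ t, ‖f t‖ ^ 2 := by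
    intro f hl hf x
    have hsq := memLp_two_sq_integrable hf
    calc ∫ t in x..(x + 1), ‖f t‖ ≤ ∫ t in x..(x + 1), (1 + ‖f t‖ ^ 2) := by
          refine intervalIntegral.integral_mono_on (by linarith)
            (locInt_intervalIntegrable hl _ _).norm
            (intervalIntegrable_const.add hsq.intervalIntegrable) fun t _ => ?_
          nlinarith [sq_nonneg (‖f t‖ - 1), norm_nonneg (f t)]
      _ = 1 + ∫ t in x..(x + 1), ‖f t‖ ^ 2 := by
          rw [intervalIntegral.integral_add intervalIntegrable_const hsq.intervalIntegrable]
          simp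
      _ ≤ 1 + ∫ t, ‖f t‖ ^ 2 := by
          gcongr
          rw [intervalIntegral.integral_of_le (by linarith)]
          exact setIntegral_le_integral hsq (Eventually.of_forall fun _ => by positivity)
  exact ⟨_, fun x => (norm_le_of_AC h x).trans
    (add_le_add (key h.locallyIntegrable hu x) (key h.1 hw x))⟩

theorem toTemp_apply {f : ℝ → ℂ} (h : MemLp f 2 volume) (φ : 𝓢(ℝ, ℂ)) :
    Lp.toTemperedDistribution (h.toLp f) φ = ∫ x, φ x * f x := by
  rw [Lp.toTemperedDistribution_apply]
  refine integral_congr_ae ?_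
  filter_upwards [h.coeFn_toLp] with x hx
  rw [hx, smul_eq_mul]

theorem lineDeriv_one_apply (φ : 𝓢(ℝ, ℂ)) (x : ℝ) :
    (∂_{(1 : ℝ)} φ : 𝓢(ℝ, ℂ)) x = deriv φ x := by
  rw [SchwartzMap.lineDerivOp_apply_eq_fderiv]
  simp

/-- The distributional derivative lies in `H^r`, hence is an `L²` function because `r ≥ 0`;
restricting the test functions to compact support makes it a weak derivative. -/
theorem MemH.exists_AC {r : ℝ} (hr : 0 ≤ r) {f : ℝ → ℂ} (h : MemH (r + 1) f) :
    ∃ u u₁, u =ᵐ[volume] f ∧ AC u u₁ ∧ MemH r u₁ := by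
  obtain ⟨hf, hs⟩ := h
  have h1 := hs.lineDerivOp (m := (1 : ℝ))
  rw [add_sub_cancel_right] at h1
  obtain ⟨G, hG⟩ := TemperedDistribution.memSobolev_zero_iff.mp (h1.mono hr)
  have hGm : MemLp (G : ℝ → ℂ) 2 volume := Lp.memLp G
  have hGe : hGm.toLp (G : ℝ → ℂ) = G := Lp.toLp_coeFn G hGm
  have hMG : MemH r (G : ℝ → ℂ) := ⟨hGm, by rw [hGe, ← hG]; exact h1⟩
  have hw : HasWeakDeriv 1 f G := by
    refine ⟨hf.locallyIntegrable (by norm_num), hGm.locallyIntegrable (by norm_num),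
      fun φ hφ hc => ?_⟩
    have hφ' : ContDiff ℝ (⊤ : ℕ∞) fun x => (φ x : ℂ) := Complex.ofRealCLM.contDiff.comp hφ
    have hc' : HasCompactSupport fun x => (φ x : ℂ) :=
      
      hc.comp_left (g := fun x : ℝ => (x : ℂ)) (by simp)
    set Φ : 𝓢(ℝ, ℂ) := hc'.toSchwartzMap hφ' with hΦ
    have e1 : ∀ x, Φ x = (φ x : ℂ) := fun x => rfl
    have h2 := congrArg (fun T => T Φ) hG
    simp only [TemperedDistribution.lineDerivOp_apply_apply, map_neg] at h2
    rw [toTemp_apply hf, ← hGe, toTemp_apply hGm] at h2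
    simp only [iteratedDeriv_one, pow_one, neg_mul, one_mul]
    have e2 : ∀ x, (∂_{(1 : ℝ)} Φ : 𝓢(ℝ, ℂ)) x = ((deriv φ x : ℝ) : ℂ) := by
      intro x
      rw [lineDeriv_one_apply]
      exact ((hφ.differentiable (by simp) x).hasDerivAt.ofReal_comp).deriv
    simp_rw [e1, e2] at h2
    rw [← h2, neg_neg]
  obtain ⟨u, hu, hA⟩ := hw.exists_AC
  exact ⟨u, G, hu, hA, hMG⟩

theorem integral_schwartz_AC {u w : ℝ → ℂ} (h : AC u w) (hu : MemLp u 2 volume)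
    (hw : MemLp w 2 volume) (φ : 𝓢(ℝ, ℂ)) :
    ∫ x, φ x * w x = -∫ x, deriv φ x * u x := by
  have hφ : AC φ (deriv φ) := by
    refine AC.of_hasDerivAt (fun x => φ.differentiableAt.hasDerivAt) ?_
    exact (φ.smooth 1).continuous_deriv le_rfl
  have hp := hφ.mul h
  have hd : MemLp (deriv φ) 2 volume := by
    have : (deriv φ) = (∂_{(1 : ℝ)} φ : 𝓢(ℝ, ℂ)) := by
      ext x; rw [lineDeriv_one_apply]
    rw [this]
    exact SchwartzMap.memLp (∂_{(1 : ℝ)} φ : 𝓢(ℝ, ℂ)) 2 volume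
  have i1 : Integrable (fun x => deriv φ x * u x) volume := hd.integrable_mul hu
  have i2 : Integrable (fun x => φ x * w x) volume := (φ.memLp 2 volume).integrable_mul hw
  have t1 := intervalIntegral_tendsto_integral (i1.add i2) tendsto_neg_atTop_atBot tendsto_id
  -- The boundary terms vanish because `u` is bounded and `φ` tends to zero.
  have t2 : Tendsto (fun R : ℝ => φ R * u R - φ (-R) * u (-R)) atTop (𝓝 0) := by
    obtain ⟨C, hC⟩ := bounded_of_AC_memLp h hu hw
    have hz : Tendsto (fun x => φ x * u x) (cocompact ℝ) (𝓝 0) := by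
      refine squeeze_zero_norm (a := fun x => ‖φ x‖ * C) (fun x => ?_) ?_
      · rw [norm_mul]; gcongr; exact hC x
      · simpa using (φ.toZeroAtInfty.zero_at_infty').norm.mul_const C
    rw [cocompact_eq_atBot_atTop] at hz
    simpa using (hz.mono_left le_sup_right).sub
      ((hz.mono_left le_sup_left).comp tendsto_neg_atTop_atBot)
  have e : (fun R : ℝ => ∫ x in (-R)..(id R), ((fun x => deriv φ x * u x) + fun x => φ x * w x) x) =
      fun R : ℝ => φ R * u R - φ (-R) * u (-R) := by
    funext R
    exact (hp.2 (-R) R).symm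
  rw [e] at t1
  have := tendsto_nhds_unique t1 t2
  simp only [Pi.add_apply] at this
  rw [integral_add i1 i2] at this
  linear_combination this

/-- Gain of one order at any real `r`. With `⟨x⟩ = (1 + x²)^{1/2}`, the splitting `⟨x⟩ = ⟨x⟩⁻¹ + x ·
x⟨x⟩⁻¹` of symbols writes the Bessel potential of order `1` of `T` as the potential of order `-1` of
`T` plus a bounded multiplier applied to `T'`. -/
theorem MemH.of_AC {r : ℝ} {u u₁ : ℝ → ℂ} (h : AC u u₁) (hu : MemH r u)
    (hu₁ : MemH r u₁) : MemH (r + 1) u := by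
  obtain ⟨hm, hs⟩ := hu
  obtain ⟨hm₁, hs₁⟩ := hu₁
  refine ⟨hm, ?_⟩
  set T := Lp.toTemperedDistribution (hm.toLp u) with hT
  have hd : ∂_{(1 : ℝ)} T = Lp.toTemperedDistribution (hm₁.toLp u₁) := by
    ext φ
    rw [TemperedDistribution.lineDerivOp_apply_apply, map_neg, hT, toTemp_apply, toTemp_apply,
      integral_schwartz_AC h hm hm₁]
    simp_rw [lineDeriv_one_apply]
  rw [← hd] at hs₁
  rw [add_comm, ← TemperedDistribution.memSobolev_besselPotential_iff]
  have g1 : (fun x : ℝ => Complex.ofReal (x * (1 + ‖x‖ ^ 2) ^ (-1 / 2 : ℝ))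
      ).HasTemperateGrowth := by
    fun_prop
  have key : TemperedDistribution.besselPotential ℝ ℂ 1 T =
      TemperedDistribution.besselPotential ℝ ℂ (-1) T + (2 * Real.pi * Complex.I)⁻¹ •
        TemperedDistribution.fourierMultiplierCLM ℂ
          (fun x : ℝ => Complex.ofReal (x * (1 + ‖x‖ ^ 2) ^ (-1 / 2 : ℝ))) (∂_{(1 : ℝ)} T) := by
    rw [TemperedDistribution.lineDeriv_eq_fourierMultiplierCLM,
      ContinuousLinearMap.map_smul_of_tower,
      TemperedDistribution.fourierMultiplierCLM_fourierMultiplierCLM_apply (by fun_prop) g1,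
      smul_smul, inv_mul_cancel₀ (by simp [Real.pi_ne_zero]), one_smul]
    simp only [TemperedDistribution.besselPotential]
    have := TemperedDistribution.fourierMultiplierCLM_sum (E := ℝ) ℂ (s := Finset.univ)
      (g := ![fun x : ℝ => (((1 + ‖x‖ ^ 2) ^ ((-1 : ℝ) / 2) : ℝ) : ℂ),
        (fun x : ℝ => ((inner ℝ x (1 : ℝ) : ℝ) : ℂ)) *
          fun x : ℝ => Complex.ofReal (x * (1 + ‖x‖ ^ 2) ^ (-1 / 2 : ℝ))]) (by
        intro i _
        fin_cases i
        · simp only [Fin.zero_eta, Matrix.cons_val_zero]; fun_prop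
        · simp only [Fin.mk_one, Matrix.cons_val_one]
          refine Function.HasTemperateGrowth.mul ?_ g1
          fun_prop)
    simp only [Fin.sum_univ_two, Matrix.cons_val_zero, Matrix.cons_val_one] at this
    rw [← add_apply, ← this]
    congr 2
    ext x
    simp only [Pi.mul_apply]
    rw [← Complex.ofReal_mul, ← Complex.ofReal_add]
    congr 1
    have hp : (0 : ℝ) < 1 + x ^ 2 := by positivity
    have : (1 + ‖x‖ ^ 2) = 1 + x ^ 2 := by simp
    rw [this]
    have e1 : (1 + x ^ 2) ^ ((1 : ℝ) / 2) = (1 + x ^ 2) * (1 + x ^ 2) ^ (-1 / 2 : ℝ) := by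
      nth_rw 2 [← Real.rpow_one (1 + x ^ 2)]
      rw [← Real.rpow_add hp]
      norm_num
    rw [e1]
    simp
    ring
  rw [key]
  refine TemperedDistribution.MemSobolev.add ?_ ?_
  · rw [TemperedDistribution.memSobolev_besselPotential_iff]
    exact hs.mono (by linarith)
  · refine TemperedDistribution.MemSobolev.smul _
      (hs₁.fourierMultiplierCLM_of_bounded g1 ⟨1, fun x => ?_⟩)
    rw [Complex.norm_real, norm_mul]
    have hp : (0 : ℝ) < 1 + x ^ 2 := by positivity
    have e1 : ‖(1 + ‖x‖ ^ 2) ^ (-1 / 2 : ℝ)‖ = (Real.sqrt (1 + x ^ 2))⁻¹ := by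
      rw [Real.norm_of_nonneg (by positivity), Real.sqrt_eq_rpow, ← Real.rpow_neg hp.le]
      norm_num
    rw [e1, mul_inv_le_iff₀ (by positivity), one_mul, Real.norm_eq_abs]
    exact Real.abs_le_sqrt (by linarith)

theorem MemH.fourier_ae {r : ℝ} {f : ℝ → ℂ} (h : MemH r f) :
    MemLp (fun k : ℝ => (((1 + ‖k‖ ^ 2) ^ (r / 2) : ℝ) : ℂ) * fourierL2 f k) 2 volume := by
  obtain ⟨hm, hs⟩ := h
  obtain ⟨G, hG⟩ := TemperedDistribution.memSobolev_iff_exists_smulLeftCLM_fourier.mp hs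
  have e0 : fourierL2 f = (𝓕 (hm.toLp f) : Lp ℂ 2 (volume : Measure ℝ)) := by
    rw [fourierL2, dif_pos hm]; rfl
  rw [Lp.fourier_toTemperedDistribution_eq] at hG
  set F : Lp ℂ 2 (volume : Measure ℝ) := 𝓕 (hm.toLp f) with hF
  have gr : (fun x : ℝ => (((1 + ‖x‖ ^ 2) ^ (r / 2) : ℝ) : ℂ)).HasTemperateGrowth := by fun_prop
  have hFm : MemLp (F : ℝ → ℂ) 2 volume := Lp.memLp F
  have hGm : MemLp (G : ℝ → ℂ) 2 volume := Lp.memLp G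
  have key : (fun k : ℝ => (((1 + ‖k‖ ^ 2) ^ (r / 2) : ℝ) : ℂ) * F k) =ᵐ[volume] G := by
    refine ae_eq_of_integral_contDiff_smul_eq ?_ (hGm.locallyIntegrable (by norm_num))
      fun φ hφ hc => ?_
    · simpa [mul_comm] using AC.locInt_mul_cont (hFm.locallyIntegrable (by norm_num))
        gr.1.continuous
    have hφ' : ContDiff ℝ (⊤ : ℕ∞) fun x => (φ x : ℂ) := Complex.ofRealCLM.contDiff.comp hφ
    have hc' : HasCompactSupport fun x => (φ x : ℂ) :=
      
      hc.comp_left (g := fun x : ℝ => (x : ℂ)) (by simp)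
    set Φ : 𝓢(ℝ, ℂ) := hc'.toSchwartzMap hφ' with hΦ
    have e1 : ∀ x, Φ x = (φ x : ℂ) := fun x => rfl
    have h2 := congrArg (fun T => T Φ) hG
    simp only [TemperedDistribution.smulLeftCLM_apply_apply, Lp.toTemperedDistribution_apply,
      SchwartzMap.smulLeftCLM_apply_apply gr, e1] at h2
    simp only [Complex.real_smul]
    simp only [smul_eq_mul] at h2
    rw [← h2]
    congr 1
    ext x
    ring
  rw [e0]
  exact (memLp_congr_ae key).mpr hGm

theorem sq_norm_integral_le_normH {r : ℝ} (hr : 0 ≤ r) {f : ℝ → ℂ} (h : MemH r f) :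
    Real.sqrt (∫ x, ‖f x‖ ^ 2) ≤ normH r f := by
  have hm := h.memLp
  have e0 : fourierL2 f = (𝓕 (hm.toLp f) : Lp ℂ 2 (volume : Measure ℝ)) := by
    rw [fourierL2, dif_pos hm]; rfl
  have hFm : MemLp (fourierL2 f) 2 volume := by rw [e0]; exact Lp.memLp _
  have e1 : ∫ x, ‖f x‖ ^ 2 = ∫ k, ‖fourierL2 f k‖ ^ 2 := by
    have n1 : ∀ g : Lp ℂ 2 (volume : Measure ℝ), ‖g‖ ^ 2 = ∫ x, ‖g x‖ ^ 2 := by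
      intro g
      have := L2.inner_def (𝕜 := ℂ) g g
      rw [inner_self_eq_norm_sq_to_K] at this
      have h2 : ∫ a, inner ℂ (g a) (g a) = ((∫ a, ‖g a‖ ^ 2 : ℝ) : ℂ) := by
        rw [← integral_complex_ofReal]
        congr 1
        ext a
        rw [inner_self_eq_norm_sq_to_K]
        simp
      rw [h2] at this
      exact Complex.ofReal_injective (by simpa using this)
    have := n1 (𝓕 (hm.toLp f))
    rw [Lp.norm_fourier_eq, n1, ← e0] at this
    rw [← this]
    refine integral_congr_ae ?_
    filter_upwards [hm.coeFn_toLp] with x hx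
    rw [hx]
  rw [e1, normH]
  refine Real.sqrt_le_sqrt (integral_mono (memLp_two_sq_integrable hFm) ?_ fun k => ?_)
  -- Integrability has to be shown, since the integral defining `normH` would otherwise take the
  -- default value zero. The weights compare by `1 + (2πk)² ≤ 4π²(1 + k²)`.
  · have h1 := memLp_two_sq_integrable h.fourier_ae
    refine Integrable.mono' (h1.const_mul ((4 * Real.pi ^ 2) ^ r)) ?_
      (Eventually.of_forall fun k => ?_)
    · refine AEStronglyMeasurable.mul ?_ (hFm.1.norm.pow 2)
      refine Continuous.aestronglyMeasurable ?_
      exact Continuous.rpow_const (by fun_prop) fun x => Or.inr hr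
    · rw [Real.norm_of_nonneg (by positivity), norm_mul (Complex.ofReal _),
        mul_pow ‖Complex.ofReal _‖, ← mul_assoc]
      gcongr
      have e2 : ((1 + ‖k‖ ^ 2) ^ (r / 2)) ^ 2 = (1 + ‖k‖ ^ 2) ^ r := by
        rw [← Real.rpow_natCast, ← Real.rpow_mul (by positivity)]
        norm_num
      rw [Complex.norm_real, Real.norm_of_nonneg (by positivity), e2,
        ← Real.mul_rpow (by positivity) (by positivity)]
      refine Real.rpow_le_rpow (by positivity) ?_ hr
      have := Real.pi_gt_three
      rw [Real.norm_eq_abs, sq_abs]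
      nlinarith
  · have : (1 : ℝ) ≤ (1 + (2 * Real.pi * k) ^ 2) ^ r :=
      Real.one_le_rpow (by nlinarith [sq_nonneg (2 * Real.pi * k)]) hr
    have h0 : 0 ≤ ‖fourierL2 f k‖ ^ 2 := by positivity
    simp only
    nlinarith

end JostSolution

end

/-! ### Multipliers, exponential weights, elliptic regularity and the wave profile -/

open MeasureTheory Filter Topology

noncomputable section

namespace JostSolution

/-- Bounded functions with `n` bounded continuous derivatives. -/
def SmoothBdd : ℕ → (ℝ → ℂ) → Prop
  | 0, b => Continuous b ∧ ∃ C, ∀ x, ‖b x‖ ≤ C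
  | n + 1, b => (∃ C, ∀ x, ‖b x‖ ≤ C) ∧ ∃ b', (∀ x, HasDerivAt b (b' x) x) ∧ SmoothBdd n b'

namespace SmoothBdd

theorem bounded {n : ℕ} {b : ℝ → ℂ} (h : SmoothBdd n b) : ∃ C, ∀ x, ‖b x‖ ≤ C := by
  cases n with
  | zero => exact h.2
  | succ n => exact h.1

theorem continuous {n : ℕ} {b : ℝ → ℂ} (h : SmoothBdd n b) : Continuous b := by
  cases n with
  | zero => exact h.1
  | succ n =>
    obtain ⟨_, b', hb, _⟩ := h
    exact continuous_iff_continuousAt.mpr fun x => (hb x).continuousAt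

theorem pred {n : ℕ} : ∀ {b : ℝ → ℂ}, SmoothBdd (n + 1) b → SmoothBdd n b := by
  induction n with
  | zero => exact fun h => ⟨h.continuous, h.1⟩
  | succ n ih =>
    rintro b ⟨h1, b', h2, h3⟩
    exact ⟨h1, b', h2, ih h3⟩

theorem const (k : ℂ) (n : ℕ) : SmoothBdd n (fun _ => k) := by
  induction n generalizing k with
  | zero => exact ⟨continuous_const, ‖k‖, fun _ => le_rfl⟩
  | succ n ih => exact ⟨⟨‖k‖, fun _ => le_rfl⟩, fun _ => 0, fun x => hasDerivAt_const x k, ih 0⟩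

theorem add {n : ℕ} : ∀ {a b : ℝ → ℂ}, SmoothBdd n a → SmoothBdd n b →
    SmoothBdd n (fun x => a x + b x) := by
  have bd : ∀ {a b : ℝ → ℂ}, (∃ C, ∀ x, ‖a x‖ ≤ C) → (∃ C, ∀ x, ‖b x‖ ≤ C) →
      ∃ C, ∀ x, ‖a x + b x‖ ≤ C := by
    rintro a b ⟨C, hC⟩ ⟨D, hD⟩
    exact ⟨C + D, fun x => (norm_add_le _ _).trans (add_le_add (hC x) (hD x))⟩
  induction n with
  | zero => exact fun h h' => ⟨h.1.add h'.1, bd h.2 h'.2⟩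
  | succ n ih =>
    rintro a b ⟨h1, a', h2, h3⟩ ⟨k1, b', k2, k3⟩
    exact ⟨bd h1 k1, _, fun x => (h2 x).add (k2 x), ih h3 k3⟩

theorem mul {n : ℕ} : ∀ {a b : ℝ → ℂ}, SmoothBdd n a → SmoothBdd n b →
    SmoothBdd n (fun x => a x * b x) := by
  have bd : ∀ {a b : ℝ → ℂ}, (∃ C, ∀ x, ‖a x‖ ≤ C) → (∃ C, ∀ x, ‖b x‖ ≤ C) →
      ∃ C, ∀ x, ‖a x * b x‖ ≤ C := by
    rintro a b ⟨C, hC⟩ ⟨D, hD⟩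
    refine ⟨C * D, fun x => ?_⟩
    rw [norm_mul]
    exact mul_le_mul (hC x) (hD x) (norm_nonneg _) ((norm_nonneg _).trans (hC x))
  induction n with
  | zero => exact fun h h' => ⟨h.1.mul h'.1, bd h.2 h'.2⟩
  | succ n ih =>
    intro a b ha hb
    have ha0 := ha.pred
    have hb0 := hb.pred
    obtain ⟨h1, a', h2, h3⟩ := ha
    obtain ⟨k1, b', k2, k3⟩ := hb
    exact ⟨bd h1 k1, _, fun x => (h2 x).mul (k2 x), (ih h3 hb0).add (ih ha0 k3)⟩

theorem const_mul {n : ℕ} {b : ℝ → ℂ} (h : SmoothBdd n b) (k : ℂ) :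
    SmoothBdd n (fun x => k * b x) := (const k n).mul h

theorem neg {n : ℕ} {b : ℝ → ℂ} (h : SmoothBdd n b) : SmoothBdd n (fun x => -b x) := by
  simpa using h.const_mul (-1)

theorem sub {n : ℕ} {a b : ℝ → ℂ} (h : SmoothBdd n a) (h' : SmoothBdd n b) :
    SmoothBdd n (fun x => a x - b x) := by
  simpa [sub_eq_add_neg] using h.add h'.neg

theorem comp_add {n : ℕ} (s : ℝ) : ∀ {b : ℝ → ℂ}, SmoothBdd n b →
    SmoothBdd n (fun x => b (x + s)) := by
  induction n with
  | zero =>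
    rintro b ⟨h, C, hC⟩
    exact ⟨by fun_prop, C, fun x => hC _⟩
  | succ n ih =>
    rintro b ⟨⟨C, hC⟩, b', h2, h3⟩
    exact ⟨⟨C, fun x => hC _⟩, _, fun x => (h2 (x + s)).comp_add_const x s, ih h3⟩

end SmoothBdd

theorem hasDerivAt_tanh (x : ℝ) : HasDerivAt Real.tanh (1 - Real.tanh x ^ 2) x := by
  have h := (Real.hasDerivAt_sinh x).div (Real.hasDerivAt_cosh x) (Real.cosh_pos x).ne'
  have e : Real.tanh = fun x => Real.sinh x / Real.cosh x := funext Real.tanh_eq_sinh_div_cosh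
  rw [e]
  convert! h using 1
  have := (Real.cosh_pos x).ne'
  field_simp

theorem abs_tanh_le_one (x : ℝ) : |Real.tanh x| ≤ 1 := by
  rw [Real.tanh_eq_sinh_div_cosh, abs_div, abs_of_pos (Real.cosh_pos x),
    div_le_one (Real.cosh_pos x)]
  refine abs_le_of_sq_le_sq ?_ (Real.cosh_pos x).le
  nlinarith [Real.cosh_sq x]

theorem SmoothBdd.tanh (n : ℕ) : SmoothBdd n (fun x => (Real.tanh x : ℂ)) := by
  have bd : ∃ C, ∀ x, ‖(Real.tanh x : ℂ)‖ ≤ C :=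
    ⟨1, fun x => by rw [Complex.norm_real]; exact abs_tanh_le_one x⟩
  induction n with
  | zero =>
    refine ⟨Complex.continuous_ofReal.comp (continuous_iff_continuousAt.mpr fun x =>
      (hasDerivAt_tanh x).continuousAt), bd⟩
  | succ n ih =>
    refine ⟨bd, fun x => 1 - (Real.tanh x : ℂ) * (Real.tanh x : ℂ), fun x => ?_,
      (SmoothBdd.const 1 n).sub (ih.mul ih)⟩
    have := (hasDerivAt_tanh x).ofReal_comp
    convert! this using 1
    push_cast
    ring

theorem cosh_add_le (x s : ℝ) : Real.cosh (x + s) ≤ Real.exp |s| * Real.cosh x := by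
  have h1 := Real.exp_le_exp.mpr (le_abs_self s)
  have h2 := Real.exp_le_exp.mpr (neg_le_abs s)
  have e1 : Real.exp (x + s) = Real.exp x * Real.exp s := Real.exp_add _ _
  have e2 : Real.exp (-(x + s)) = Real.exp (-x) * Real.exp (-s) := by
    rw [← Real.exp_add]; ring_nf
  rw [Real.cosh_eq, Real.cosh_eq, e1, e2]
  have p1 := Real.exp_pos x
  have p2 := Real.exp_pos (-x)
  nlinarith [mul_le_mul_of_nonneg_left h1 p1.le, mul_le_mul_of_nonneg_left h2 p2.le]

/-- The quotient `cosh^q(x) / cosh^q(x + s)`. -/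
def coshRatio (q s x : ℝ) : ℝ := Real.cosh x ^ q * Real.cosh (x + s) ^ (-q)

theorem coshRatio_pos (q s x : ℝ) : 0 < coshRatio q s x :=
  mul_pos (Real.rpow_pos_of_pos (Real.cosh_pos _) _) (Real.rpow_pos_of_pos (Real.cosh_pos _) _)

theorem coshRatio_le (q s x : ℝ) : coshRatio q s x ≤ Real.exp (|q| * |s|) := by
  have p1 := Real.cosh_pos x
  have p2 := Real.cosh_pos (x + s)
  have key : ∀ y z t : ℝ, 0 ≤ t → 0 < y → 0 < z → y ≤ Real.exp |s| * z →
      y ^ t * z ^ (-t) ≤ Real.exp (t * |s|) := by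
    intro y z t ht hy hz h
    rw [Real.rpow_neg hz.le, ← div_eq_mul_inv, ← Real.div_rpow hy.le hz.le, mul_comm,
      Real.exp_mul]
    refine Real.rpow_le_rpow (by positivity) ?_ ht
    rwa [div_le_iff₀ hz]
  rcases le_total 0 q with h | h
  · rw [abs_of_nonneg h]
    refine key _ _ q h p1 p2 ?_
    have := cosh_add_le (x + s) (-s)
    simpa using this
  · rw [abs_of_nonpos h, coshRatio, mul_comm]
    have := key _ _ (-q) (by linarith) p2 p1 (cosh_add_le x s)
    simpa using this

theorem hasDerivAt_cosh_rpow (q x : ℝ) : HasDerivAt (fun x => Real.cosh x ^ q)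
    (q * Real.tanh x * Real.cosh x ^ q) x := by
  have h := (Real.hasDerivAt_cosh x).rpow_const (p := q) (Or.inl (Real.cosh_pos x).ne')
  convert! h using 1
  rw [Real.tanh_eq_sinh_div_cosh, Real.rpow_sub_one (Real.cosh_pos x).ne']
  ring

/-- All derivatives stay bounded because the logarithmic derivative is `q (tanh x - tanh (x + s))`.
Consequently translations act on weighted Sobolev spaces up to a harmless multiplier. -/
theorem SmoothBdd.coshRatio (q s : ℝ) (n : ℕ) : SmoothBdd n (fun x => (coshRatio q s x : ℂ)) := by
  have bd : ∃ C, ∀ x, ‖(JostSolution.coshRatio q s x : ℂ)‖ ≤ C :=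
    ⟨_, fun x => by
      rw [Complex.norm_real, Real.norm_of_nonneg (coshRatio_pos q s x).le]
      exact coshRatio_le q s x⟩
  have hd : ∀ x, HasDerivAt (fun x => JostSolution.coshRatio q s x)
      (q * JostSolution.coshRatio q s x * (Real.tanh x - Real.tanh (x + s))) x := by
    intro x
    have h := (hasDerivAt_cosh_rpow q x).mul
      ((hasDerivAt_cosh_rpow (-q) (x + s)).comp_add_const x s)
    convert! h using 1
    simp only [JostSolution.coshRatio]
    ring
  induction n with
  | zero => exact ⟨Complex.continuous_ofReal.comp (continuous_iff_continuousAt.mpr fun x =>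
      (hd x).continuousAt), bd⟩
  | succ n ih =>
    refine ⟨bd, _, fun x => (hd x).ofReal_comp, ?_⟩
    have := (ih.const_mul q).mul ((SmoothBdd.tanh n).sub ((SmoothBdd.tanh n).comp_add s))
    simpa using this

/-- Multiplication is treated at integer orders only, by induction with the product rule. For real
`r` the products are formed at a nearby integer order and the order is lowered afterwards; this is
affordable because the factors being multiplied have derivatives to spare. -/
theorem SmoothBdd.mul_memH {n : ℕ} : ∀ {b f : ℝ → ℂ}, SmoothBdd n b → MemH n f →
    MemH n (fun x => b x * f x) := by
  have base : ∀ {n : ℕ} {b f : ℝ → ℂ}, SmoothBdd n b → MemLp f 2 volume →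
      MemLp (fun x => b x * f x) 2 volume := by
    intro n b f hb hf
    obtain ⟨C, hC⟩ := hb.bounded
    exact hf.of_le_mul (hb.continuous.aestronglyMeasurable.mul hf.1)
      (Eventually.of_forall fun x => by rw [norm_mul]; gcongr; exact hC x)
  induction n with
  | zero =>
    intro b f hb hf
    rw [Nat.cast_zero, memH_zero_iff] at hf ⊢
    exact base hb hf
  | succ n ih =>
    intro b f hb hf
    push_cast at hf ⊢
    obtain ⟨u, u₁, hu, hA, h1⟩ := hf.exists_AC (Nat.cast_nonneg n)
    have hbn := hb.pred
    have hun : MemH n u := (hf.mono (by linarith)).congr hu.symm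
    obtain ⟨_, b', hd, hb'⟩ := hb
    have hAb : AC b b' := AC.of_hasDerivAt hd hb'.continuous
    have := MemH.of_AC (hAb.mul hA) (ih hbn hun) ((ih hb' hun).add (ih hbn h1))
    exact this.congr (hu.mono fun x hx => by simp only [hx])

theorem ae_shift {p : ℝ → Prop} (h : ∀ᵐ x, p x) (s : ℝ) : ∀ᵐ x, p (x + s) :=
  (measurePreserving_add_right volume s).quasiMeasurePreserving.ae h

theorem ae_reflect {p : ℝ → Prop} (h : ∀ᵐ x, p x) : ∀ᵐ x, p (-x) :=
  (Measure.measurePreserving_neg (volume : Measure ℝ)).quasiMeasurePreserving.ae h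

theorem MemH.shift {n : ℕ} (s : ℝ) : ∀ {f : ℝ → ℂ}, MemH n f → MemH n (fun x => f (x + s)) := by
  have base : ∀ {f : ℝ → ℂ}, MemLp f 2 volume → MemLp (fun x => f (x + s)) 2 volume :=
    fun h => h.comp_measurePreserving (measurePreserving_add_right volume s)
  induction n with
  | zero =>
    intro f hf
    rw [Nat.cast_zero, memH_zero_iff] at hf ⊢
    exact base hf
  | succ n ih =>
    intro f hf
    push_cast at hf ⊢
    obtain ⟨u, u₁, hu, hA, h1⟩ := hf.exists_AC (Nat.cast_nonneg n)
    have hun : MemH n u := (hf.mono (by linarith)).congr hu.symm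
    exact (MemH.of_AC (hA.comp_add s) (ih hun) (ih h1)).congr (ae_shift hu s)

theorem coshMul_shift (q s : ℝ) (f : ℝ → ℂ) (x : ℝ) :
    coshMul q (fun y => f (y + s)) x = (coshRatio q s x : ℂ) * coshMul q f (x + s) := by
  have h : Real.cosh (x + s) ^ (-q) * Real.cosh (x + s) ^ q = 1 := by
    rw [← Real.rpow_add (Real.cosh_pos _)]; simp
  have h' : ((Real.cosh (x + s) ^ (-q) : ℝ) : ℂ) * ((Real.cosh (x + s) ^ q : ℝ) : ℂ) = 1 := by
    exact_mod_cast h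
  simp only [coshMul, coshRatio]
  push_cast [-Complex.ofReal_cosh]
  linear_combination -((Real.cosh x ^ q : ℝ) : ℂ) * f (x + s) * h'

theorem MemH.coshMul_shift {n : ℕ} {q : ℝ} {f : ℝ → ℂ} (h : MemH n (coshMul q f)) (s : ℝ) :
    MemH n (coshMul q fun y => f (y + s)) := by
  refine ((SmoothBdd.coshRatio q s n).mul_memH (h.shift s)).congr
    (Eventually.of_forall fun x => ?_)
  exact (JostSolution.coshMul_shift q s f x).symm

theorem coshMul_zero (f : ℝ → ℂ) : coshMul 0 f = f := by
  ext x; simp [coshMul]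

theorem hasDerivAt_cosh_rpow_complex (q x : ℝ) :
    HasDerivAt (fun x => ((Real.cosh x ^ q : ℝ) : ℂ))
      ((q : ℂ) * Real.tanh x * ((Real.cosh x ^ q : ℝ) : ℂ)) x := by
  have := (hasDerivAt_cosh_rpow q x).ofReal_comp
  simpa [-Complex.ofReal_cosh, -Complex.ofReal_tanh] using this

theorem continuous_cosh_rpow (q : ℝ) : Continuous fun x => ((Real.cosh x ^ q : ℝ) : ℂ) :=
  continuous_iff_continuousAt.mpr fun x => (hasDerivAt_cosh_rpow_complex q x).continuousAt

theorem AC.coshMul {u u₁ : ℝ → ℂ} (h : AC u u₁) (q : ℝ) :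
    AC (coshMul q u) (fun x => q * Real.tanh x * coshMul q u x + coshMul q u₁ x) := by
  have hA : AC (fun x => ((Real.cosh x ^ q : ℝ) : ℂ)) _ :=
    AC.of_hasDerivAt (hasDerivAt_cosh_rpow_complex q)
      ((continuous_const.mul (SmoothBdd.tanh 0).1).mul (continuous_cosh_rpow q))
  refine (hA.mul h).congr (Eventually.of_forall fun x => ?_)
  simp only [JostSolution.coshMul]
  ring

theorem coshMul_coshMul (p q : ℝ) (f : ℝ → ℂ) : coshMul p (coshMul q f) = coshMul (p + q) f := by
  ext x
  simp only [coshMul]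
  rw [Real.rpow_add (Real.cosh_pos x)]
  push_cast
  ring

theorem coshMul_congr (q : ℝ) {f g : ℝ → ℂ} (h : f =ᵐ[volume] g) :
    coshMul q f =ᵐ[volume] coshMul q g :=
  h.mono fun x hx => by simp only [coshMul, hx]

theorem natCeil_le_add_one {r : ℝ} (hr : 0 ≤ r) : (⌈r⌉₊ : ℝ) ≤ r + 1 := (Nat.ceil_lt_add_one hr).le

theorem MemH.exists_AC_two {r : ℝ} (hr : 0 ≤ r) {f : ℝ → ℂ} (h : MemH (r + 2) f) :
    ∃ u u₁ u₂, u =ᵐ[volume] f ∧ AC u u₁ ∧ AC u₁ u₂ ∧ MemH (r + 1) u₁ ∧ MemH r u₂ := by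
  rw [show r + 2 = r + 1 + 1 by ring] at h
  obtain ⟨F, F₁, hF, hA, h1⟩ := h.exists_AC (by linarith)
  obtain ⟨G, F₂, hG, hA', h2⟩ := h1.exists_AC hr
  exact ⟨F, G, F₂, hF, hA.congr hG.symm, hA', h1.congr hG.symm, h2⟩

theorem AC.tanh : AC (fun x => (Real.tanh x : ℂ))
    (fun x => 1 - (Real.tanh x : ℂ) * (Real.tanh x : ℂ)) := by
  have hc := (SmoothBdd.tanh 0).1
  refine AC.of_hasDerivAt (fun x => ?_) (continuous_const.sub (hc.mul hc))
  have := (hasDerivAt_tanh x).ofReal_comp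
  convert! this using 1
  push_cast
  ring

/-- Functions in a weighted Sobolev space have derivatives in weighted Sobolev spaces. -/
theorem MemH.exists_AC_weighted {r q : ℝ} (hr : 0 ≤ r) {f : ℝ → ℂ}
    (h : MemH (r + 2) (JostSolution.coshMul q f)) :
    ∃ u u₁ u₂, u =ᵐ[volume] f ∧ AC u u₁ ∧ AC u₁ u₂ ∧
      MemH (⌈r⌉₊ : ℝ) (JostSolution.coshMul q u₁) ∧ MemH r (JostSolution.coshMul q u₂) := by
  have hn1 := natCeil_le_add_one hr
  have hn0 := Nat.le_ceil r
  obtain ⟨F, F₁, F₂, hF, hA, hA', h1, h2⟩ := h.exists_AC_two hr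
  have h0 : MemH (⌈r⌉₊ : ℝ) F := (h.mono (by linarith)).congr hF.symm
  have h1n : MemH (⌈r⌉₊ : ℝ) F₁ := h1.mono hn1
  have inv : ∀ g : ℝ → ℂ, ∀ x, JostSolution.coshMul q (JostSolution.coshMul (-q) g) x = g x := by
    intro g x; rw [coshMul_coshMul]; simp [coshMul_zero]
  have B1 := hA.coshMul (-q)
  have B2 := hA'.coshMul (-q)
  have B3 := ((AC.tanh.mul B1).const_mul ((-q : ℝ) : ℂ)).add B2
  set T : ℝ → ℂ := fun x => (Real.tanh x : ℂ) with hT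
  have hTn : ∀ n, SmoothBdd n T := SmoothBdd.tanh
  have e1 : ∀ x, JostSolution.coshMul q (fun x => ((-q : ℝ) : ℂ) * T x *
      JostSolution.coshMul (-q) F x + JostSolution.coshMul (-q) F₁ x) x =
      ((-q : ℝ) : ℂ) * (T x * F x) + F₁ x := by
    intro x
    have a := inv F x
    have b := inv F₁ x
    simp only [JostSolution.coshMul] at a b ⊢
    linear_combination ((-q : ℝ) : ℂ) * T x * a + b
  have m1 : MemH (⌈r⌉₊ : ℝ) (fun x => ((-q : ℝ) : ℂ) * (T x * F x) + F₁ x) :=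
    (((hTn _).mul_memH h0).const_mul _).add h1n
  have B4 : AC (fun x => ((-q : ℝ) : ℂ) * T x * JostSolution.coshMul (-q) F x +
      JostSolution.coshMul (-q) F₁ x)
      (fun x => ((-q : ℝ) : ℂ) * ((1 - T x * T x) * JostSolution.coshMul (-q) F x +
      T x * (((-q : ℝ) : ℂ) * T x * JostSolution.coshMul (-q) F x +
        JostSolution.coshMul (-q) F₁ x)) +
      (((-q : ℝ) : ℂ) * T x * JostSolution.coshMul (-q) F₁ x +
        JostSolution.coshMul (-q) F₂ x)) := by
    simpa only [mul_assoc] using B3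
  refine ⟨_, _, _, ?_, B1, B4, ?_, ?_⟩
  · filter_upwards [coshMul_congr (-q) hF] with x hx
    rw [hx, coshMul_coshMul]
    simp [coshMul_zero]
  · exact m1.congr (Eventually.of_forall fun x => (e1 x).symm)
  · have m2 : MemH r (fun x => ((-q : ℝ) : ℂ) * ((1 - T x * T x) * F x +
        T x * (((-q : ℝ) : ℂ) * (T x * F x) + F₁ x)) + (((-q : ℝ) : ℂ) * (T x * F₁ x) + F₂ x)) := by
      refine MemH.add (MemH.const_mul (MemH.mono (MemH.add ?_ ?_) hn0) _)
        (MemH.add (MemH.const_mul (((hTn _).mul_memH h1n).mono hn0) _) h2)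
      · exact (((SmoothBdd.const 1 _).sub ((hTn _).mul (hTn _))).mul_memH h0)
      · exact (hTn _).mul_memH m1
    refine m2.congr (Eventually.of_forall fun x => ?_)
    have a := inv F x
    have b := inv F₁ x
    have d := inv F₂ x
    simp only [JostSolution.coshMul] at a b d ⊢
    linear_combination (-((-q : ℝ) : ℂ) * (1 - T x * T x) - ((-q : ℝ) : ℂ) * T x *
      ((-q : ℝ) : ℂ) * T x) * a + (-((-q : ℝ) : ℂ) * T x - ((-q : ℝ) : ℂ) * T x) * b - d

/-- `L_c` acting on a twice differentiable representative, with `m = 1 + 2ς`. -/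
def repL (c : ℝ) (m u u₂ : ℝ → ℂ) (x : ℝ) : ℂ :=
  (c : ℂ) ^ 2 * u₂ x + (2 * (m x * u x) + m (x + 1) * u (x + 1) + m (x - 1) * u (x - 1))

/-- `L_c^*` acting on a twice differentiable representative, with `m = 1 + 2ς`. -/
def repLstar (c : ℝ) (m u u₂ : ℝ → ℂ) (x : ℝ) : ℂ :=
  (c : ℂ) ^ 2 * u₂ x + m x * (2 * u x + u (x + 1) + u (x - 1))

theorem opL_ae_eq {c : ℝ} {ς : ℝ → ℝ} {s f u u₁ u₂ : ℝ → ℂ} (hs : ∀ᵐ x, (ς x : ℂ) = s x)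
    (hu : u =ᵐ[volume] f) (h : AC u u₁) (h₁ : AC u₁ u₂) :
    opL c ς f =ᵐ[volume] repL c (fun x => 1 + 2 * s x) u u₂ := by
  filter_upwards [weakDeriv_eq ((h.hasWeakDeriv_two h₁).congr_left hu), hs, ae_shift hs 1,
    ae_shift hs (-1), hu, ae_shift hu 1, ae_shift hu (-1)] with x a b b1 b2 d d1 d2
  simp only [← sub_eq_add_neg] at b2 d2
  simp only [opL, opB, opA, repL, a, b, b1, b2, ← d, ← d1, ← d2]
  ring

theorem opLstar_ae_eq {c : ℝ} {ς : ℝ → ℝ} {s f u u₁ u₂ : ℝ → ℂ} (hs : ∀ᵐ x, (ς x : ℂ) = s x)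
    (hu : u =ᵐ[volume] f) (h : AC u u₁) (h₁ : AC u₁ u₂) :
    opLstar c ς f =ᵐ[volume] repLstar c (fun x => 1 + 2 * s x) u u₂ := by
  filter_upwards [weakDeriv_eq ((h.hasWeakDeriv_two h₁).congr_left hu), hs, hu, ae_shift hu 1,
    ae_shift hu (-1)] with x a b d d1 d2
  simp only [← sub_eq_add_neg] at d2
  simp only [opLstar, opB, opA, repLstar, a, b, ← d, ← d1, ← d2]
  ring

theorem SmoothBdd.mul_memH_weighted {n : ℕ} {q : ℝ} {b f : ℝ → ℂ} (hb : SmoothBdd n b)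
    (h : MemH n (JostSolution.coshMul q f)) :
    MemH n (JostSolution.coshMul q fun x => b x * f x) :=
  (hb.mul_memH h).congr (Eventually.of_forall fun x => by simp only [JostSolution.coshMul]; ring)

theorem memH_coshMul_zeroth {n : ℕ} {q : ℝ} {m u : ℝ → ℂ} (hm : SmoothBdd n m)
    (h : MemH n (coshMul q u)) :
    MemH n (coshMul q fun x => 2 * (m x * u x) + m (x + 1) * u (x + 1) +
      m (x - 1) * u (x - 1)) := by
  have a := hm.mul_memH_weighted h
  have b := a.coshMul_shift 1
  have d := a.coshMul_shift (-1)
  refine (((a.const_mul 2).add b).add d).congr (Eventually.of_forall fun x => ?_)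
  simp only [coshMul, sub_eq_add_neg]
  ring

theorem opL_memH {c r q : ℝ} (hr : 0 ≤ r) {ς : ℝ → ℝ} {s f : ℝ → ℂ}
    (hs : ∀ᵐ x, (ς x : ℂ) = s x) (hsm : ∀ n, SmoothBdd n s) (h : MemH (r + 2) (coshMul q f)) :
    MemH r (coshMul q (opL c ς f)) := by
  obtain ⟨u, u₁, u₂, hu, hA, hA', -, h2⟩ := h.exists_AC_weighted hr
  have hn1 := natCeil_le_add_one hr
  have h0 : MemH (⌈r⌉₊ : ℝ) (coshMul q u) :=
    (h.mono (by linarith)).congr (coshMul_congr q hu.symm)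
  have hm : SmoothBdd ⌈r⌉₊ fun x => 1 + 2 * s x :=
    (SmoothBdd.const 1 _).add ((hsm _).const_mul 2)
  refine ((h2.const_mul ((c : ℂ) ^ 2)).add
    ((memH_coshMul_zeroth hm h0).mono (Nat.le_ceil r))).congr ?_
  refine EventuallyEq.trans (Eventually.of_forall fun x => ?_)
    (coshMul_congr q (opL_ae_eq hs hu hA hA').symm)
  simp only [coshMul, repL]
  ring

/-- Elliptic regularity for `L_c` in weighted Sobolev spaces of arbitrary real order. -/
theorem memH_of_repL {c r q : ℝ} (hc : c ≠ 0) (hr : 0 ≤ r) {m u u₁ u₂ g : ℝ → ℂ}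
    (hm : ∀ n, SmoothBdd n m) (h : AC u u₁) (h₁ : AC u₁ u₂)
    (he : repL c m u u₂ =ᵐ[volume] g) (h0 : MemLp (coshMul q u) 2 volume)
    (h1 : MemLp (coshMul q u₁) 2 volume) (hg : MemH r (coshMul q g)) :
    MemH (r + 2) (coshMul q u) := by
  set T : ℝ → ℂ := fun x => (Real.tanh x : ℂ) with hT
  have hTn : ∀ n, SmoothBdd n T := SmoothBdd.tanh
  set F := coshMul q u with hF
  set F₁ : ℝ → ℂ := fun x => q * T x * coshMul q u x + coshMul q u₁ x with hF₁
  have hA : AC F F₁ := h.coshMul q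
  have hA' : AC F₁ (fun x => (q : ℂ) * ((1 - T x * T x) * F x + T x * F₁ x) +
      (q * T x * coshMul q u₁ x + coshMul q u₂ x)) := by
    have := ((AC.tanh.mul hA).const_mul q).add (h₁.coshMul q)
    simpa only [mul_assoc, hF₁, hF] using this
  have hc2 : (c : ℂ) ^ 2 ≠ 0 := by simpa using hc
  have e2 : coshMul q u₂ =ᵐ[volume] fun x => ((c : ℂ) ^ 2)⁻¹ * (coshMul q g x -
      coshMul q (fun x => 2 * (m x * u x) + m (x + 1) * u (x + 1) + m (x - 1) * u (x - 1)) x) := by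
    filter_upwards [he] with x hx
    rw [eq_inv_mul_iff_mul_eq₀ hc2]
    simp only [coshMul, ← hx, repL]
    ring
  have m1 : MemLp F₁ 2 volume := by
    have : MemH ((0 : ℕ) : ℝ) F := by rw [Nat.cast_zero]; exact memH_zero_iff.mpr h0
    have := ((hTn 0).mul_memH this).const_mul (q : ℂ)
    refine memH_zero_iff.mp ?_
    rw [Nat.cast_zero] at this
    refine (this.add (memH_zero_iff.mpr h1)).congr (Eventually.of_forall fun x => ?_)
    simp only [hF₁, hF]
    ring
  -- Bootstrap on the order, capped at `r + 1`. Below the cap the order is the integer `n`, so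
  -- multiplication by `m` and `tanh` is available; the equation puts the derivative of `F₁` in
  -- order `min n r`, and `min n r + 1 = min (n + 1) (r + 1)`.
  have step : ∀ n : ℕ, MemH (min n (r + 1)) F ∧ MemH (min n (r + 1)) F₁ := by
    intro n
    induction n with
    | zero =>
      rw [Nat.cast_zero, min_eq_left (by linarith)]
      exact ⟨memH_zero_iff.mpr h0, memH_zero_iff.mpr m1⟩
    | succ n ih =>
      have hup : MemH (min (n : ℝ) (r + 1) + 1) F := MemH.of_AC hA ih.1 ih.2
      rcases le_or_gt (r + 1) n with hn | hn
      · rw [min_eq_right (by push_cast; linarith)]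
        rw [min_eq_right hn] at ih
        exact ih
      · rw [min_eq_left hn.le] at ih hup
        refine ⟨hup.mono ?_, ?_⟩
        · push_cast; exact min_le_left _ _
        set p := min (n : ℝ) r with hp
        have hpn : p ≤ n := min_le_left _ _
        have w1 : MemH n (coshMul q u₁) := by
          refine (ih.2.sub (((hTn n).mul_memH ih.1).const_mul (q : ℂ))).congr
            (Eventually.of_forall fun x => ?_)
          simp only [hF₁, hF]
          ring
        have w2 : MemH p (coshMul q u₂) := by
          refine MemH.congr (MemH.const_mul (MemH.sub (hg.mono (min_le_right _ _)) ?_) _) e2.symm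
          exact (memH_coshMul_zeroth (hm n) ih.1).mono hpn
        have w3 : MemH p (fun x => (q : ℂ) * ((1 - T x * T x) * F x + T x * F₁ x) +
            (q * (T x * coshMul q u₁ x) + coshMul q u₂ x)) := by
          refine MemH.add (MemH.const_mul (MemH.mono (MemH.add ?_ ?_) hpn) _)
            (MemH.add (MemH.const_mul (((hTn n).mul_memH w1).mono hpn) _) w2)
          · exact (((SmoothBdd.const 1 _).sub ((hTn n).mul (hTn n))).mul_memH ih.1)
          · exact (hTn n).mul_memH ih.2
        have w4 := MemH.of_AC hA' (ih.2.mono hpn) (by simpa [mul_assoc] using w3)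
        refine w4.mono ?_
        rw [hp, ← min_add_add_right]
        push_cast
        exact le_rfl
  obtain ⟨n, hn⟩ := exists_nat_ge (r + 1)
  have := step n
  rw [min_eq_right hn] at this
  have := MemH.of_AC hA this.1 this.2
  rwa [show r + 1 + 1 = r + 2 by ring] at this

theorem eq_of_ae_eq {f g : ℝ → ℂ} (hf : Continuous f) (hg : Continuous g)
    (h : f =ᵐ[volume] g) : ∀ x, f x = g x := fun x =>
  congrFun ((hf.ae_eq_iff_eq volume hg).mp h) x

theorem opL_odd {c : ℝ} {ς : ℝ → ℝ} {s f u u₁ u₂ : ℝ → ℂ} (hs : ∀ᵐ x, (ς x : ℂ) = s x)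
    (hse : ∀ x, s (-x) = s x) (hu : u =ᵐ[volume] f) (h : AC u u₁) (h₁ : AC u₁ u₂)
    (hf : AEOdd f) : AEOdd (opL c ς f) := by
  have ho : ∀ x, u (-x) = -u x := by
    refine eq_of_ae_eq (h.continuous.comp continuous_neg) h.continuous.neg ?_
    filter_upwards [hu, ae_reflect hu, hf] with x a b d
    simp only [a, b, d]
  have h1 : (fun x => -u₁ (-x)) =ᵐ[volume] fun x => -u₁ x := by
    refine AC.unique h.comp_neg ?_
    simpa only [← funext ho] using h.neg
  have h1' : ∀ x, u₁ (-x) = u₁ x := by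
    have := eq_of_ae_eq (by have := h₁.continuous; fun_prop) (by have := h₁.continuous; fun_prop) h1
    exact fun x => neg_injective (this x)
  have h2 : (fun x => -u₂ (-x)) =ᵐ[volume] u₂ := by
    refine AC.unique h₁.comp_neg ?_
    simpa only [h1'] using h₁
  have he := opL_ae_eq (c := c) hs hu h h₁
  filter_upwards [he, ae_reflect he, h2] with x a b d
  rw [a, b]
  simp only [repL]
  rw [← d, show -x + 1 = -(x - 1) by ring, show -x - 1 = -(x + 1) by ring]
  simp only [hse, ho]
  ring

theorem cosh_rpow_neg_le (q x : ℝ) (hq : 0 ≤ q) :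
    Real.cosh x ^ (-q) ≤ 2 ^ q * Real.exp (-q * |x|) := by
  have h1 : Real.exp |x| / 2 ≤ Real.cosh x := by
    rw [← Real.cosh_abs, Real.cosh_eq]
    have := Real.exp_pos (-|x|)
    linarith
  have h2 : (Real.exp |x| / 2) ^ q ≤ Real.cosh x ^ q :=
    Real.rpow_le_rpow (by positivity) h1 hq
  rw [Real.rpow_neg (Real.cosh_pos x).le, inv_le_iff_one_le_mul₀ (by positivity)]
  rw [Real.div_rpow (by positivity) (by positivity), ← Real.exp_mul] at h2
  have h3 : Real.exp (-q * |x|) * Real.exp (|x| * q) = 1 := by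
    rw [← Real.exp_add]; ring_nf; simp
  have p2 : (0 : ℝ) < 2 ^ q := by positivity
  calc (1 : ℝ) = 2 ^ q * Real.exp (-q * |x|) * (Real.exp (|x| * q) / 2 ^ q) := by
        rw [mul_assoc, mul_div_assoc', h3]; field_simp
    _ ≤ _ := by gcongr

/-- A function in a weighted Sobolev space and its derivative decay exponentially. -/
theorem exists_bound_weighted {q : ℝ} (hq : 0 ≤ q) {f : ℝ → ℂ} (h : MemH 2 (coshMul q f)) :
    ∃ u u₁ u₂, u =ᵐ[volume] f ∧ AC u u₁ ∧ AC u₁ u₂ ∧ ∃ C, 0 ≤ C ∧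
      (∀ x, ‖u x‖ ≤ C * Real.exp (-q * |x|)) ∧ (∀ x, ‖u₁ x‖ ≤ C * Real.exp (-q * |x|)) := by
  rw [show (2 : ℝ) = 0 + 2 by norm_num] at h
  obtain ⟨u, u₁, u₂, hu, hA, hA', h1, h2⟩ := h.exists_AC_weighted le_rfl
  have h0 : MemLp (coshMul q u) 2 volume :=
    (h.congr (coshMul_congr q hu.symm)).memLp
  have ht : ∀ g : ℝ → ℂ, MemLp g 2 volume →
      MemLp (fun x => (q : ℂ) * (Real.tanh x) * g x) 2 volume := by
    intro g hg
    have : MemH ((0 : ℕ) : ℝ) g := by rw [Nat.cast_zero]; exact memH_zero_iff.mpr hg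
    have := (((SmoothBdd.tanh 0).const_mul q).mul_memH this).memLp
    exact this
  have bd : ∀ {v w : ℝ → ℂ}, AC v w → MemLp (coshMul q v) 2 volume →
      MemLp (coshMul q w) 2 volume → ∃ C, 0 ≤ C ∧ ∀ x, ‖v x‖ ≤ C * Real.exp (-q * |x|) := by
    intro v w hv h1 h2
    obtain ⟨C, hC⟩ := bounded_of_AC_memLp (hv.coshMul q) h1 ((ht _ h1).add h2)
    have hC0 : 0 ≤ C := (norm_nonneg _).trans (hC 0)
    refine ⟨C * 2 ^ q, by positivity, fun x => ?_⟩
    have e : v x = ((Real.cosh x ^ (-q) : ℝ) : ℂ) * coshMul q v x := by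
      have := congrFun (coshMul_coshMul (-q) q v) x
      rw [neg_add_cancel, coshMul_zero] at this
      exact this.symm
    rw [e, norm_mul, Complex.norm_real,
      Real.norm_of_nonneg (Real.rpow_nonneg (Real.cosh_pos x).le _)]
    calc Real.cosh x ^ (-q) * ‖coshMul q v x‖ ≤ (2 ^ q * Real.exp (-q * |x|)) * C :=
          mul_le_mul (cosh_rpow_neg_le q x hq) (hC x) (norm_nonneg _) (by positivity)
      _ = _ := by ring
  obtain ⟨C, hC0, hC⟩ := bd hA h0 h1.memLp
  obtain ⟨D, hD0, hD⟩ := bd hA' h1.memLp h2.memLp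
  refine ⟨u, u₁, u₂, hu, hA, hA', max C D, le_max_of_le_left hC0, fun x => (hC x).trans ?_,
    fun x => (hD x).trans ?_⟩
  · gcongr; exact le_max_left _ _
  · gcongr; exact le_max_right _ _

/-- Regularity, symmetry and decay of the profile of a solitary wave. -/
theorem IsSolitaryWave.exists_profile {c qς : ℝ} {ς : ℝ → ℝ} (hc : c ≠ 0)
    (h : IsSolitaryWave c qς ς) :
    ∃ s : ℝ → ℂ, (∀ᵐ x, (ς x : ℂ) = s x) ∧ (∀ n, SmoothBdd n s) ∧ (∀ x, s (-x) = s x) ∧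
      (∀ x, (starRingEnd ℂ) (s x) = s x) ∧
      ∃ C, 0 ≤ C ∧ ∀ x, ‖s x‖ ≤ C * Real.exp (-qς * |x|) := by
  obtain ⟨hq, ⟨⟨-, hH⟩, hev⟩, heq⟩ := h
  obtain ⟨s, s₁, s₂, hs, hA, hA', C, hC0, hC, hC1⟩ := exists_bound_weighted hq.le hH
  have hc2 : (c : ℂ) ^ 2 ≠ 0 := by simpa using hc
  have hs' : ∀ᵐ x, (ς x : ℂ) = s x := hs.mono fun x hx => hx.symm
  set N : ℝ → ℂ := fun x => ((c : ℂ) ^ 2)⁻¹ * ((s (x + 1) + s (x + 1) * s (x + 1)) +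
    (s (x + (-1)) + s (x + (-1)) * s (x + (-1))) - 2 * (s x + s x * s x)) with hN
  have cs := hA.continuous
  have hNc : Continuous N := by rw [hN]; fun_prop
  have hAN : AC s₁ N := by
    refine hA'.congr ?_
    filter_upwards [heq, weakDeriv_eq ((hA.hasWeakDeriv_two hA').congr_left hs), hs',
      ae_shift hs' 1, ae_shift hs' (-1)] with x a b d d1 d2
    rw [hN]
    simp only
    rw [eq_inv_mul_iff_mul_eq₀ hc2]
    simp only [opA, b, d, d1, sub_eq_add_neg x 1, d2] at a
    linear_combination a
  have ebd : ∀ x : ℝ, C * Real.exp (-qς * |x|) ≤ C := fun x => by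
    have : Real.exp (-qς * |x|) ≤ 1 := Real.exp_le_one_iff.mpr (by
      have := mul_nonneg hq.le (abs_nonneg x); linarith)
    nlinarith
  -- The equation expresses the derivative of `s₁` through `s + s²` and its shifts, so the
  -- smoothness of `s` and that of `s₁` climb together.
  have hsm : ∀ n, SmoothBdd n s ∧ SmoothBdd n s₁ := by
    intro n
    induction n with
    | zero => exact ⟨⟨cs, C, fun x => (hC x).trans (ebd x)⟩,
        ⟨hA'.continuous, C, fun x => (hC1 x).trans (ebd x)⟩⟩
    | succ n ih =>
      refine ⟨⟨⟨C, fun x => (hC x).trans (ebd x)⟩, s₁, hA.hasDerivAt hA'.continuous, ih.2⟩,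
        ⟨⟨C, fun x => (hC1 x).trans (ebd x)⟩, N, hAN.hasDerivAt hNc, ?_⟩⟩
      have a := ih.1.add (ih.1.mul ih.1)
      exact (((a.comp_add 1).add (a.comp_add (-1))).sub (a.const_mul 2)).const_mul _
  refine ⟨s, hs', fun n => (hsm n).1, ?_, ?_, C, hC0, hC⟩
  · refine eq_of_ae_eq (cs.comp continuous_neg) cs ?_
    filter_upwards [hs', ae_reflect hs', hev] with x a b d
    simp only [← a, ← b, d]
  · refine eq_of_ae_eq (Complex.continuous_conj.comp cs) cs ?_
    filter_upwards [hs'] with x a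
    simp only [← a, Complex.conj_ofReal]

end JostSolution

end

/-! ### The critical frequency and the positive kernel -/

open MeasureTheory Filter Topology

noncomputable section

namespace JostSolution

open scoped ENNReal

/-- The symbol is positive at `0`, strictly decreasing on `(0, π]` and negative from `2` on, so its
root is unique. The extra bound `ω < 3/2` makes the kernel nonnegative and keeps its exponential
moment small. -/
theorem critical_freq_exists {c : ℝ} (hc : 1 < |c|) :
    ∃ ω : ℝ, IsCriticalFrequency c ω ∧ ω < 3 / 2 := by
  have hc2 : 1 < c ^ 2 := by
    rw [← sq_abs]; nlinarith
  have hcont : Continuous (symbolB c) := by unfold symbolB; fun_prop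
  -- The value `1/8` is what negativity at `3/2` requires: `-9/4 + 2 + 2/8 = 0`.
  have hcos : Real.cos (3 / 2) < 1 / 8 := by
    have h1 : Real.cos (3 / 2) = Real.sin (Real.pi / 2 - 3 / 2) :=
      (Real.sin_pi_div_two_sub _).symm
    rw [h1]
    have := Real.pi_gt_d2
    have := Real.pi_lt_d2
    refine (Real.sin_lt (by linarith)).trans_le (by linarith)
  have anti : ∀ x y : ℝ, 0 < x → x < y → y ≤ Real.pi → symbolB c y < symbolB c x := by
    intro x y hx hxy hy
    have h1 := Real.cos_lt_cos_of_nonneg_of_le_pi hx.le hy hxy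
    have h2 : c ^ 2 * x ^ 2 < c ^ 2 * y ^ 2 :=
      mul_lt_mul_of_pos_left (pow_lt_pow_left₀ hxy hx.le two_ne_zero) (by linarith)
    simp only [symbolB]
    linarith
  have big : ∀ x : ℝ, 2 ≤ x → symbolB c x < 0 := by
    intro x hx
    have := Real.cos_le_one x
    have h2 : (4 : ℝ) ≤ x ^ 2 := by nlinarith
    have h3 : x ^ 2 < c ^ 2 * x ^ 2 := by nlinarith
    simp only [symbolB]
    linarith
  have h0 : 0 < symbolB c 0 := by simp [symbolB]
  have h1 : symbolB c (3 / 2) < 0 := by simp only [symbolB]; nlinarith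
  obtain ⟨ω, ⟨hω0, hω1⟩, hz⟩ := intermediate_value_Icc' (by norm_num : (0 : ℝ) ≤ 3 / 2)
    hcont.continuousOn (show (0 : ℝ) ∈ Set.Icc _ _ from ⟨h1.le, h0.le⟩)
  have p0 : 0 < ω := lt_of_le_of_ne hω0 (by rintro rfl; exact absurd hz h0.ne')
  have p1 : ω < 3 / 2 := lt_of_le_of_ne hω1 (by rintro rfl; exact absurd hz h1.ne)
  refine ⟨ω, ⟨p0, hz, fun ω' hp hz' => ?_⟩, p1⟩
  have hpi := Real.pi_gt_three
  have h2 : ω' < 2 := by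
    by_contra h
    exact absurd hz' (big ω' (not_lt.mp h)).ne
  rcases lt_trichotomy ω' ω with h | h | h
  · have := anti _ _ hp h (by linarith); linarith
  · exact h
  · have := anti _ _ p0 h (by linarith); linarith

/-- The kernel with Fourier transform `(2 cos ω - 2 cos z) / (z² - ω²)`, on `[0, 1]`. -/
def kern (ω s : ℝ) : ℝ := Real.sin (ω * (1 - s)) / ω

/-- The value at `z = i` of the Fourier transform of the even extension of `kern ω`. -/
def kernConst (ω : ℝ) : ℝ := 2 * (Real.cosh 1 - Real.cos ω) / (1 + ω ^ 2)

/-- Convolution with the even extension of `kern ω`. -/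
def kernConv (ω : ℝ) (U : ℝ → ℝ≥0∞) (x : ℝ) : ℝ≥0∞ :=
  ∫⁻ s in Set.Ioc (0 : ℝ) 1, ENNReal.ofReal (kern ω s) * (U (x + s) + U (x - s))

section Kernel

variable {c ω : ℝ}

theorem cos_gt_of_lt (h0 : 0 < ω) (h1 : ω < 3 / 2) : 1 / 20 < Real.cos ω := by
  have hp := Real.pi_gt_d2
  have hp' := Real.pi_lt_d2
  have h2 : Real.cos (3 / 2) < Real.cos ω :=
    Real.cos_lt_cos_of_nonneg_of_le_pi h0.le (by linarith) h1
  refine lt_trans ?_ h2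
  rw [← Real.sin_pi_div_two_sub]
  have h3 := Real.sin_gt_sub_cube (x := Real.pi / 2 - 3 / 2) (by linarith)
  refine lt_of_lt_of_le ?_ h3.le
  have a : 0.07 ≤ Real.pi / 2 - 3 / 2 := by linarith
  have b : Real.pi / 2 - 3 / 2 ≤ 0.08 := by linarith
  have : (Real.pi / 2 - 3 / 2) ^ 3 ≤ 0.08 ^ 3 := pow_le_pow_left₀ (by linarith) b 3
  norm_num at this ⊢
  linarith

theorem cosh_one_lt : Real.cosh 1 < 31 / 20 := by
  rw [Real.cosh_eq]
  have h1 := Real.exp_one_lt_d9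
  have h2 := Real.exp_one_gt_d9
  have h3 : Real.exp (-1) < 0.37 := by
    rw [Real.exp_neg, inv_lt_comm₀ (Real.exp_pos 1) (by norm_num)]
    norm_num at h2 ⊢
    linarith
  norm_num at h1 h3 ⊢
  linarith

/-- By `c²ω² = 2 + 2 cos ω` the claim reads `2 cosh 1 - 2 - 4 cos ω < c²`. With `cosh 1 < 31/20` and
`cos ω > 1/20` the left side is below `9/10`. The strict inequality is what makes the iteration
below contract. -/
theorem kernConst_lt (hc : 1 < |c|) (h0 : 0 < ω) (h1 : ω < 3 / 2) (hz : symbolB c ω = 0) :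
    kernConst ω < c ^ 2 := by
  have hc2 : 1 < c ^ 2 := by
    rw [← sq_abs]; nlinarith
  rw [kernConst, div_lt_iff₀ (by positivity)]
  have := cos_gt_of_lt h0 h1
  have := cosh_one_lt
  simp only [symbolB] at hz
  nlinarith

theorem kernConst_nonneg (ω : ℝ) : 0 ≤ kernConst ω := by
  have := Real.one_le_cosh 1
  have := Real.cos_le_one ω
  exact div_nonneg (by linarith) (by positivity)

theorem kern_nonneg (h0 : 0 < ω) (h1 : ω < 3 / 2) {s : ℝ} (hs : s ∈ Set.Ioc (0 : ℝ) 1) :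
    0 ≤ kern ω s := by
  have hp := Real.pi_gt_three
  refine div_nonneg (Real.sin_nonneg_of_nonneg_of_le_pi ?_ ?_) h0.le
  · exact mul_nonneg h0.le (by linarith [hs.2])
  · nlinarith [hs.1, hs.2]

theorem kern_le_one (h0 : 0 < ω) {s : ℝ} (hs : s ∈ Set.Ioc (0 : ℝ) 1) : kern ω s ≤ 1 := by
  rw [kern, div_le_one h0]
  have := Real.sin_le (x := ω * (1 - s)) (mul_nonneg h0.le (by linarith [hs.2]))
  nlinarith [hs.1]

theorem continuous_kern (ω : ℝ) : Continuous (kern ω) := by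
  unfold kern; fun_prop

theorem integral_kern_cosh (h0 : 0 < ω) :
    ∫ s in (0 : ℝ)..1, kern ω s * (2 * Real.cosh s) = kernConst ω := by
  have hd : ∀ s, HasDerivAt (fun s => 2 / ω * (Real.sin (ω * (1 - s)) * Real.sinh s +
      ω * (Real.cos (ω * (1 - s)) * Real.cosh s)) / (1 + ω ^ 2))
      (kern ω s * (2 * Real.cosh s)) s := by
    intro s
    have hl : HasDerivAt (fun s : ℝ => ω * (1 - s)) (-ω) s := by
      simpa using ((hasDerivAt_id s).const_sub 1).const_mul ω
    have h := ((((hl.sin.mul (Real.hasDerivAt_sinh s)).add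
      ((hl.cos.mul (Real.hasDerivAt_cosh s)).const_mul ω)).const_mul (2 / ω)).div_const (1 + ω ^ 2))
    convert! h using 1
    have : 1 + ω ^ 2 ≠ 0 := by positivity
    simp only [kern]
    field_simp
    ring
  rw [intervalIntegral.integral_eq_sub_of_hasDerivAt (fun s _ => hd s)
    (Continuous.intervalIntegrable (by have := continuous_kern ω; fun_prop) _ _)]
  simp only [kernConst]
  field_simp
  simp
  ring

theorem measurable_kern (ω : ℝ) : Measurable (fun s => ENNReal.ofReal (kern ω s)) :=
  (continuous_kern ω).measurable.ennreal_ofReal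

/-- Exponentials are eigenfunctions of a convolution, and evenness of the kernel makes the
eigenvalue the same for both signs. -/
theorem kernConv_exp (h0 : 0 < ω) (h1 : ω < 3 / 2) (σ : ℝ) (hσ : σ = 1 ∨ σ = -1) (x : ℝ) :
    kernConv ω (fun y => ENNReal.ofReal (Real.exp (σ * y))) x =
      ENNReal.ofReal (kernConst ω) * ENNReal.ofReal (Real.exp (σ * x)) := by
  have e : ∀ s, Real.exp (σ * (x + s)) + Real.exp (σ * (x - s)) =
      Real.exp (σ * x) * (2 * Real.cosh s) := by
    intro s
    rw [Real.cosh_eq, mul_add, mul_sub, Real.exp_add, sub_eq_add_neg, Real.exp_add]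
    rcases hσ with rfl | rfl <;> simp <;> ring
  have e2 : ∀ s ∈ Set.Ioc (0 : ℝ) 1, ENNReal.ofReal (kern ω s) *
      (ENNReal.ofReal (Real.exp (σ * (x + s))) + ENNReal.ofReal (Real.exp (σ * (x - s)))) =
      ENNReal.ofReal (kern ω s * (2 * Real.cosh s)) * ENNReal.ofReal (Real.exp (σ * x)) := by
    intro s hs
    have k0 := kern_nonneg h0 h1 hs
    have c0 := (Real.cosh_pos s).le
    rw [← ENNReal.ofReal_add (Real.exp_pos _).le (Real.exp_pos _).le, e,
      ← ENNReal.ofReal_mul k0, ← ENNReal.ofReal_mul (by positivity)]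
    congr 1
    ring
  rw [kernConv, setLIntegral_congr_fun measurableSet_Ioc e2,
    lintegral_mul_const' _ _ ENNReal.ofReal_ne_top]
  congr 1
  rw [← integral_kern_cosh h0, intervalIntegral.integral_of_le zero_le_one,
    ofReal_integral_eq_lintegral_ofReal]
  · exact (Continuous.integrableOn_Ioc (by have := continuous_kern ω; fun_prop))
  · refine (ae_restrict_iff' measurableSet_Ioc).mpr (Eventually.of_forall fun s hs => ?_)
    exact mul_nonneg (kern_nonneg h0 h1 hs) (by have := (Real.cosh_pos s).le; positivity)

theorem kernConv_mono_ae {U V : ℝ → ℝ≥0∞} (h : ∀ᵐ x, U x ≤ V x) (x : ℝ) :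
    kernConv ω U x ≤ kernConv ω V x := by
  refine lintegral_mono_ae (ae_restrict_of_ae ?_)
  have h1 := ae_shift h x
  have h2 := ae_reflect (ae_shift h x)
  filter_upwards [h1, h2] with s a b
  rw [add_comm] at a
  rw [neg_add_eq_sub] at b
  gcongr

theorem kernConv_mono {U V : ℝ → ℝ≥0∞} (h : ∀ x, U x ≤ V x) (x : ℝ) :
    kernConv ω U x ≤ kernConv ω V x := kernConv_mono_ae (Eventually.of_forall h) x

theorem kernConv_add {U V : ℝ → ℝ≥0∞} (hU : Measurable U) (x : ℝ) :
    kernConv ω (fun y => U y + V y) x = kernConv ω U x + kernConv ω V x := by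
  simp only [kernConv]
  have hk := measurable_kern ω
  rw [← lintegral_add_left (by fun_prop)]
  congr 1
  ext s
  ring

theorem kernConv_const_mul {U : ℝ → ℝ≥0∞} (hU : Measurable U) (k : ℝ≥0∞) (x : ℝ) :
    kernConv ω (fun y => k * U y) x = k * kernConv ω U x := by
  simp only [kernConv]
  have hk := measurable_kern ω
  rw [← lintegral_const_mul _ (by fun_prop)]
  congr 1
  ext s
  ring

theorem measurable_kernConv {U : ℝ → ℝ≥0∞} (hU : Measurable U) : Measurable (kernConv ω U) := by
  unfold kernConv
  refine Measurable.lintegral_prod_right' (f := fun p : ℝ × ℝ => ENNReal.ofReal (kern ω p.2) *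
    (U (p.1 + p.2) + U (p.1 - p.2))) ?_
  refine ((measurable_kern ω).comp measurable_snd).mul ?_
  exact (hU.comp (by fun_prop)).add (hU.comp (by fun_prop))

/-- The two-sided growth weight `e^x + e^{-x}`. -/
def growth (x : ℝ) : ℝ≥0∞ := ENNReal.ofReal (Real.exp (1 * x)) + ENNReal.ofReal (Real.exp (-1 * x))

theorem measurable_growth : Measurable growth := by unfold growth; fun_prop

theorem one_le_growth (x : ℝ) : 1 ≤ growth x := by
  rcases le_total 0 x with h | h
  · refine le_trans ?_ le_self_add
    rw [ENNReal.one_le_ofReal]; exact Real.one_le_exp (by linarith)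
  · refine le_trans ?_ le_add_self
    rw [ENNReal.one_le_ofReal]; exact Real.one_le_exp (by linarith)

theorem growth_ne_top (x : ℝ) : growth x ≠ ∞ := by simp [growth]

theorem kernConv_growth (h0 : 0 < ω) (h1 : ω < 3 / 2) (x : ℝ) :
    kernConv ω growth x = ENNReal.ofReal (kernConst ω) * growth x := by
  unfold growth
  rw [kernConv_add (by fun_prop), kernConv_exp h0 h1 1 (Or.inl rfl),
    kernConv_exp h0 h1 (-1) (Or.inr rfl)]
  ring

/-- Convolution with `e^{-|x|}`. -/
def expConv (H : ℝ → ℝ≥0∞) (x : ℝ) : ℝ≥0∞ :=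
  ∫⁻ z, ENNReal.ofReal (Real.exp (-|x - z|)) * H z

theorem measurable_expConv {H : ℝ → ℝ≥0∞} (hH : Measurable H) : Measurable (expConv H) := by
  unfold expConv
  refine Measurable.lintegral_prod_right' (f := fun p : ℝ × ℝ =>
    ENNReal.ofReal (Real.exp (-|p.1 - p.2|)) * H p.2) ?_
  exact (Measurable.ennreal_ofReal (by fun_prop)).mul (hH.comp measurable_snd)

/-- `e^{-|y|}` is the minimum of the eigenfunctions `e^{±y}`, and a positive operator sends a
minimum below the minimum of the images. -/
theorem kernConv_exp_abs (h0 : 0 < ω) (h1 : ω < 3 / 2) (z x : ℝ) :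
    kernConv ω (fun y => ENNReal.ofReal (Real.exp (-|y - z|))) x ≤
      ENNReal.ofReal (kernConst ω) * ENNReal.ofReal (Real.exp (-|x - z|)) := by
  have key : ∀ σ : ℝ, (σ = 1 ∨ σ = -1) → -|x - z| = σ * (x - z) →
      kernConv ω (fun y => ENNReal.ofReal (Real.exp (-|y - z|))) x ≤
      ENNReal.ofReal (kernConst ω) * ENNReal.ofReal (Real.exp (-|x - z|)) := by
    intro σ hσ he
    have hb : ∀ y, ENNReal.ofReal (Real.exp (-|y - z|)) ≤
        ENNReal.ofReal (Real.exp (-σ * z)) * ENNReal.ofReal (Real.exp (σ * y)) := by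
      intro y
      rw [← ENNReal.ofReal_mul (Real.exp_pos _).le, ← Real.exp_add]
      refine ENNReal.ofReal_le_ofReal (Real.exp_le_exp.mpr ?_)
      rcases hσ with rfl | rfl
      · linarith [neg_abs_le (y - z)]
      · linarith [le_abs_self (y - z)]
    refine (kernConv_mono hb x).trans ?_
    rw [kernConv_const_mul (by fun_prop), kernConv_exp h0 h1 σ hσ, he, mul_left_comm,
      ← ENNReal.ofReal_mul (Real.exp_pos _).le, ← Real.exp_add]
    refine le_of_eq ?_
    congr 3
    ring
  rcases le_total x z with h | h
  · exact key 1 (Or.inl rfl) (by rw [abs_of_nonpos (by linarith)]; ring)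
  · exact key (-1) (Or.inr rfl) (by rw [abs_of_nonneg (by linarith)]; ring)

theorem kernConv_expConv (h0 : 0 < ω) (h1 : ω < 3 / 2) {H : ℝ → ℝ≥0∞} (hH : Measurable H)
    (x : ℝ) : kernConv ω (expConv H) x ≤ ENNReal.ofReal (kernConst ω) * expConv H x := by
  have e : ∀ s, ENNReal.ofReal (kern ω s) * (expConv H (x + s) + expConv H (x - s)) =
      ∫⁻ z, ENNReal.ofReal (kern ω s) * (ENNReal.ofReal (Real.exp (-|x + s - z|)) +
        ENNReal.ofReal (Real.exp (-|x - s - z|))) * H z := by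
    intro s
    simp only [expConv]
    rw [← lintegral_add_left (by fun_prop), ← lintegral_const_mul _ (by fun_prop)]
    congr 1; ext z; ring
  simp only [kernConv, e]
  rw [lintegral_lintegral_swap]
  · rw [expConv, ← lintegral_const_mul _ (by fun_prop)]
    refine lintegral_mono fun z => ?_
    have := kernConv_exp_abs h0 h1 z x
    rw [← mul_assoc]
    simp only [kernConv] at this
    rw [lintegral_mul_const]
    · gcongr
    · have hk := measurable_kern ω
      fun_prop
  · refine Measurable.aemeasurable ?_
    have hk : Measurable fun p : ℝ × ℝ => ENNReal.ofReal (kern ω p.1) :=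
      (measurable_kern ω).comp measurable_fst
    have hH' : Measurable fun p : ℝ × ℝ => H p.2 := hH.comp measurable_snd
    unfold Function.uncurry
    fun_prop

/-- On its support the kernel is at most `1 ≤ e · e^{-|s|}`; the factor `2` counts the two shifts.
-/
theorem kernConv_le_expConv (h0 : 0 < ω) {H : ℝ → ℝ≥0∞} (hH : Measurable H) (x : ℝ) :
    kernConv ω H x ≤ ENNReal.ofReal (2 * Real.exp 1) * expConv H x := by
  have hshift : ∀ σ : ℝ, (σ = 1 ∨ σ = -1) →
      ∫⁻ s in Set.Ioc (0 : ℝ) 1, ENNReal.ofReal (Real.exp 1 * Real.exp (-|s|)) * H (x + σ * s) ≤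
        ENNReal.ofReal (Real.exp 1) * expConv H x := by
    intro σ hσ
    refine (setLIntegral_le_lintegral _ _).trans (le_of_eq ?_)
    have e1 : ∀ s, ENNReal.ofReal (Real.exp 1 * Real.exp (-|s|)) * H (x + σ * s) =
        ENNReal.ofReal (Real.exp 1) *
          (ENNReal.ofReal (Real.exp (-|x - (x + σ * s)|)) * H (x + σ * s)) := by
      intro s
      rw [ENNReal.ofReal_mul (Real.exp_pos _).le, mul_assoc]
      congr 4
      rcases hσ with rfl | rfl <;> simp
    simp_rw [e1]
    rw [lintegral_const_mul' _ _ ENNReal.ofReal_ne_top, expConv]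
    congr 1
    rcases hσ with rfl | rfl
    · simp only [one_mul]
      exact lintegral_add_left_eq_self (μ := volume)
        (fun z => ENNReal.ofReal (Real.exp (-|x - z|)) * H z) x
    · simp only [neg_mul, one_mul, ← sub_eq_add_neg]
      exact lintegral_sub_left_eq_self (μ := volume)
        (fun z => ENNReal.ofReal (Real.exp (-|x - z|)) * H z) x
  have hb : ∀ s ∈ Set.Ioc (0 : ℝ) 1, kern ω s ≤ Real.exp 1 * Real.exp (-|s|) := by
    intro s hs
    refine (kern_le_one h0 hs).trans ?_
    rw [← Real.exp_add, abs_of_pos hs.1]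
    exact Real.one_le_exp (by linarith [hs.2])
  have hb' : ∀ s ∈ Set.Ioc (0 : ℝ) 1, ENNReal.ofReal (kern ω s) * (H (x + s) + H (x - s)) ≤
      ENNReal.ofReal (Real.exp 1 * Real.exp (-|s|)) * H (x + 1 * s) +
        ENNReal.ofReal (Real.exp 1 * Real.exp (-|s|)) * H (x + -1 * s) := by
    intro s hs
    rw [← mul_add, one_mul, neg_one_mul, ← sub_eq_add_neg]
    gcongr
    exact hb s hs
  refine (setLIntegral_mono' measurableSet_Ioc hb').trans ?_
  rw [lintegral_add_left (by fun_prop)]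
  refine (add_le_add (hshift 1 (Or.inl rfl)) (hshift (-1) (Or.inr rfl))).trans (le_of_eq ?_)
  rw [ENNReal.ofReal_mul zero_le_two, ← two_mul, ENNReal.ofReal_ofNat, mul_assoc]

/-- A subsolution estimate: the only subsolutions of at most exponential growth with rate `1`
are dominated by the convolution of the right-hand side with `e^{-|x|}`. -/
theorem le_expConv_of_subsolution (h0 : 0 < ω) (h1 : ω < 3 / 2) (hlt : kernConst ω < c ^ 2)
    {y H : ℝ → ℝ≥0∞} (hH : Measurable H) {κ M : ℝ≥0∞} (hM : M ≠ ∞)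
    (hy : ∀ x, ENNReal.ofReal (c ^ 2) * y x ≤ κ * expConv H x + kernConv ω y x)
    (hb : ∀ x, y x ≤ M * growth x) :
    ∀ x, y x ≤ κ * ENNReal.ofReal (c ^ 2 - kernConst ω)⁻¹ * expConv H x := by
  have hk0 := kernConst_nonneg ω
  have hc2 : 0 < c ^ 2 := by linarith
  set C2 := ENNReal.ofReal (c ^ 2) with hC2
  set K := ENNReal.ofReal (kernConst ω) with hK
  set D := ENNReal.ofReal (c ^ 2 - kernConst ω)⁻¹ with hD
  have hC20 : C2 ≠ 0 := by simpa [hC2] using hc2.ne'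
  have hC2t : C2 ≠ ∞ := ENNReal.ofReal_ne_top
  -- This choice of `D` makes `κ D · expConv H` reproduce itself as an upper bound under one step of
  -- the iteration.
  have hDeq : 1 + K * D = C2 * D := by
    rw [hK, hD, hC2, ← ENNReal.ofReal_mul hk0, ← ENNReal.ofReal_mul hc2.le,
      ← ENNReal.ofReal_one, ← ENNReal.ofReal_add zero_le_one
        (mul_nonneg hk0 (inv_nonneg.mpr (by linarith)))]
    congr 1
    have : c ^ 2 - kernConst ω ≠ 0 := by linarith
    field_simp
    ring
  set θ := K / C2 with hθ
  have hθ1 : θ < 1 := by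
    rw [hθ, ENNReal.div_lt_iff (Or.inl hC20) (Or.inl hC2t), one_mul]
    exact (ENNReal.ofReal_lt_ofReal_iff hc2).mpr hlt
  have hKθ : K = C2 * θ := (ENNReal.mul_div_cancel hC20 hC2t).symm
  -- Each pass through `hy` multiplies the a priori growth term by `θ < 1` and leaves the other term
  -- unchanged.
  have step : ∀ n : ℕ, ∀ x, y x ≤ θ ^ n * M * growth x + κ * D * expConv H x := by
    intro n
    induction n with
    | zero =>
      intro x
      rw [pow_zero, one_mul]
      exact (hb x).trans le_self_add
    | succ n ih =>
      intro x
      have hw := measurable_expConv hH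
      have hg := measurable_growth
      have h2 : kernConv ω y x ≤ θ ^ n * M * (K * growth x) + κ * D * (K * expConv H x) := by
        refine (kernConv_mono ih x).trans ?_
        rw [kernConv_add (by fun_prop), kernConv_const_mul hg, kernConv_growth h0 h1,
          kernConv_const_mul hw]
        gcongr
        exact kernConv_expConv h0 h1 hH x
      have h3 : C2 * y x ≤ C2 * (θ ^ (n + 1) * M * growth x + κ * D * expConv H x) := by
        refine (hy x).trans ((add_le_add le_rfl h2).trans (le_of_eq ?_))
        calc κ * expConv H x + (θ ^ n * M * (K * growth x) + κ * D * (K * expConv H x))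
            = θ ^ n * M * growth x * K + κ * expConv H x * (1 + K * D) := by ring
          _ = _ := by rw [hDeq, hKθ]; ring
      exact (ENNReal.mul_le_mul_iff_right hC20 hC2t).mp h3
  intro x
  have hlim : Tendsto (fun n : ℕ => θ ^ n * (M * growth x) + κ * D * expConv H x) atTop
      (𝓝 (0 * (M * growth x) + κ * D * expConv H x)) := by
    refine Tendsto.add_const _ (ENNReal.Tendsto.mul_const
      (ENNReal.tendsto_pow_atTop_nhds_zero_of_lt_one hθ1) (Or.inr ?_))
    exact ENNReal.mul_ne_top hM (growth_ne_top x)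
  rw [zero_mul, zero_add] at hlim
  exact ge_of_tendsto' hlim fun n => by rw [← mul_assoc]; exact step n x

end Kernel

end JostSolution

end

/-! ### Plane-wave asymptotics for `B_c u = f` -/

open MeasureTheory Filter Topology

noncomputable section

namespace JostSolution

open scoped ENNReal

/-- The plane wave `e^{iωx}`. -/
def wave (ω x : ℝ) : ℂ := Complex.exp ((ω * x : ℝ) * Complex.I)

theorem hasDerivAt_wave (ω x : ℝ) : HasDerivAt (wave ω) (Complex.I * ω * wave ω x) x := by
  have h1 : HasDerivAt (fun x : ℝ => ((ω * x : ℝ) : ℂ) * Complex.I) (ω * Complex.I) x := by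
    have := (((hasDerivAt_id x).const_mul ω).ofReal_comp).mul_const Complex.I
    simpa using this
  have := h1.cexp
  refine this.congr_deriv ?_
  simp only [wave]
  ring

theorem continuous_wave (ω : ℝ) : Continuous (wave ω) :=
  continuous_iff_continuousAt.mpr fun x => (hasDerivAt_wave ω x).continuousAt

@[simp] theorem norm_wave (ω x : ℝ) : ‖wave ω x‖ = 1 := Complex.norm_exp_ofReal_mul_I _

theorem AC.wave (ω : ℝ) : AC (wave ω) (fun x => Complex.I * ω * JostSolution.wave ω x) :=
  AC.of_hasDerivAt (hasDerivAt_wave ω) (continuous_const.mul (continuous_wave ω))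

theorem AC.wave_deriv (ω : ℝ) : AC (fun x => Complex.I * ω * JostSolution.wave ω x)
    (fun x => -(ω : ℂ) ^ 2 * JostSolution.wave ω x) := by
  have := (AC.wave ω).const_mul (Complex.I * ω)
  refine this.congr (Eventually.of_forall fun x => ?_)
  linear_combination (ω : ℂ) ^ 2 * JostSolution.wave ω x * Complex.I_sq

theorem wave_add (ω x s : ℝ) : wave ω (x + s) = wave ω x * wave ω s := by
  simp only [wave, ← Complex.exp_add]
  congr 1
  push_cast
  ring

theorem wave_neg (ω x : ℝ) : wave ω (-x) = wave (-ω) x := by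
  simp only [wave, mul_neg, neg_mul]

theorem wave_mul_neg (ω x : ℝ) : wave ω x * wave (-ω) x = 1 := by
  simp only [wave, ← Complex.exp_add]
  rw [← Complex.exp_zero]
  congr 1
  push_cast
  ring

theorem conj_wave (ω x : ℝ) : (starRingEnd ℂ) (wave ω x) = wave (-ω) x := by
  simp only [wave, ← Complex.exp_conj]
  congr 1
  simp

theorem wave_one_add (ω : ℝ) : wave ω 1 + wave (-ω) 1 = 2 * Real.cos ω := by
  simp only [wave, mul_one]
  rw [Complex.ofReal_neg, neg_mul, Complex.exp_mul_I, neg_mul_eq_neg_mul, Complex.exp_mul_I,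
    Complex.cos_neg, Complex.sin_neg, Complex.ofReal_cos]
  ring

theorem wave_one_sub (ω : ℝ) : wave ω 1 - wave (-ω) 1 = 2 * Complex.I * Real.sin ω := by
  simp only [wave, mul_one]
  rw [Complex.ofReal_neg, neg_mul, Complex.exp_mul_I, neg_mul_eq_neg_mul, Complex.exp_mul_I,
    Complex.cos_neg, Complex.sin_neg, Complex.ofReal_sin]
  ring

section Duhamel

variable {u u₁ u₂ : ℝ → ℂ} {c ω : ℝ}

/-- `u'' + ω² u` for a twice differentiable representative. -/
def helm (ω : ℝ) (u u₂ : ℝ → ℂ) (x : ℝ) : ℂ := u₂ x + (ω : ℂ) ^ 2 * u x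

/-- `B_c` acting on a twice differentiable representative. -/
def repB (c : ℝ) (u u₂ : ℝ → ℂ) (x : ℝ) : ℂ :=
  (c : ℂ) ^ 2 * u₂ x + (2 * u x + u (x + 1) + u (x - 1))

theorem AC.kern (h0 : ω ≠ 0) : AC (fun s => (kern ω s : ℂ))
    (fun s => -(Real.cos (ω * (1 - s)) : ℂ)) := by
  refine AC.of_hasDerivAt (fun s => ?_) (by fun_prop)
  have hl : HasDerivAt (fun s : ℝ => ω * (1 - s)) (-ω) s := by
    simpa using ((hasDerivAt_id s).const_sub 1).const_mul ω
  have := (hl.sin.div_const ω).ofReal_comp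
  convert! this using 1
  rw [← Complex.ofReal_neg]
  congr 1
  field_simp

theorem AC.kern_deriv (h0 : ω ≠ 0) : AC (fun s => -(Real.cos (ω * (1 - s)) : ℂ))
    (fun s => -(ω : ℂ) ^ 2 * (JostSolution.kern ω s : ℂ)) := by
  refine AC.of_hasDerivAt (fun s => ?_)
    (continuous_const.mul (Complex.continuous_ofReal.comp (continuous_kern ω)))
  have hl : HasDerivAt (fun s : ℝ => ω * (1 - s)) (-ω) s := by
    simpa using ((hasDerivAt_id s).const_sub 1).const_mul ω
  have := (hl.cos.ofReal_comp).neg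
  convert! this using 1
  simp only [JostSolution.kern]
  push_cast
  have : (ω : ℂ) ≠ 0 := by exact_mod_cast h0
  field_simp

/-- Green's formula on `[0, 1]` for `kern ω` and `s ↦ u (x + s) + u (x - s)`. The kernel solves `y''
+ ω²y = 0`, vanishes at `1` with slope `-1` and has slope `-cos ω` at `0`, where the symmetric
combination has slope zero. -/
theorem duhamel (h0 : ω ≠ 0) (h : AC u u₁) (h₁ : AC u₁ u₂) (x : ℝ) :
    ∫ s in (0 : ℝ)..1, (kern ω s : ℂ) * (helm ω u u₂ (x + s) + helm ω u u₂ (x - s)) =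
      u (x + 1) + u (x - 1) - 2 * Real.cos ω * u x := by
  have p : ∀ {v w : ℝ → ℂ}, AC v w → AC (fun s => v (x + s)) (fun s => w (x + s)) := by
    intro v w hv
    simpa only [add_comm] using hv.comp_add x
  have q : ∀ {v w : ℝ → ℂ}, AC v w → AC (fun s => v (x - s)) (fun s => -w (x - s)) := by
    intro v w hv
    have := hv.comp_neg.comp_sub x
    simpa only [neg_sub] using this
  have hM : AC (fun s => u (x + s) + u (x - s)) (fun s => u₁ (x + s) - u₁ (x - s)) := by
    simpa only [← sub_eq_add_neg] using (p h).add (q h)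
  have hM₁ : AC (fun s => u₁ (x + s) - u₁ (x - s)) (fun s => u₂ (x + s) + u₂ (x - s)) := by
    simpa only [sub_neg_eq_add] using (p h₁).sub (q h₁)
  have hΘ := ((AC.kern h0).mul hM₁).sub ((AC.kern_deriv h0).mul hM)
  have h2 := hΘ.2 0 1
  have e : ∀ s, (kern ω s : ℂ) * (helm ω u u₂ (x + s) + helm ω u u₂ (x - s)) =
      -(Real.cos (ω * (1 - s)) : ℂ) * (u₁ (x + s) - u₁ (x - s)) +
        (kern ω s : ℂ) * (u₂ (x + s) + u₂ (x - s)) -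
      (-(ω : ℂ) ^ 2 * (kern ω s : ℂ) * (u (x + s) + u (x - s)) +
        -(Real.cos (ω * (1 - s)) : ℂ) * (u₁ (x + s) - u₁ (x - s))) := by
    intro s
    simp only [helm]
    ring
  simp_rw [e]
  rw [← h2]
  simp [kern]
  ring

/-- The factorization `B_c = (c² + k*)(∂² + ω²)`: the leftover multiple of `u` is the symbol at `ω`,
which is zero. -/
theorem helm_eq (h0 : ω ≠ 0) (hz : symbolB c ω = 0) (h : AC u u₁) (h₁ : AC u₁ u₂) (x : ℝ) :
    (c : ℂ) ^ 2 * helm ω u u₂ x = repB c u u₂ x -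
      ∫ s in (0 : ℝ)..1, (kern ω s : ℂ) * (helm ω u u₂ (x + s) + helm ω u u₂ (x - s)) := by
  rw [duhamel h0 h h₁]
  have hz' : -(c : ℂ) ^ 2 * (ω : ℂ) ^ 2 + 2 + 2 * (Real.cos ω : ℂ) = 0 := by
    have := congrArg (fun t : ℝ => (t : ℂ)) hz
    simp only [symbolB] at this
    push_cast at this ⊢
    exact this
  simp only [helm, repB]
  linear_combination (-u x) * hz'

theorem enorm_helm_le (h0 : 0 < ω) (h1 : ω < 3 / 2) (hz : symbolB c ω = 0) (h : AC u u₁)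
    (h₁ : AC u₁ u₂) (x : ℝ) : ENNReal.ofReal (c ^ 2) * ‖helm ω u u₂ x‖ₑ ≤
      ‖repB c u u₂ x‖ₑ + kernConv ω (fun y => ‖helm ω u u₂ y‖ₑ) x := by
  have e1 : ENNReal.ofReal (c ^ 2) * ‖helm ω u u₂ x‖ₑ = ‖(c : ℂ) ^ 2 * helm ω u u₂ x‖ₑ := by
    rw [enorm_mul]
    congr 1
    rw [← Complex.ofReal_pow, ← ofReal_norm, Complex.norm_real,
      Real.norm_of_nonneg (sq_nonneg c)]
  rw [e1, helm_eq h0.ne' hz h h₁]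
  refine enorm_sub_le.trans (add_le_add le_rfl ?_)
  rw [intervalIntegral.integral_of_le zero_le_one]
  refine (enorm_integral_le_lintegral_enorm _).trans ?_
  refine setLIntegral_mono' measurableSet_Ioc fun s hs => ?_
  rw [enorm_mul]
  gcongr
  · rw [← ofReal_norm, Complex.norm_real, Real.norm_of_nonneg (kern_nonneg h0 h1 hs)]
  · exact enorm_add_le _ _

theorem ofReal_exp_abs_le_growth (x : ℝ) : ENNReal.ofReal (Real.exp |x|) ≤ growth x := by
  unfold growth
  rcases le_total 0 x with h | h
  · rw [abs_of_nonneg h, one_mul]; exact le_self_add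
  · rw [abs_of_nonpos h, neg_one_mul]; exact le_add_self

theorem expConv_congr {H H' : ℝ → ℝ≥0∞} (h : H =ᵐ[volume] H') (x : ℝ) :
    expConv H x = expConv H' x :=
  lintegral_congr_ae (h.mono fun z hz => by simp only [hz])

/-- Solutions of `B_c u = h` of at most exponential growth satisfy a pointwise bound on
`u'' + ω² u` in terms of `h`. -/
theorem helm_bound (hc : 1 < |c|) (h0 : 0 < ω) (h1 : ω < 3 / 2) (hz : symbolB c ω = 0)
    (h : AC u u₁) (h₁ : AC u₁ u₂) {f : ℝ → ℂ} (hf : repB c u u₂ =ᵐ[volume] f)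
    (hi : Integrable f volume) {M : ℝ} (hM : ∀ x, ‖u x‖ ≤ M * Real.exp |x|) :
    ∃ A : ℝ≥0∞, A ≠ ∞ ∧ ∀ᵐ x, ‖helm ω u u₂ x‖ₑ ≤
      A * (‖f x‖ₑ + expConv (fun y => ‖f y‖ₑ) x) := by
  have hlt := kernConst_lt hc h0 h1 hz
  have hc2 : 0 < c ^ 2 := (kernConst_nonneg ω).trans_lt hlt
  set v := h₁.1.aestronglyMeasurable.mk u₂ with hv
  have hvm : Measurable v := h₁.1.aestronglyMeasurable.stronglyMeasurable_mk.measurable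
  have huv : u₂ =ᵐ[volume] v := h₁.1.aestronglyMeasurable.ae_eq_mk
  have hA := h₁.congr huv
  have hum : Measurable u := h.continuous.measurable
  have hBm : Measurable (repB c u v) := by unfold repB; fun_prop
  have hPm : Measurable (helm ω u v) := by unfold helm; fun_prop
  have hBf : repB c u v =ᵐ[volume] f := by
    filter_upwards [hf, huv] with x a b
    rw [← a]; simp only [repB, b]
  set H : ℝ → ℝ≥0∞ := fun x => ‖repB c u v x‖ₑ with hH
  have hHm : Measurable H := hBm.enorm
  have hHf : H =ᵐ[volume] fun x => ‖f x‖ₑ := hBf.mono fun x hx => by simp only [hH, hx]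
  set U : ℝ → ℝ≥0∞ := fun x => ‖helm ω u v x‖ₑ with hU
  have hUm : Measurable U := hPm.enorm
  set C2 := ENNReal.ofReal (c ^ 2) with hC2
  have hC20 : C2 ≠ 0 := by simpa [hC2] using hc2.ne'
  have hC2t : C2 ≠ ∞ := ENNReal.ofReal_ne_top
  have hb1 : ∀ x, C2 * U x ≤ H x + kernConv ω U x := enorm_helm_le h0 h1 hz h hA
  have hHi : ∫⁻ x, H x ≠ ∞ := by
    rw [lintegral_congr_ae hHf]
    exact hi.hasFiniteIntegral.ne
  have hwb : ∀ x, expConv H x ≤ ∫⁻ z, H z := by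
    intro x
    refine lintegral_mono fun z => ?_
    refine (mul_le_mul_left (ENNReal.ofReal_le_one.mpr ?_) (H z)).trans (one_mul _).le
    exact Real.exp_le_one_iff.mpr (by linarith [abs_nonneg (x - z)])
  have hM0 : 0 ≤ M := by simpa using (norm_nonneg _).trans (hM 0)
  -- A crude a priori bound: apart from the source, `c²(u'' + ω²u)` involves only `u` and its
  -- shifts, which grow at most like `e^{|x|}`.
  have hb2 : ∀ x, C2 * U x ≤ H x +
      ENNReal.ofReal (M * (2 + 2 * Real.exp 1 + c ^ 2 * ω ^ 2)) * growth x := by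
    intro x
    have e : (c : ℂ) ^ 2 * helm ω u v x = repB c u v x + ((c : ℂ) ^ 2 * (ω : ℂ) ^ 2 * u x -
        (2 * u x + u (x + 1) + u (x - 1))) := by
      simp only [helm, repB]; ring
    have e1 : C2 * U x = ‖(c : ℂ) ^ 2 * helm ω u v x‖ₑ := by
      rw [enorm_mul]
      congr 1
      rw [← Complex.ofReal_pow, ← ofReal_norm, Complex.norm_real,
        Real.norm_of_nonneg (sq_nonneg c)]
    rw [e1, e]
    refine (enorm_add_le _ _).trans (add_le_add le_rfl ?_)
    refine le_trans ?_ (mul_le_mul_right (ofReal_exp_abs_le_growth x) _)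
    rw [← ENNReal.ofReal_mul (by positivity), ← ofReal_norm]
    refine ENNReal.ofReal_le_ofReal ?_
    have s1 : ∀ t : ℝ, |t| = 1 → ‖u (x + t)‖ ≤ M * (Real.exp 1 * Real.exp |x|) := by
      intro t ht
      refine (hM _).trans ?_
      gcongr
      rw [← Real.exp_add]
      refine Real.exp_le_exp.mpr ((abs_add_le x t).trans ?_)
      rw [ht, add_comm]
    have s2 := s1 1 (by simp)
    have s3 := s1 (-1) (by simp)
    rw [← sub_eq_add_neg] at s3
    have s4 := hM x
    have n1 : ‖(c : ℂ) ^ 2 * (ω : ℂ) ^ 2 * u x‖ = c ^ 2 * ω ^ 2 * ‖u x‖ := by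
      rw [norm_mul, norm_mul, norm_pow, norm_pow, Complex.norm_real, Complex.norm_real,
        Real.norm_eq_abs, Real.norm_eq_abs, sq_abs, sq_abs]
    calc _ ≤ ‖(c : ℂ) ^ 2 * (ω : ℂ) ^ 2 * u x‖ + (‖2 * u x‖ + ‖u (x + 1)‖ + ‖u (x - 1)‖) := by
          refine (norm_sub_le _ _).trans (add_le_add le_rfl ?_)
          exact (norm_add_le _ _).trans (add_le_add (norm_add_le _ _) le_rfl)
      _ ≤ c ^ 2 * ω ^ 2 * (M * Real.exp |x|) + (2 * (M * Real.exp |x|) +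
          M * (Real.exp 1 * Real.exp |x|) + M * (Real.exp 1 * Real.exp |x|)) := by
          rw [n1, norm_mul, Complex.norm_ofNat]
          gcongr
      _ = _ := by ring
  -- The iteration runs on `k * U` rather than on `U`. The source `H` is merely integrable, but its
  -- convolution with the bounded kernel is bounded, so `y` has the pointwise growth bound that the
  -- subsolution estimate requires.
  set y := kernConv ω U with hy
  have hym : Measurable y := measurable_kernConv hUm
  have hgm := measurable_growth
  set e2 := ENNReal.ofReal (2 * Real.exp 1) with he2
  have hy1 : ∀ x, C2 * y x ≤ e2 * expConv H x + kernConv ω y x := by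
    intro x
    rw [← kernConv_const_mul hUm]
    refine (kernConv_mono hb1 x).trans ?_
    rw [kernConv_add hHm]
    gcongr
    exact kernConv_le_expConv h0 hHm x
  set N := ENNReal.ofReal (M * (2 + 2 * Real.exp 1 + c ^ 2 * ω ^ 2)) with hN
  have hy2 : ∀ x, y x ≤ C2⁻¹ * (e2 * (∫⁻ z, H z) + N * ENNReal.ofReal (kernConst ω)) *
      growth x := by
    intro x
    have : C2 * y x ≤ (e2 * (∫⁻ z, H z) + N * ENNReal.ofReal (kernConst ω)) * growth x := by
      rw [← kernConv_const_mul hUm]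
      refine (kernConv_mono hb2 x).trans ?_
      rw [kernConv_add hHm, kernConv_const_mul hgm, kernConv_growth h0 h1, add_mul]
      refine add_le_add ?_ (le_of_eq (by ring))
      refine (kernConv_le_expConv h0 hHm x).trans ?_
      calc e2 * expConv H x ≤ e2 * (∫⁻ z, H z) * 1 := by
            rw [mul_one]; gcongr; exact hwb x
        _ ≤ _ := by gcongr; exact one_le_growth x
    rw [mul_assoc, ← ENNReal.mul_le_mul_iff_right hC20 hC2t, ← mul_assoc C2,
      ENNReal.mul_inv_cancel hC20 hC2t, one_mul]
    exact this
  have hfin := le_expConv_of_subsolution h0 h1 hlt hHm (κ := e2)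
    (M := C2⁻¹ * (e2 * (∫⁻ z, H z) + N * ENNReal.ofReal (kernConst ω)))
    (by
      refine ENNReal.mul_ne_top (ENNReal.inv_ne_top.mpr hC20) (ENNReal.add_ne_top.mpr ⟨?_, ?_⟩)
      · exact ENNReal.mul_ne_top ENNReal.ofReal_ne_top hHi
      · exact ENNReal.mul_ne_top ENNReal.ofReal_ne_top ENNReal.ofReal_ne_top) hy1 hy2
  set B := e2 * ENNReal.ofReal (c ^ 2 - kernConst ω)⁻¹ with hB
  have hBt : B ≠ ∞ := ENNReal.mul_ne_top ENNReal.ofReal_ne_top ENNReal.ofReal_ne_top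
  refine ⟨C2⁻¹ * (1 + B), ENNReal.mul_ne_top (ENNReal.inv_ne_top.mpr hC20)
    (ENNReal.add_ne_top.mpr ⟨ENNReal.one_ne_top, hBt⟩), ?_⟩
  filter_upwards [huv, hHf] with x a b
  have e3 : helm ω u u₂ x = helm ω u v x := by simp only [helm, a]
  rw [e3, mul_assoc, ← ENNReal.mul_le_mul_iff_right hC20 hC2t, ← mul_assoc C2,
    ENNReal.mul_inv_cancel hC20 hC2t, one_mul, ← b, ← expConv_congr hHf]
  calc C2 * U x ≤ H x + B * expConv H x := (hb1 x).trans (add_le_add le_rfl (hfin x))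
    _ ≤ (1 + B) * (H x + expConv H x) := by
        rw [add_mul, one_mul, mul_add]
        exact add_le_add le_self_add le_add_self

end Duhamel

/-- The weighted mass `∫ min(1, e^{z-x}) |f(z)| dz`. -/
def tailMass (f : ℝ → ℂ) (x : ℝ) : ℝ≥0∞ :=
  ∫⁻ z, ENNReal.ofReal (min 1 (Real.exp (z - x))) * ‖f z‖ₑ

/-- The origin of the weight in `tailMass`: the mass of `e^{-|t-z|}` beyond `x` is `e^{z-x}` when
`z` lies left of `x`, and otherwise at most the total mass `2`. -/
theorem lintegral_exp_abs_Ioi_le (x z : ℝ) :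
    ∫⁻ t in Set.Ioi x, ENNReal.ofReal (Real.exp (-|t - z|)) ≤
      2 * ENNReal.ofReal (min 1 (Real.exp (z - x))) := by
  have hr : ∀ y, z ≤ y → ∫⁻ t in Set.Ioi y, ENNReal.ofReal (Real.exp (-|t - z|)) =
      ENNReal.ofReal (Real.exp (z - y)) := by
    intro y hy
    have e : ∀ t ∈ Set.Ioi y, ENNReal.ofReal (Real.exp (-|t - z|)) =
        ENNReal.ofReal (Real.exp z) * ENNReal.ofReal (Real.exp (-t)) := by
      intro t ht
      have : y < t := ht
      rw [← ENNReal.ofReal_mul (Real.exp_pos _).le, ← Real.exp_add, abs_of_pos (by linarith)]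
      ring_nf
    rw [setLIntegral_congr_fun measurableSet_Ioi e, lintegral_const_mul' _ _ ENNReal.ofReal_ne_top,
      ← ofReal_integral_eq_lintegral_ofReal (integrableOn_exp_neg_Ioi y)
        (Eventually.of_forall fun _ => (Real.exp_pos _).le), integral_exp_neg_Ioi,
      ← ENNReal.ofReal_mul (Real.exp_pos _).le, ← Real.exp_add]
    ring_nf
  have hl : ∫⁻ t in Set.Iic z, ENNReal.ofReal (Real.exp (-|t - z|)) = 1 := by
    have e : ∀ t ∈ Set.Iic z, ENNReal.ofReal (Real.exp (-|t - z|)) =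
        ENNReal.ofReal (Real.exp (-z)) * ENNReal.ofReal (Real.exp t) := by
      intro t ht
      have : t ≤ z := ht
      rw [← ENNReal.ofReal_mul (Real.exp_pos _).le, ← Real.exp_add, abs_of_nonpos (by linarith)]
      ring_nf
    rw [setLIntegral_congr_fun measurableSet_Iic e, lintegral_const_mul' _ _ ENNReal.ofReal_ne_top,
      ← ofReal_integral_eq_lintegral_ofReal (integrableOn_exp_Iic z)
        (Eventually.of_forall fun _ => (Real.exp_pos _).le), integral_exp_Iic,
      ← ENNReal.ofReal_mul (Real.exp_pos _).le, ← Real.exp_add]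
    simp
  rcases le_total z x with h | h
  · rw [hr x h, min_eq_right (Real.exp_le_one_iff.mpr (by linarith)), two_mul]
    exact le_self_add
  · rw [min_eq_left (Real.one_le_exp (by linarith)), ENNReal.ofReal_one, mul_one]
    refine (setLIntegral_le_lintegral _ _).trans (le_of_eq ?_)
    rw [← lintegral_add_compl _ (measurableSet_Iic (a := z)), hl, Set.compl_Iic, hr z le_rfl]
    simp
    norm_num

theorem lintegral_Ioi_enorm_le_tailMass (f : ℝ → ℂ) (x : ℝ) :
    ∫⁻ t in Set.Ioi x, ‖f t‖ₑ ≤ tailMass f x := by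
  rw [← lintegral_indicator measurableSet_Ioi]
  refine lintegral_mono fun t => ?_
  by_cases ht : t ∈ Set.Ioi x
  · have : x < t := ht
    rw [Set.indicator_of_mem ht, min_eq_left (Real.one_le_exp (by linarith)),
      ENNReal.ofReal_one, one_mul]
  · rw [Set.indicator_of_notMem ht]; exact zero_le

theorem lintegral_Ioi_le_tailMass {f : ℝ → ℂ} (hf : AEStronglyMeasurable f volume) (x : ℝ) :
    ∫⁻ t in Set.Ioi x, (‖f t‖ₑ + expConv (fun y => ‖f y‖ₑ) t) ≤ 3 * tailMass f x := by
  have h2 : ∫⁻ t in Set.Ioi x, expConv (fun y => ‖f y‖ₑ) t ≤ 2 * tailMass f x := by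
    unfold expConv
    rw [lintegral_lintegral_swap]
    · rw [tailMass, ← lintegral_const_mul' 2 _ (by simp)]
      refine lintegral_mono fun z => ?_
      rw [lintegral_mul_const _ (by fun_prop), ← mul_assoc]
      gcongr
      exact lintegral_exp_abs_Ioi_le x z
    · have : AEMeasurable (fun p : ℝ × ℝ => ENNReal.ofReal (Real.exp (-|p.1 - p.2|)) * ‖f p.2‖ₑ)
          ((volume.restrict (Set.Ioi x)).prod volume) :=
        AEMeasurable.mul (Measurable.aemeasurable (by fun_prop)) hf.enorm.comp_snd
      exact this
  rw [lintegral_add_left' (hf.enorm.mono_measure Measure.restrict_le_self)]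
  calc _ ≤ tailMass f x + 2 * tailMass f x := add_le_add (lintegral_Ioi_enorm_le_tailMass f x) h2
    _ = _ := by ring

theorem exists_limit_of_AC {w z : ℝ → ℂ} (h : AC w z)
    (hz : ∀ x, ∫⁻ t in Set.Ioi x, ‖z t‖ₑ ≠ ∞) :
    ∃ ℓ, ∀ x, ‖w x - ℓ‖ₑ ≤ ∫⁻ t in Set.Ioi x, ‖z t‖ₑ := by
  have hi : ∀ x, IntegrableOn z (Set.Ioi x) volume := fun x =>
    ⟨h.1.aestronglyMeasurable.restrict, (hz x).lt_top⟩
  refine ⟨w 0 + ∫ t in Set.Ioi 0, z t, fun x => ?_⟩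
  have h1 := intervalIntegral.integral_interval_add_Ioi (hi 0) (hi x)
  rw [← h.2] at h1
  have e : w x - (w 0 + ∫ t in Set.Ioi 0, z t) = -∫ t in Set.Ioi x, z t := by
    rw [← h1]; ring
  rw [e, enorm_neg]
  exact enorm_integral_le_lintegral_enorm _

/-- Asymptotics at `+∞` of a function for which `u'' + ω² u` is integrable at `+∞`. -/
theorem exists_amplitudes {u u₁ u₂ : ℝ → ℂ} {ω : ℝ} (h0 : 0 < ω) (h : AC u u₁) (h₁ : AC u₁ u₂)
    (hz : ∀ x, ∫⁻ t in Set.Ioi x, ‖helm ω u u₂ t‖ₑ ≠ ∞) :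
    ∃ a b : ℂ, ∃ A : ℝ≥0∞, A ≠ ∞ ∧ ∀ x,
      ‖u x - (a * wave ω x + b * wave (-ω) x)‖ₑ ≤
        A * ∫⁻ t in Set.Ioi x, ‖helm ω u u₂ t‖ₑ ∧
      ‖u₁ x - Complex.I * ω * (a * wave ω x - b * wave (-ω) x)‖ₑ ≤
        A * ∫⁻ t in Set.Ioi x, ‖helm ω u u₂ t‖ₑ := by
  -- Variation of constants: `(u' + iω'u) e^{-iω'x}` has derivative `(u'' + ω²u) e^{-iω'x}`, so it
  -- converges at `+∞`. The choices `ω' = ±ω` produce the two amplitudes.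
  have key : ∀ ω' : ℝ, ω' ^ 2 = ω ^ 2 → ∃ ℓ, ∀ x,
      ‖(u₁ x + Complex.I * ω' * u x) * wave (-ω') x - ℓ‖ₑ ≤
        ∫⁻ t in Set.Ioi x, ‖helm ω u u₂ t‖ₑ := by
    intro ω' hω
    have hω' : (ω' : ℂ) ^ 2 = (ω : ℂ) ^ 2 := by exact_mod_cast hω
    have hA := (h₁.add (h.const_mul (Complex.I * ω'))).mul (AC.wave (-ω'))
    have e : ∀ x, (u₂ x + Complex.I * ω' * u₁ x) * wave (-ω') x +
        (u₁ x + Complex.I * ω' * u x) * (Complex.I * ((-ω' : ℝ) : ℂ) * wave (-ω') x) =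
        helm ω u u₂ x * wave (-ω') x := by
      intro x
      simp only [helm]
      push_cast
      linear_combination (wave (-ω') x * u x) * hω' -
        (ω' : ℂ) ^ 2 * wave (-ω') x * u x * Complex.I_sq
    have e2 : ∀ x, ‖helm ω u u₂ x * wave (-ω') x‖ₑ = ‖helm ω u u₂ x‖ₑ := by
      intro x
      rw [enorm_mul, ← ofReal_norm (wave _ _), norm_wave]
      simp
    have hA' := hA.congr (Eventually.of_forall e)
    obtain ⟨ℓ, hℓ⟩ := exists_limit_of_AC hA' (by simpa only [e2] using hz)
    exact ⟨ℓ, by simpa only [e2] using hℓ⟩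
  obtain ⟨p, hp⟩ := key ω rfl
  obtain ⟨q, hq⟩ := key (-ω) (by ring)
  have hωc : (ω : ℂ) ≠ 0 := by exact_mod_cast h0.ne'
  have hI := Complex.I_ne_zero
  simp only [neg_neg, Complex.ofReal_neg] at hq
  set V : ℝ → ℝ≥0∞ := fun x => ∫⁻ t in Set.Ioi x, ‖helm ω u u₂ t‖ₑ with hV
  set k : ℂ := (2 * Complex.I * ω)⁻¹ with hk
  have hk' : 2 * Complex.I * ω * k = 1 := mul_inv_cancel₀ (by simp [h0.ne'])
  have bd : ∀ (m n P Q : ℂ) (x : ℝ), ‖P‖ₑ ≤ V x → ‖Q‖ₑ ≤ V x →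
      ‖m * (P * wave ω x) + n * (Q * wave (-ω) x)‖ₑ ≤ (‖m‖ₑ + ‖n‖ₑ) * V x := by
    intro m n P Q x hP hQ
    refine (enorm_add_le _ _).trans ?_
    have w1 : ∀ ω', ‖wave ω' x‖ₑ = 1 := fun ω' => by rw [← ofReal_norm, norm_wave]; simp
    rw [enorm_mul, enorm_mul, enorm_mul, enorm_mul, w1, w1, mul_one, mul_one, add_mul]
    gcongr
  refine ⟨k * p, -k * q, (‖k‖ₑ + ‖-k‖ₑ) + (‖(1 / 2 : ℂ)‖ₑ + ‖(1 / 2 : ℂ)‖ₑ), by simp,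
    fun x => ⟨?_, ?_⟩⟩
  · have e : u x - (k * p * wave ω x + -k * q * wave (-ω) x) =
        k * (((u₁ x + Complex.I * ω * u x) * wave (-ω) x - p) * wave ω x) +
        -k * (((u₁ x + Complex.I * -ω * u x) * wave ω x - q) * wave (-ω) x) := by
      have w := wave_mul_neg ω x
      linear_combination (-u x) * hk' - (2 * Complex.I * ω * k * u x) * w
    rw [e]
    refine (bd _ _ _ _ x (hp x) (hq x)).trans ?_
    exact mul_le_mul_left le_self_add _
  · have e : u₁ x - Complex.I * ω * (k * p * wave ω x - -k * q * wave (-ω) x) =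
        (1 / 2) * (((u₁ x + Complex.I * ω * u x) * wave (-ω) x - p) * wave ω x) +
        (1 / 2) * (((u₁ x + Complex.I * -ω * u x) * wave ω x - q) * wave (-ω) x) := by
      have w := wave_mul_neg ω x
      linear_combination (-u₁ x) * w - (1 / 2) * (p * wave ω x + q * wave (-ω) x) * hk'
    rw [e]
    refine (bd _ _ _ _ x (hp x) (hq x)).trans ?_
    exact mul_le_mul_left le_add_self _

/-- Asymptotics at `+∞` of solutions of `B_c u = f` of at most exponential growth. -/
theorem exists_asymptotics {u u₁ u₂ f : ℝ → ℂ} {c ω : ℝ} (hc : 1 < |c|) (h0 : 0 < ω)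
    (h1 : ω < 3 / 2) (hz : symbolB c ω = 0) (h : AC u u₁) (h₁ : AC u₁ u₂)
    (hf : repB c u u₂ =ᵐ[volume] f) (hi : Integrable f volume) {M : ℝ}
    (hM : ∀ x, ‖u x‖ ≤ M * Real.exp |x|) :
    ∃ a b : ℂ, ∃ A : ℝ≥0∞, A ≠ ∞ ∧ ∀ x,
      ‖u x - (a * wave ω x + b * wave (-ω) x)‖ₑ ≤ A * tailMass f x ∧
      ‖u₁ x - Complex.I * ω * (a * wave ω x - b * wave (-ω) x)‖ₑ ≤ A * tailMass f x := by
  obtain ⟨A, hA, hb⟩ := helm_bound hc h0 h1 hz h h₁ hf hi hM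
  have hle : ∀ x, ∫⁻ t in Set.Ioi x, ‖helm ω u u₂ t‖ₑ ≤ A * (3 * tailMass f x) := by
    intro x
    calc _ ≤ ∫⁻ t in Set.Ioi x, A * (‖f t‖ₑ + expConv (fun y => ‖f y‖ₑ) t) :=
          lintegral_mono_ae (ae_restrict_of_ae hb)
      _ ≤ _ := by
          rw [lintegral_const_mul' _ _ hA]
          gcongr
          exact lintegral_Ioi_le_tailMass hi.1 x
  have hfin : ∀ x, tailMass f x ≠ ∞ := by
    intro x
    refine ne_top_of_le_ne_top hi.hasFiniteIntegral.ne (lintegral_mono fun z => ?_)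
    refine (mul_le_mul_left (ENNReal.ofReal_le_one.mpr (min_le_left _ _)) _).trans (one_mul _).le
  obtain ⟨a, b, A', hA', hab⟩ := exists_amplitudes h0 h h₁ fun x =>
    ne_top_of_le_ne_top (ENNReal.mul_ne_top hA (ENNReal.mul_ne_top (by simp) (hfin x))) (hle x)
  refine ⟨a, b, A' * (A * 3), ENNReal.mul_ne_top hA' (ENNReal.mul_ne_top hA (by simp)),
    fun x => ⟨(hab x).1.trans ?_, (hab x).2.trans ?_⟩⟩ <;>
  · rw [mul_assoc, mul_assoc]
    gcongr
    exact hle x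

end JostSolution

end

/-! ### One-sided exponential weights and the passage from `L_c^*` to `L_c` -/

open MeasureTheory Filter Topology

noncomputable section

namespace JostSolution

/-- Pointwise exponential bound `u(x) = O(e^{-qx})` on the whole line. -/
def ExpBdd (q : ℝ) (u : ℝ → ℂ) : Prop := ∃ C, ∀ x, ‖u x‖ ≤ C * Real.exp (-q * x)

namespace ExpBdd

variable {q : ℝ} {u v : ℝ → ℂ}

theorem exists_nonneg (h : ExpBdd q u) : ∃ C, 0 ≤ C ∧ ∀ x, ‖u x‖ ≤ C * Real.exp (-q * x) := by
  obtain ⟨C, hC⟩ := h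
  refine ⟨C, ?_, hC⟩
  simpa using (norm_nonneg _).trans (hC 0)

theorem add (h : ExpBdd q u) (h' : ExpBdd q v) : ExpBdd q (fun x => u x + v x) := by
  obtain ⟨C, hC⟩ := h
  obtain ⟨D, hD⟩ := h'
  refine ⟨C + D, fun x => (norm_add_le _ _).trans ?_⟩
  rw [add_mul]
  exact add_le_add (hC x) (hD x)

theorem mul {b : ℝ → ℂ} {B : ℝ} (hb : ∀ x, ‖b x‖ ≤ B) (h : ExpBdd q u) :
    ExpBdd q (fun x => b x * u x) := by
  obtain ⟨C, hC⟩ := h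
  refine ⟨B * C, fun x => ?_⟩
  rw [norm_mul, mul_assoc]
  exact mul_le_mul (hb x) (hC x) (norm_nonneg _) ((norm_nonneg _).trans (hb x))

theorem const_mul (h : ExpBdd q u) (k : ℂ) : ExpBdd q (fun x => k * u x) :=
  h.mul (b := fun _ => k) (B := ‖k‖) fun _ => le_rfl

theorem neg (h : ExpBdd q u) : ExpBdd q (fun x => -u x) := by
  simpa [ExpBdd] using h

theorem sub (h : ExpBdd q u) (h' : ExpBdd q v) : ExpBdd q (fun x => u x - v x) := by
  simpa [sub_eq_add_neg] using h.add h'.neg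

theorem comp_add (h : ExpBdd q u) (s : ℝ) : ExpBdd q (fun x => u (x + s)) := by
  obtain ⟨C, hC⟩ := h
  refine ⟨C * Real.exp (-q * s), fun x => (hC _).trans (le_of_eq ?_)⟩
  rw [mul_assoc, ← Real.exp_add]
  ring_nf

theorem comp_sub (h : ExpBdd q u) (s : ℝ) : ExpBdd q (fun x => u (x - s)) := by
  simpa [sub_eq_add_neg] using h.comp_add (-s)

theorem conj (h : ExpBdd q u) : ExpBdd q (fun x => (starRingEnd ℂ) (u x)) := by
  simpa [ExpBdd] using h

theorem congr (h : ExpBdd q u) (e : ∀ x, u x = v x) : ExpBdd q v := by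
  rwa [← show u = v from funext e]

theorem average (h : ExpBdd q u) : ExpBdd q (fun x => 2 * u x + u (x + 1) + u (x - 1)) :=
  ((h.const_mul 2).add (h.comp_add 1)).add (h.comp_sub 1)

theorem tendsto (h : ExpBdd q u) (hq : 0 < q) : Tendsto u atTop (𝓝 0) := by
  obtain ⟨C, hC⟩ := h
  refine squeeze_zero_norm hC ?_
  have h1 : Tendsto (fun x : ℝ => -q * x) atTop atBot :=
    tendsto_id.const_mul_atTop_of_neg (by linarith)
  simpa using (Real.tendsto_exp_atBot.comp h1).const_mul C

end ExpBdd

theorem ExpBdd.of_exp_abs {p q C : ℝ} {u : ℝ → ℂ} (hp : 0 ≤ q) (hpq : q ≤ p) (hC : 0 ≤ C)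
    (h : ∀ x, ‖u x‖ ≤ C * Real.exp (-p * |x|)) : ExpBdd q u := by
  refine ⟨C, fun x => (h x).trans (mul_le_mul_of_nonneg_left (Real.exp_le_exp.mpr ?_) hC)⟩
  linarith [mul_le_mul_of_nonneg_left (le_abs_self x) hp,
    mul_le_mul_of_nonneg_right hpq (abs_nonneg x)]

/-- If `u` and `u''` are `O(e^{-qx})`, so is `u'`. -/
theorem ExpBdd.deriv {u u₁ u₂ : ℝ → ℂ} {q : ℝ} (hq : 0 ≤ q) (h : AC u u₁) (h₁ : AC u₁ u₂)
    (hu : ExpBdd q u) {C : ℝ} (hC : ∀ᵐ x, ‖u₂ x‖ ≤ C * Real.exp (-q * x)) : ExpBdd q u₁ := by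
  obtain ⟨D, hD⟩ := hu
  refine ⟨2 * D + C, fun x => ?_⟩
  have hC0 : 0 ≤ C := by
    obtain ⟨y, hy⟩ := hC.exists
    exact nonneg_of_mul_nonneg_left ((norm_nonneg _).trans hy) (Real.exp_pos _)
  have hi := h₁.continuous.intervalIntegrable (μ := volume) x (x + 1)
  -- The mean of `u₁` over a unit interval is a difference of values of `u`, and the deviation from
  -- the mean is controlled by `u₂`.
  have e : u₁ x = (u (x + 1) - u x) - ∫ t in x..(x + 1), (u₁ t - u₁ x) := by
    rw [intervalIntegral.integral_sub hi intervalIntegrable_const, ← h.2]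
    simp
  have b1 : ∀ t ∈ Set.uIoc x (x + 1), ‖u₁ t - u₁ x‖ ≤ C * Real.exp (-q * x) := by
    intro t ht
    rw [Set.uIoc_of_le (by linarith)] at ht
    rw [h₁.2]
    have := intervalIntegral.norm_integral_le_of_norm_le_const_ae (a := x) (b := t) (f := u₂)
      (C := C * Real.exp (-q * x)) ?_
    · refine this.trans ?_
      rw [abs_of_nonneg (by linarith [ht.1])]
      exact mul_le_of_le_one_right (by positivity) (by linarith [ht.2])
    · filter_upwards [hC] with y hy hy'
      rw [Set.uIoc_of_le ht.1.le] at hy'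
      refine hy.trans (mul_le_mul_of_nonneg_left (Real.exp_le_exp.mpr ?_) hC0)
      linarith [mul_le_mul_of_nonneg_left hy'.1.le hq]
  have b2 := intervalIntegral.norm_integral_le_of_norm_le_const b1
  have b3 : ‖u (x + 1)‖ ≤ D * Real.exp (-q * x) := by
    refine (hD _).trans ?_
    have : 0 ≤ D := by simpa using (norm_nonneg _).trans (hD 0)
    refine mul_le_mul_of_nonneg_left (Real.exp_le_exp.mpr ?_) this
    linarith
  rw [e]
  calc _ ≤ ‖u (x + 1)‖ + ‖u x‖ + ‖∫ t in x..(x + 1), (u₁ t - u₁ x)‖ :=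
        (norm_sub_le _ _).trans (by gcongr; exact norm_sub_le _ _)
    _ ≤ _ := by
        have := hD x
        rw [add_sub_cancel_left, abs_one, mul_one] at b2
        linarith

/-- Invertibility of `L_c^*` on exponentially weighted spaces, for pointwise representatives. -/
structure AdjointSolvable (c q : ℝ) (m : ℝ → ℂ) : Prop where
  unique : ∀ {u u₁ u₂ : ℝ → ℂ}, AC u u₁ → AC u₁ u₂ → ExpBdd q u →
    repLstar c m u u₂ =ᵐ[volume] 0 → ∀ x, u x = 0
  solve : ∀ {g : ℝ → ℂ}, Continuous g → ExpBdd q g → ∃ u u₁ u₂, AC u u₁ ∧ AC u₁ u₂ ∧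
    ExpBdd q u ∧ ExpBdd q u₁ ∧ repLstar c m u u₂ =ᵐ[volume] g

theorem hasDerivAt_exp_complex (q x : ℝ) : HasDerivAt (fun x => (Real.exp (q * x) : ℂ))
    (q * (Real.exp (q * x) : ℂ)) x := by
  have := (((hasDerivAt_id x).const_mul q).exp).ofReal_comp
  refine this.congr_deriv ?_
  simp
  ring

theorem continuous_exp_complex (q : ℝ) : Continuous fun x => (Real.exp (q * x) : ℂ) := by fun_prop

theorem AC.exp (q : ℝ) : AC (fun x => (Real.exp (q * x) : ℂ))
    (fun x => q * (Real.exp (q * x) : ℂ)) :=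
  AC.of_hasDerivAt (hasDerivAt_exp_complex q) (by fun_prop)

theorem memLp_top_of_exp {q C : ℝ} {v : ℝ → ℂ} (hv : LocallyIntegrable v volume)
    (h : ∀ᵐ x, ‖v x‖ ≤ C * Real.exp (-q * x)) :
    MemLp (fun x => (Real.exp (q * x) : ℂ) * v x) ⊤ volume := by
  refine memLp_top_of_bound ((continuous_exp_complex q).aestronglyMeasurable.mul
    hv.aestronglyMeasurable) C ?_
  filter_upwards [h] with x hx
  rw [norm_mul, Complex.norm_real, Real.norm_of_nonneg (Real.exp_pos _).le]
  calc _ ≤ Real.exp (q * x) * (C * Real.exp (-q * x)) := by gcongr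
    _ = C * (Real.exp (q * x) * Real.exp (-q * x)) := by ring
    _ = C := by rw [← Real.exp_add]; simp

theorem ae_bound_second {c q : ℝ} (hc : c ≠ 0) {m g u u₂ : ℝ → ℂ} {B : ℝ} (hm : ∀ x, ‖m x‖ ≤ B)
    (hu : ExpBdd q u) (hg : ExpBdd q g) (he : repLstar c m u u₂ =ᵐ[volume] g) :
    ∃ C, ∀ᵐ x, ‖u₂ x‖ ≤ C * Real.exp (-q * x) := by
  obtain ⟨C, hC⟩ := ((hg.sub (hu.average.mul hm)).const_mul ((c : ℂ) ^ 2)⁻¹)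
  refine ⟨C, ?_⟩
  filter_upwards [he] with x hx
  have hc' : (c : ℂ) ^ 2 ≠ 0 := by simp [hc]
  have : u₂ x = ((c : ℂ) ^ 2)⁻¹ * (g x - m x * (2 * u x + u (x + 1) + u (x - 1))) := by
    rw [← hx, repLstar, add_sub_cancel_right, inv_mul_cancel_left₀ hc']
  rw [this]
  exact hC x

theorem memWqInf_two {q C : ℝ} {u u₁ u₂ : ℝ → ℂ} (h : AC u u₁) (h₁ : AC u₁ u₂)
    (hu : ExpBdd q u) (hu₁ : ExpBdd q u₁) (hu₂ : ∀ᵐ x, ‖u₂ x‖ ≤ C * Real.exp (-q * x)) :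
    MemWqInf (-q) 2 u := by
  have hE := AC.exp q
  have hF := hE.mul h
  have hF₁ : AC (fun x => q * (Real.exp (q * x) : ℂ) * u x + (Real.exp (q * x) : ℂ) * u₁ x)
      (fun x => (Real.exp (q * x) : ℂ) * (q ^ 2 * u x + 2 * q * u₁ x + u₂ x)) := by
    refine (((hE.const_mul q).mul h).add (hE.mul h₁)).congr (Eventually.of_forall fun x => ?_)
    simp only
    ring
  obtain ⟨C₀, hC₀⟩ := hu
  obtain ⟨C₁, hC₁⟩ := hu₁
  have m0 : MemLp (fun x => (Real.exp (q * x) : ℂ) * u x) ⊤ volume :=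
    memLp_top_of_exp h.locallyIntegrable (Eventually.of_forall hC₀)
  have m1 : MemLp (fun x => (Real.exp (q * x) : ℂ) * u₁ x) ⊤ volume :=
    memLp_top_of_exp h₁.locallyIntegrable (Eventually.of_forall hC₁)
  have m2 : MemLp (fun x => (Real.exp (q * x) : ℂ) * u₂ x) ⊤ volume :=
    memLp_top_of_exp h₁.1 hu₂
  unfold MemWqInf
  rw [neg_neg]
  intro k hk
  interval_cases k
  · exact ⟨_, hasWeakDeriv_zero hF.locallyIntegrable, m0⟩
  · refine ⟨_, hF.hasWeakDeriv, ((m0.const_mul (q : ℂ)).add m1).congr_norm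
      hF.1.aestronglyMeasurable (Eventually.of_forall fun x => ?_)⟩
    simp only [Pi.add_apply]
    ring_nf
  · refine ⟨_, hF.hasWeakDeriv_two hF₁, (((m0.const_mul ((q : ℂ) ^ 2)).add
      (m1.const_mul (2 * (q : ℂ)))).add m2).congr_norm
      hF₁.1.aestronglyMeasurable (Eventually.of_forall fun x => ?_)⟩
    simp only [Pi.add_apply]
    ring_nf

theorem exists_rep_of_memWqInf {q : ℝ} {f : ℝ → ℂ} (h : MemWqInf (-q) 2 f) :
    ∃ u u₁ u₂, u =ᵐ[volume] f ∧ AC u u₁ ∧ AC u₁ u₂ ∧ ExpBdd q u := by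
  unfold MemWqInf at h
  rw [neg_neg] at h
  obtain ⟨g0, hg0, hb⟩ := h 0 (by norm_num)
  obtain ⟨g2, hg2, -⟩ := h 2 le_rfl
  obtain ⟨v, v₁, hv, h1, h2⟩ := hg2.exists_AC_two
  have hE := AC.exp (-q)
  have hF := hE.mul h1
  have hF₁ := ((hE.const_mul ((-q : ℝ) : ℂ)).mul h1).add (hE.mul h2)
  refine ⟨_, _, _, ?_, hF, hF₁, ?_⟩
  · filter_upwards [hv] with x hx
    rw [hx, ← mul_assoc, ← Complex.ofReal_mul, ← Real.exp_add]
    simp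
  · have hae : v =ᵐ[volume] g0 := hv.trans hg0.ae_eq_zero.symm
    obtain ⟨C, hC⟩ : ∃ C, ∀ᵐ x, ‖v x‖ ≤ C := by
      refine ⟨(eLpNormEssSup g0 volume).toReal, ?_⟩
      have hfin : eLpNormEssSup g0 volume ≠ ⊤ := by simpa using hb.eLpNorm_ne_top
      filter_upwards [hae, ae_le_eLpNormEssSup (f := g0) (μ := volume)] with x hx hle
      rw [hx]
      rwa [← toReal_enorm, ENNReal.toReal_le_toReal enorm_ne_top hfin]
    have hC' : ∀ x, ‖v x‖ ≤ C := by
      have : ∀ x, max ‖v x‖ C = C := fun x => congrFun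
        (((h1.continuous.norm.max continuous_const).ae_eq_iff_eq volume continuous_const).mp
          (hC.mono fun x hx => max_eq_right hx)) x
      exact fun x => max_eq_right_iff.mp (this x)
    refine ⟨C, fun x => ?_⟩
    rw [norm_mul, Complex.norm_real, Real.norm_of_nonneg (Real.exp_pos _).le, mul_comm]
    gcongr
    exact hC' x

/-- The hypothesis concerns classes modulo null sets; twice differentiable representatives turn it
into pointwise statements. For uniqueness only `u` is assumed to be `O(e^{-qx})`: the equation
bounds `u₂`, and then `ExpBdd.deriv` bounds `u₁`, as membership in the `W^{2,∞}` space demands. -/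
theorem AdjointInvertible.solvable {c q : ℝ} {ς : ℝ → ℝ} {s : ℝ → ℂ} {B : ℝ} (hc : c ≠ 0)
    (hq : 0 ≤ q) (hs : ∀ᵐ x, (ς x : ℂ) = s x) (hB : ∀ x, ‖1 + 2 * s x‖ ≤ B)
    (hI : AdjointInvertible c ς q) : AdjointSolvable c q (fun x => 1 + 2 * s x) where
  unique := by
    intro u u₁ u₂ h h₁ hu he
    have h0 : AC (fun _ => (0 : ℂ)) (fun _ => 0) := AC.const 0
    have b0 : ExpBdd q (fun _ => (0 : ℂ)) := ⟨0, by simp⟩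
    obtain ⟨C, hC⟩ := ae_bound_second hc hB hu b0 he
    have hu₁ := hu.deriv hq h h₁ hC
    have key := hI.2.1 u (fun _ => 0) (memWqInf_two h h₁ hu hu₁ hC)
      (memWqInf_two (C := 0) h0 h0 b0 b0 (by simp)) ?_
    · exact eq_of_ae_eq h.continuous continuous_const key
    · refine (opLstar_ae_eq hs (ae_eq_refl _) h h₁).trans (he.trans ?_)
      refine EventuallyEq.trans ?_ (opLstar_ae_eq hs (ae_eq_refl _) h0 h0).symm
      exact Eventually.of_forall fun x => by simp [repLstar]
  solve := by
    intro g hg hb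
    have hgW : MemWqInf (-q) 0 g := by
      intro k hk
      obtain rfl : k = 0 := by omega
      obtain ⟨C, hC⟩ := hb
      rw [neg_neg]
      exact ⟨_, hasWeakDeriv_zero ((continuous_exp_complex q).mul hg).locallyIntegrable,
        memLp_top_of_exp hg.locallyIntegrable (Eventually.of_forall hC)⟩
    obtain ⟨f, hf, he⟩ := hI.2.2 g hgW
    obtain ⟨u, u₁, u₂, hu, h, h₁, hub⟩ := exists_rep_of_memWqInf hf
    have he' := (opLstar_ae_eq hs hu h h₁).symm.trans he
    obtain ⟨C, hC⟩ := ae_bound_second hc hB hub hb he'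
    exact ⟨u, u₁, u₂, h, h₁, hub, hub.deriv hq h h₁ hC, he'⟩

/-- Primitives vanishing at `+∞`. -/
theorem exists_primitive_of_tail {g : ℝ → ℂ} {q C : ℝ} (hg : LocallyIntegrable g volume)
    (hC : 0 ≤ C)
    (h : ∀ x, ∫⁻ t in Set.Ioi x, ‖g t‖ₑ ≤ ENNReal.ofReal (C * Real.exp (-q * x))) :
    ∃ w, AC w g ∧ ∀ x, ‖w x‖ ≤ C * Real.exp (-q * x) := by
  obtain ⟨ℓ, hℓ⟩ := exists_limit_of_AC (AC.primitive hg 0 0)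
    (fun x => ((h x).trans_lt ENNReal.ofReal_lt_top).ne)
  have hA := (AC.primitive hg 0 0).sub (AC.const ℓ)
  simp only [sub_zero] at hA
  refine ⟨_, hA, fun x => ?_⟩
  have := (hℓ x).trans (h x)
  rw [← ofReal_norm] at this
  exact (ENNReal.ofReal_le_ofReal_iff (by positivity)).mp this

theorem lintegral_exp_Ioi {q : ℝ} (hq : 0 < q) {C : ℝ} (hC : 0 ≤ C) (x : ℝ) :
    ∫⁻ t in Set.Ioi x, ENNReal.ofReal (C * Real.exp (-q * t)) =
      ENNReal.ofReal (C / q * Real.exp (-q * x)) := by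
  have hi := (integrableOn_exp_mul_Ioi (a := -q) (by linarith) x).const_mul C
  rw [← ofReal_integral_eq_lintegral_ofReal hi
    (Eventually.of_forall fun _ => mul_nonneg hC (Real.exp_pos _).le), integral_const_mul,
    integral_exp_mul_Ioi (by linarith)]
  congr 1
  field_simp

theorem exists_double_primitive {g : ℝ → ℂ} {q C : ℝ} (hq : 0 < q)
    (hg : LocallyIntegrable g volume) (hC : 0 ≤ C)
    (h : ∀ x, ∫⁻ t in Set.Ioi x, ‖g t‖ₑ ≤ ENNReal.ofReal (C * Real.exp (-q * x))) :
    ∃ e e₁, AC e e₁ ∧ AC e₁ g ∧ ExpBdd q e ∧ ExpBdd q e₁ := by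
  obtain ⟨w, hw, hb⟩ := exists_primitive_of_tail hg hC h
  obtain ⟨e, he, hb'⟩ := exists_primitive_of_tail (q := q) (C := C / q) hw.locallyIntegrable
    (by positivity) fun x => by
      rw [← lintegral_exp_Ioi hq hC]
      refine lintegral_mono fun t => ?_
      rw [← ofReal_norm]
      exact ENNReal.ofReal_le_ofReal (hb t)
  exact ⟨e, w, he, hw, ⟨_, hb'⟩, ⟨_, hb⟩⟩

theorem lintegral_Ioi_le_of_expBdd {g : ℝ → ℂ} {q : ℝ} (hq : 0 < q) (hg : ExpBdd q g) :
    ∃ C, 0 ≤ C ∧ ∀ x, ∫⁻ t in Set.Ioi x, ‖g t‖ₑ ≤ ENNReal.ofReal (C * Real.exp (-q * x)) := by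
  obtain ⟨C, hC0, hC⟩ := hg.exists_nonneg
  refine ⟨C / q, by positivity, fun x => ?_⟩
  rw [← lintegral_exp_Ioi hq hC0]
  refine lintegral_mono fun t => ?_
  rw [← ofReal_norm]
  exact ENNReal.ofReal_le_ofReal (hC t)

/-- The function is affine, and a nonzero affine function does not tend to zero. -/
theorem eq_zero_of_second_deriv_zero {d d₁ d₂ : ℝ → ℂ} (h : AC d d₁) (h₁ : AC d₁ d₂)
    (h0 : d₂ =ᵐ[volume] 0) (ht : Tendsto d atTop (𝓝 0)) (x : ℝ) : d x = 0 := by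
  have h₂ : AC d₁ (fun _ => 0) := h₁.congr h0
  have hk : ∀ y, d₁ y = d₁ 0 := fun y => by
    have := h₂.2 0 y
    simpa [sub_eq_zero] using this
  have hd : ∀ a b, d b - d a = (b - a : ℝ) * d₁ 0 := fun a b => by
    rw [h.2, intervalIntegral.integral_congr (g := fun _ => d₁ 0) fun y _ => hk y]
    simp
  have hk0 : d₁ 0 = 0 := by
    have h1 : Tendsto (fun y => d (y + 1) - d y) atTop (𝓝 (0 - 0)) :=
      (ht.comp (tendsto_atTop_add_const_right _ 1 tendsto_id)).sub ht
    have h2 : (fun y => d (y + 1) - d y) = fun _ => d₁ 0 := by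
      funext y
      rw [hd]; simp
    rw [h2, sub_zero] at h1
    exact tendsto_nhds_unique tendsto_const_nhds h1
  have hc : d = fun _ => d x := by
    funext y
    have := hd x y
    rw [hk0, mul_zero, sub_eq_zero] at this
    exact this
  rw [hc] at ht
  exact tendsto_nhds_unique tendsto_const_nhds ht

theorem AC.average {u w : ℝ → ℂ} (h : AC u w) :
    AC (fun x => 2 * u x + u (x + 1) + u (x - 1)) (fun x => 2 * w x + w (x + 1) + w (x - 1)) :=
  ((h.const_mul 2).add (h.comp_add 1)).add (h.comp_sub 1)

/-- `L_c(e + (2 + A)h) = c² e'' + (2 + A)(L_c^* h + m e)`. -/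
theorem repL_average (c : ℝ) (m e e₂ h h₂ : ℝ → ℂ) (x : ℝ) :
    repL c m (fun x => e x + (2 * h x + h (x + 1) + h (x - 1)))
      (fun x => e₂ x + (2 * h₂ x + h₂ (x + 1) + h₂ (x - 1))) x =
    (c : ℂ) ^ 2 * e₂ x + (2 * (repLstar c m h h₂ x + m x * e x) +
      (repLstar c m h h₂ (x + 1) + m (x + 1) * e (x + 1)) +
      (repLstar c m h h₂ (x - 1) + m (x - 1) * e (x - 1))) := by
  simp only [repL, repLstar]
  ring

namespace AdjointSolvable

variable {c q : ℝ} {m : ℝ → ℂ}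

/-- `L_c` is injective on functions decaying exponentially at `+∞`. -/
theorem repL_unique (H : AdjointSolvable c q m) (hc : c ≠ 0) (hq : 0 < q) (hmc : Continuous m)
    {B : ℝ} (hm : ∀ x, ‖m x‖ ≤ B) {u u₁ u₂ : ℝ → ℂ} (h : AC u u₁) (h₁ : AC u₁ u₂)
    (hu : ExpBdd q u) (he : repL c m u u₂ =ᵐ[volume] 0) (x : ℝ) : u x = 0 := by
  have hc' : (c : ℂ) ^ 2 ≠ 0 := by simp [hc]
  have hmu := ((hu.mul hm).const_mul (-((c : ℂ) ^ 2)⁻¹))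
  obtain ⟨C, hC0, hC⟩ := lintegral_Ioi_le_of_expBdd hq hmu
  obtain ⟨p, p₁, hp, hp₁, hpb, -⟩ := exists_double_primitive
    (g := fun x => -((c : ℂ) ^ 2)⁻¹ * (m x * u x)) hq
    ((continuous_const.mul (hmc.mul h.continuous)).locallyIntegrable) hC0 hC
  -- If `L_c u = 0`, then `u = (2 + A)p` for the decaying double primitive `p` of `-c⁻² m u`: both
  -- sides have the same second derivative and tend to zero. Hence `L_c^* p = -m u + m u = 0`, and
  -- `p` vanishes.
  have hd : ∀ x, u x - (2 * p x + p (x + 1) + p (x - 1)) = 0 := by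
    refine eq_zero_of_second_deriv_zero (h.sub hp.average) (h₁.sub hp₁.average) ?_
      ((hu.sub hpb.average).tendsto hq)
    filter_upwards [he] with x hx
    simp only [repL, Pi.zero_apply] at hx ⊢
    have := congrArg (((c : ℂ) ^ 2)⁻¹ * ·) hx
    simp only [mul_add, mul_zero, inv_mul_cancel_left₀ hc'] at this
    linear_combination this
  have hp0 := H.unique hp hp₁ hpb (Eventually.of_forall fun x => by
    simp only [repLstar, Pi.zero_apply]
    rw [← sub_eq_zero.mp (hd x)]
    linear_combination (-(m x * u x)) * mul_inv_cancel₀ hc')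
  have := hd x
  simpa [hp0] using this

/-- Solvability of `L_c f = g` in functions decaying exponentially at `+∞`. -/
theorem repL_solve (H : AdjointSolvable c q m) (hc : c ≠ 0) (hq : 0 < q) (hmc : Continuous m)
    {B : ℝ} (hm : ∀ x, ‖m x‖ ≤ B) {g : ℝ → ℂ} (hg : LocallyIntegrable g volume) {C : ℝ}
    (hC : 0 ≤ C)
    (h : ∀ x, ∫⁻ t in Set.Ioi x, ‖g t‖ₑ ≤ ENNReal.ofReal (C * Real.exp (-q * x))) :
    ∃ u u₁ u₂, AC u u₁ ∧ AC u₁ u₂ ∧ ExpBdd q u ∧ ExpBdd q u₁ ∧ repL c m u u₂ =ᵐ[volume] g := by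
  have hc' : (c : ℂ) ^ 2 ≠ 0 := by simp [hc]
  obtain ⟨e, e₁, he, he₁, hb, hb₁⟩ := exists_double_primitive hq hg hC h
  have ka := he.const_mul ((c : ℂ) ^ 2)⁻¹
  have ka₁ := he₁.const_mul ((c : ℂ) ^ 2)⁻¹
  -- Ansatz `u = c⁻²e + (2 + A)v` with `e'' = g`. By `repL_average` the error is `(2 + A)(L_c^* v +
  -- c⁻² m e)`, which the choice of `v` cancels.
  obtain ⟨v, v₁, v₂, hv, hv₁, hvb, hvb₁, hve⟩ := H.solve
    (g := fun x => -(m x * (((c : ℂ) ^ 2)⁻¹ * e x))) (hmc.mul ka.continuous).neg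
    ((hb.const_mul _).mul hm).neg
  refine ⟨_, _, _, ka.add hv.average, ka₁.add hv₁.average, (hb.const_mul _).add hvb.average,
    (hb₁.const_mul _).add hvb₁.average, ?_⟩
  filter_upwards [hve, ae_shift hve 1, ae_shift hve (-1)] with x e1 e2 e3
  rw [← sub_eq_add_neg] at e3
  rw [repL_average, e1, e2, e3]
  linear_combination g x * mul_inv_cancel₀ hc'

end AdjointSolvable

end JostSolution

end

/-! ### Weighted `L²` estimates for tails -/

open MeasureTheory Filter Topology

noncomputable section

namespace JostSolution

open scoped ENNReal

theorem integrable_exp_neg_mul_abs {η : ℝ} (hη : 0 < η) :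
    Integrable (fun x : ℝ => Real.exp (-η * |x|)) volume := by
  rw [← integrableOn_univ, ← Set.Iic_union_Ioi (a := (0 : ℝ))]
  refine IntegrableOn.union ?_ ?_
  · refine (integrableOn_exp_mul_Iic hη 0).congr_fun (fun x hx => ?_) measurableSet_Iic
    have : x ≤ 0 := hx
    simp only [abs_of_nonpos this]
    ring_nf
  · refine (integrableOn_exp_mul_Ioi (a := -η) (by linarith) 0).congr_fun (fun x hx => ?_)
      measurableSet_Ioi
    have : 0 < x := hx
    simp only [abs_of_pos this]

/-- The mass of `z ↦ e^{-η|z|}`. -/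
def expMass (η : ℝ) : ℝ≥0∞ := ∫⁻ z : ℝ, ENNReal.ofReal (Real.exp (-η * |z|))

theorem expMass_ne_top {η : ℝ} (hη : 0 < η) : expMass η ≠ ∞ :=
  (integrable_exp_neg_mul_abs hη).lintegral_lt_top.ne

theorem lintegral_exp_sub (η x : ℝ) :
    ∫⁻ z : ℝ, ENNReal.ofReal (Real.exp (-η * |x - z|)) = expMass η :=
  lintegral_sub_left_eq_self (fun z : ℝ => ENNReal.ofReal (Real.exp (-η * |z|))) x

theorem lintegral_exp_sub' (η z : ℝ) :
    ∫⁻ x : ℝ, ENNReal.ofReal (Real.exp (-η * |x - z|)) = expMass η := by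
  rw [← lintegral_exp_sub η z]
  simp only [abs_sub_comm]

/-- Convolution with `e^{-η|·|}`. -/
def smear (η : ℝ) (k : ℝ → ℝ≥0∞) (x : ℝ) : ℝ≥0∞ :=
  ∫⁻ z, ENNReal.ofReal (Real.exp (-η * |x - z|)) * k z

theorem ennreal_mul_le_sq_add_sq (a b : ℝ≥0∞) : a * b ≤ a ^ 2 + b ^ 2 := by
  rcases le_total a b with h | h
  · calc a * b ≤ b * b := by gcongr
      _ = b ^ 2 := (sq b).symm
      _ ≤ _ := le_add_self
  · calc a * b ≤ a * a := by gcongr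
      _ = a ^ 2 := (sq a).symm
      _ ≤ _ := le_self_add

theorem smear_le {η : ℝ} {k : ℝ → ℝ≥0∞} (x : ℝ) :
    smear η k x ≤ expMass (2 * η) + ∫⁻ z, k z ^ 2 := by
  rw [← lintegral_exp_sub (2 * η) x, ← lintegral_add_left (by fun_prop)]
  refine lintegral_mono fun z => (ennreal_mul_le_sq_add_sq _ _).trans (le_of_eq ?_)
  rw [← ENNReal.ofReal_pow (Real.exp_pos _).le, ← Real.exp_nat_mul]
  ring_nf

/-- Cauchy–Schwarz for the finite measure `w dz`, done by squaring the integral and applying `ab ≤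
a² + b²` inside the double integral, which costs the factor `2`. -/
theorem smear_sq_le {η : ℝ} {k : ℝ → ℝ≥0∞} (hk : AEMeasurable k volume) (x : ℝ) :
    smear η k x ^ 2 ≤ 2 * expMass η * smear η (fun z => k z ^ 2) x := by
  set w : ℝ → ℝ≥0∞ := fun z => ENNReal.ofReal (Real.exp (-η * |x - z|)) with hw
  have mw : Measurable w := by fun_prop
  have mwk : AEMeasurable (fun z => w z * k z) volume := mw.aemeasurable.mul hk
  have mwk2 : AEMeasurable (fun z => w z * k z ^ 2) volume :=
    mw.aemeasurable.mul (hk.pow_const 2)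
  have hW : ∫⁻ z, w z = expMass η := lintegral_exp_sub η x
  change (∫⁻ z, w z * k z) ^ 2 ≤ 2 * expMass η * ∫⁻ z, w z * k z ^ 2
  calc (∫⁻ z, w z * k z) ^ 2 = ∫⁻ z, ∫⁻ y, (w z * k z) * (w y * k y) := by
        rw [sq, ← lintegral_mul_const'' _ mwk]
        refine lintegral_congr fun z => ?_
        rw [lintegral_const_mul'' _ mwk]
    _ ≤ ∫⁻ z, ∫⁻ y, (w z * k z ^ 2 * w y + w z * (w y * k y ^ 2)) := by
        refine lintegral_mono fun z => lintegral_mono fun y => ?_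
        calc (w z * k z) * (w y * k y) = (w z * w y) * (k z * k y) := by ring
          _ ≤ (w z * w y) * (k z ^ 2 + k y ^ 2) := by
              gcongr; exact ennreal_mul_le_sq_add_sq _ _
          _ = _ := by ring
    _ = ∫⁻ z, (w z * k z ^ 2 * expMass η + w z * ∫⁻ y, w y * k y ^ 2) := by
        refine lintegral_congr fun z => ?_
        rw [lintegral_add_left' (mw.aemeasurable.const_mul _), lintegral_const_mul _ mw, hW,
          lintegral_const_mul'' _ mwk2]
    _ = _ := by
        rw [lintegral_add_left' (mwk2.mul_const _), lintegral_mul_const'' _ mwk2,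
          lintegral_mul_const _ mw, hW]
        ring

/-- Young's inequality for `L¹ * L²`, from the pointwise bound and Tonelli. -/
theorem lintegral_smear_sq_ne_top {η : ℝ} (hη : 0 < η) {k : ℝ → ℝ≥0∞}
    (hk : AEMeasurable k volume) (h2 : ∫⁻ z, k z ^ 2 ≠ ∞) : ∫⁻ x, smear η k x ^ 2 ≠ ∞ := by
  have h : ∫⁻ x, smear η k x ^ 2 ≤ 2 * expMass η * (expMass η * ∫⁻ z, k z ^ 2) := by
    calc _ ≤ ∫⁻ x, 2 * expMass η * smear η (fun z => k z ^ 2) x :=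
          lintegral_mono fun x => smear_sq_le hk x
      _ = 2 * expMass η * ∫⁻ x, smear η (fun z => k z ^ 2) x :=
          lintegral_const_mul' _ _ (ENNReal.mul_ne_top (by simp) (expMass_ne_top hη))
      _ ≤ _ := by
          gcongr
          unfold smear
          rw [lintegral_lintegral_swap]
          · rw [← lintegral_const_mul' _ _ (expMass_ne_top hη)]
            refine lintegral_mono fun z => ?_
            rw [lintegral_mul_const _ (by fun_prop), lintegral_exp_sub']
          · have : AEMeasurable (fun p : ℝ × ℝ => ENNReal.ofReal (Real.exp (-η * |p.1 - p.2|)) *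
                k p.2 ^ 2) (volume.prod volume) :=
              AEMeasurable.mul (Measurable.aemeasurable (by fun_prop)) (hk.pow_const 2).comp_snd
            exact this
  refine (h.trans_lt (ENNReal.mul_lt_top (ENNReal.mul_lt_top (by simp) ?_)
    (ENNReal.mul_lt_top ?_ h2.lt_top))).ne <;> exact (expMass_ne_top hη).lt_top

/-- `e^{q·} f ∈ L²(ℝ)`. -/
def ExpL2 (q : ℝ) (f : ℝ → ℂ) : Prop := MemLp (fun x => (Real.exp (q * x) : ℂ) * f x) 2 volume

theorem memLp_two_iff_lintegral {f : ℝ → ℂ} (hf : AEStronglyMeasurable f volume) :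
    MemLp f 2 volume ↔ ∫⁻ x, ‖f x‖ₑ ^ 2 ≠ ∞ := by
  have e := eLpNorm_lt_top_iff_lintegral_rpow_enorm_lt_top (f := f) (μ := volume) (p := 2)
    (by simp) (by simp)
  simp only [ENNReal.toReal_ofNat, ENNReal.rpow_ofNat] at e
  rw [MemLp, e, lt_top_iff_ne_top]
  exact and_iff_right hf

theorem enorm_exp_mul (q x : ℝ) (z : ℂ) :
    ‖(Real.exp (q * x) : ℂ) * z‖ₑ = ENNReal.ofReal (Real.exp (q * x)) * ‖z‖ₑ := by
  rw [enorm_mul, ← ofReal_norm, Complex.norm_real, Real.norm_of_nonneg (Real.exp_pos _).le]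

/-- Moving the weight through the kernel multiplies `min 1 (e^{z-x})` by `e^{q(x-z)}`. What remains
decays at rate `q` for `z > x` and at rate `1 - q` for `z < x`, which is the reason for `0 < q < 1`.
-/
theorem tailMass_le_smear {q : ℝ} (hq0 : 0 < q) (hq1 : q < 1) (f : ℝ → ℂ) (x : ℝ) :
    ENNReal.ofReal (Real.exp (q * x)) * tailMass f x ≤
      smear (min q (1 - q)) (fun z => ‖(Real.exp (q * z) : ℂ) * f z‖ₑ) x := by
  rw [tailMass, ← lintegral_const_mul' _ _ ENNReal.ofReal_ne_top]
  refine lintegral_mono fun z => ?_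
  simp only
  rw [enorm_exp_mul, ← mul_assoc, ← mul_assoc, ← ENNReal.ofReal_mul (Real.exp_pos _).le,
    ← ENNReal.ofReal_mul (Real.exp_pos _).le]
  refine mul_le_mul_left (ENNReal.ofReal_le_ofReal ?_) _
  set η := min q (1 - q)
  have h1 : η ≤ q := min_le_left _ _
  have h2 : η ≤ 1 - q := min_le_right _ _
  rcases le_total x z with h | h
  · calc _ ≤ Real.exp (q * x) * 1 := by gcongr; exact min_le_left _ _
      _ ≤ _ := by
        rw [mul_one, ← Real.exp_add, abs_of_nonpos (by linarith)]
        refine Real.exp_le_exp.mpr ?_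
        nlinarith
  · calc _ ≤ Real.exp (q * x) * Real.exp (z - x) := by gcongr; exact min_le_right _ _
      _ ≤ _ := by
        rw [← Real.exp_add, ← Real.exp_add, abs_of_nonneg (by linarith)]
        refine Real.exp_le_exp.mpr ?_
        nlinarith

theorem tailMass_bound {q : ℝ} (hq0 : 0 < q) (hq1 : q < 1) {f : ℝ → ℂ} (hf : ExpL2 q f) :
    ∃ C, 0 ≤ C ∧ ∀ x, tailMass f x ≤ ENNReal.ofReal (C * Real.exp (-q * x)) := by
  have h2 := (memLp_two_iff_lintegral hf.1).mp hf
  set η := min q (1 - q)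
  have hη : 0 < η := lt_min hq0 (by linarith)
  set A := expMass (2 * η) + ∫⁻ x, ‖(Real.exp (q * x) : ℂ) * f x‖ₑ ^ 2
  have hA : A ≠ ∞ := ENNReal.add_ne_top.mpr ⟨expMass_ne_top (by linarith), h2⟩
  refine ⟨A.toReal, ENNReal.toReal_nonneg, fun x => ?_⟩
  have h := (tailMass_le_smear hq0 hq1 f x).trans (smear_le x)
  rw [mul_comm, ENNReal.ofReal_mul (Real.exp_pos _).le, ENNReal.ofReal_toReal hA]
  calc tailMass f x = ENNReal.ofReal (Real.exp (-q * x)) *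
        (ENNReal.ofReal (Real.exp (q * x)) * tailMass f x) := by
        rw [← mul_assoc, ← ENNReal.ofReal_mul (Real.exp_pos _).le, ← Real.exp_add]
        simp
    _ ≤ _ := by gcongr

theorem lintegral_tailMass_sq_ne_top {q : ℝ} (hq0 : 0 < q) (hq1 : q < 1) {f : ℝ → ℂ}
    (hf : ExpL2 q f) :
    ∫⁻ x, (ENNReal.ofReal (Real.exp (q * x)) * tailMass f x) ^ 2 ≠ ∞ := by
  have h2 := (memLp_two_iff_lintegral hf.1).mp hf
  refine ((lintegral_mono fun x => ?_).trans_lt (lintegral_smear_sq_ne_top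
    (lt_min hq0 (sub_pos.mpr hq1)) hf.1.enorm h2).lt_top).ne
  exact pow_le_pow_left' (tailMass_le_smear hq0 hq1 f x) 2

namespace ExpL2

variable {q : ℝ} {f g : ℝ → ℂ}

theorem add (hf : ExpL2 q f) (hg : ExpL2 q g) : ExpL2 q (fun x => f x + g x) := by
  refine (MemLp.add hf hg).ae_eq (Eventually.of_forall fun x => ?_)
  simp only [Pi.add_apply]
  ring

theorem const_mul (hf : ExpL2 q f) (k : ℂ) : ExpL2 q (fun x => k * f x) := by
  refine (MemLp.const_mul hf k).ae_eq (Eventually.of_forall fun x => ?_)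
  simp only
  ring

/-- A continuous function that is `O(e^{-p|x|})` lies in the weighted space for `|q| < p`. -/
theorem of_exp_abs {p C : ℝ} (hq : |q| < p) (hf : AEStronglyMeasurable f volume)
    (h : ∀ᵐ x, ‖f x‖ ≤ C * Real.exp (-p * |x|)) : ExpL2 q f := by
  have hi := (integrable_exp_neg_mul_abs (η := 2 * (p - |q|)) (by linarith)).const_mul (C ^ 2)
  have hm : AEStronglyMeasurable (fun x => (Real.exp (q * x) : ℂ) * f x) volume :=
    (continuous_exp_complex q).aestronglyMeasurable.mul hf
  refine (memLp_two_iff_integrable_sq_norm hm).mpr (hi.mono' (hm.norm.pow 2) ?_)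
  filter_upwards [h] with x hx
  rw [Real.norm_of_nonneg (by positivity), norm_mul, Complex.norm_real,
    Real.norm_of_nonneg (Real.exp_pos _).le, mul_pow]
  have hqx : q * x ≤ |q| * |x| := by rw [← abs_mul]; exact le_abs_self _
  calc _ ≤ Real.exp (|q| * |x|) ^ 2 * (C * Real.exp (-p * |x|)) ^ 2 := by gcongr
    _ = C ^ 2 * (Real.exp (|q| * |x|) ^ 2 * Real.exp (-p * |x|) ^ 2) := by ring
    _ = _ := by
      rw [← Real.exp_nat_mul, ← Real.exp_nat_mul, ← Real.exp_add]
      congr 2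
      push_cast
      ring

end ExpL2

theorem integrable_of_exp_abs {p C : ℝ} (hp : 0 < p) {f : ℝ → ℂ}
    (hf : AEStronglyMeasurable f volume) (h : ∀ᵐ x, ‖f x‖ ≤ C * Real.exp (-p * |x|)) :
    Integrable f volume :=
  ((integrable_exp_neg_mul_abs hp).const_mul C).mono' hf h

theorem cosh_rpow_neg_le_exp {p q : ℝ} (hp : 0 ≤ p) (hpq : p ≤ q) (x : ℝ) :
    Real.cosh x ^ (-q) ≤ 2 ^ p * Real.exp (-p * |x|) :=
  (Real.rpow_le_rpow_of_exponent_le (Real.one_le_cosh x) (by linarith)).trans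
    (cosh_rpow_neg_le p x hp)

theorem coshMul_aestronglyMeasurable {q : ℝ} {f : ℝ → ℂ}
    (h : AEStronglyMeasurable (coshMul q f) volume) : AEStronglyMeasurable f volume := by
  have := (continuous_cosh_rpow (-q)).aestronglyMeasurable.mul (μ := volume) h
  refine this.congr (Eventually.of_forall fun x => ?_)
  have := congrFun (coshMul_coshMul (-q) q f) x
  rw [neg_add_cancel, coshMul_zero] at this
  exact this

theorem norm_eq_coshMul (q : ℝ) (f : ℝ → ℂ) (x : ℝ) :
    ‖f x‖ = Real.cosh x ^ (-q) * ‖coshMul q f x‖ := by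
  have := congrFun (coshMul_coshMul (-q) q f) x
  rw [neg_add_cancel, coshMul_zero] at this
  rw [← this]
  conv_lhs => rw [coshMul]
  rw [norm_mul, Complex.norm_real,
    Real.norm_of_nonneg (Real.rpow_nonneg (Real.cosh_pos x).le _)]

theorem ExpL2.of_coshMul {p q : ℝ} (hpq : |p| ≤ q) {f : ℝ → ℂ}
    (h : MemLp (coshMul q f) 2 volume) : ExpL2 p f := by
  have hm := coshMul_aestronglyMeasurable h.1
  refine MemLp.of_le_mul (c := 2 ^ |p|) h
    ((continuous_exp_complex p).aestronglyMeasurable.mul hm) (Eventually.of_forall fun x => ?_)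
  rw [norm_mul, Complex.norm_real, Real.norm_of_nonneg (Real.exp_pos _).le, norm_eq_coshMul q f,
    ← mul_assoc]
  gcongr
  have hpx : p * x ≤ |p| * |x| := by rw [← abs_mul]; exact le_abs_self _
  calc _ ≤ Real.exp (|p| * |x|) * (2 ^ |p| * Real.exp (-|p| * |x|)) := by
        gcongr
        exact cosh_rpow_neg_le_exp (abs_nonneg p) hpq x
    _ = 2 ^ |p| * (Real.exp (|p| * |x|) * Real.exp (-|p| * |x|)) := by ring
    _ = _ := by rw [← Real.exp_add]; simp

/-- Cauchy–Schwarz in weighted spaces, against a bounded function. -/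
theorem integrable_mul_of_coshMul {q : ℝ} (hq : 0 < q) {f b : ℝ → ℂ} {B : ℝ}
    (hbc : Continuous b) (hb : ∀ x, ‖b x‖ ≤ B) (h : MemLp (coshMul q f) 2 volume) :
    Integrable (fun x => f x * b x) volume ∧
      ‖∫ x, f x * b x‖ ≤ B * Real.sqrt (∫ x : ℝ, (Real.cosh x ^ (-q)) ^ 2) *
        Real.sqrt (∫ x, ‖coshMul q f x‖ ^ 2) := by
  have hw : MemLp (fun x : ℝ => Real.cosh x ^ (-q)) 2 volume := by
    have hm : AEStronglyMeasurable (fun x : ℝ => Real.cosh x ^ (-q)) volume :=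
      (Real.continuous_cosh.rpow_const fun x => Or.inl (Real.cosh_pos x).ne').aestronglyMeasurable
    refine (memLp_two_iff_integrable_sq_norm hm).mpr
      (((integrable_exp_neg_mul_abs (η := 2 * q) (by linarith)).const_mul ((2 ^ q) ^ 2)).mono'
        (hm.norm.pow 2) (Eventually.of_forall fun x => ?_))
    have hp : 0 ≤ Real.cosh x ^ (-q) := Real.rpow_nonneg (Real.cosh_pos x).le _
    rw [Real.norm_of_nonneg (by positivity), Real.norm_of_nonneg hp]
    calc _ ≤ (2 ^ q * Real.exp (-q * |x|)) ^ 2 := by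
          gcongr
          exact cosh_rpow_neg_le q x hq.le
      _ = _ := by
          rw [mul_pow, ← Real.exp_nat_mul]
          congr 2
          push_cast
          ring
  have hi : Integrable (fun x => Real.cosh x ^ (-q) * ‖coshMul q f x‖) volume :=
    hw.integrable_mul h.norm
  have hB : 0 ≤ B := (norm_nonneg _).trans (hb 0)
  have hle : ∀ x, ‖f x * b x‖ ≤ B * (Real.cosh x ^ (-q) * ‖coshMul q f x‖) := fun x => by
    rw [norm_mul, ← norm_eq_coshMul, mul_comm]
    gcongr
    exact hb x
  have hI : Integrable (fun x => f x * b x) volume :=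
    (hi.const_mul B).mono' ((coshMul_aestronglyMeasurable h.1).mul hbc.aestronglyMeasurable)
      (Eventually.of_forall hle)
  refine ⟨hI, (norm_integral_le_integral_norm _).trans ?_⟩
  calc _ ≤ ∫ x, B * (Real.cosh x ^ (-q) * ‖coshMul q f x‖) :=
        integral_mono hI.norm (hi.const_mul B) hle
    _ = B * ∫ x, (Real.cosh x ^ (-q) * ‖coshMul q f x‖) := integral_const_mul _ _
    _ ≤ B * (Real.sqrt (∫ x : ℝ, (Real.cosh x ^ (-q)) ^ 2) *
        Real.sqrt (∫ x, ‖coshMul q f x‖ ^ 2)) := by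
        gcongr
        have := integral_mul_le_Lp_mul_Lq_of_nonneg (μ := (volume : Measure ℝ))
          Real.HolderConjugate.two_two (f := fun x : ℝ => Real.cosh x ^ (-q))
          (g := fun x => ‖coshMul q f x‖)
          (Eventually.of_forall fun x => Real.rpow_nonneg (Real.cosh_pos x).le _)
          (Eventually.of_forall fun x => norm_nonneg _) (by simpa using hw) (by simpa using h.norm)
        simpa [Real.sqrt_eq_rpow] using this
    _ = _ := by ring

theorem integrable_of_coshMul {q : ℝ} (hq : 0 < q) {f : ℝ → ℂ}
    (h : MemLp (coshMul q f) 2 volume) : Integrable f volume := by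
  simpa using (integrable_mul_of_coshMul hq (b := fun _ => 1) (B := 1) continuous_const
    (by simp) h).1

end JostSolution

end

/-! ### Two-sided bounds, plane-wave amplitudes and the flux -/

open MeasureTheory Filter Topology

noncomputable section

namespace JostSolution

open scoped ENNReal

/-- Two-sided exponential bound `u(x) = O(e^{-p|x|})`; negative rates allow growth. -/
def AbsBdd (p : ℝ) (u : ℝ → ℂ) : Prop := ∃ C, ∀ x, ‖u x‖ ≤ C * Real.exp (-p * |x|)

namespace AbsBdd

variable {p q : ℝ} {u v : ℝ → ℂ}

theorem exists_nonneg (h : AbsBdd p u) : ∃ C, 0 ≤ C ∧ ∀ x, ‖u x‖ ≤ C * Real.exp (-p * |x|) := by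
  obtain ⟨C, hC⟩ := h
  refine ⟨C, ?_, hC⟩
  simpa using (norm_nonneg _).trans (hC 0)

theorem mono (h : AbsBdd p u) (hq : q ≤ p) : AbsBdd q u := by
  obtain ⟨C, hC0, hC⟩ := h.exists_nonneg
  refine ⟨C, fun x => (hC x).trans (mul_le_mul_of_nonneg_left (Real.exp_le_exp.mpr ?_) hC0)⟩
  linarith [mul_le_mul_of_nonneg_right hq (abs_nonneg x)]

theorem add (h : AbsBdd p u) (h' : AbsBdd p v) : AbsBdd p (fun x => u x + v x) := by
  obtain ⟨C, hC⟩ := h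
  obtain ⟨D, hD⟩ := h'
  refine ⟨C + D, fun x => (norm_add_le _ _).trans ?_⟩
  rw [add_mul]
  exact add_le_add (hC x) (hD x)

theorem mul (h : AbsBdd p u) (h' : AbsBdd q v) : AbsBdd (p + q) (fun x => u x * v x) := by
  obtain ⟨C, hC⟩ := h
  obtain ⟨D, hD⟩ := h'
  refine ⟨C * D, fun x => ?_⟩
  rw [norm_mul]
  calc _ ≤ (C * Real.exp (-p * |x|)) * (D * Real.exp (-q * |x|)) :=
        mul_le_mul (hC x) (hD x) (norm_nonneg _) ((norm_nonneg _).trans (hC x))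
    _ = C * D * (Real.exp (-p * |x|) * Real.exp (-q * |x|)) := by ring
    _ = _ := by rw [← Real.exp_add]; ring_nf

theorem const_mul (h : AbsBdd p u) (k : ℂ) : AbsBdd p (fun x => k * u x) := by
  have hk : AbsBdd 0 (fun _ : ℝ => k) := ⟨‖k‖, by simp⟩
  simpa using hk.mul h

theorem comp_add (h : AbsBdd p u) (s : ℝ) : AbsBdd p (fun x => u (x + s)) := by
  obtain ⟨C, hC0, hC⟩ := h.exists_nonneg
  refine ⟨C * Real.exp (|p| * |s|), fun x => (hC _).trans ?_⟩
  rw [mul_assoc, ← Real.exp_add]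
  refine mul_le_mul_of_nonneg_left (Real.exp_le_exp.mpr ?_) hC0
  have h1 : |(|x + s| - |x|)| ≤ |s| := by simpa using abs_abs_sub_abs_le_abs_sub (x + s) x
  have h2 : -p * (|x + s| - |x|) ≤ |p| * |s| := by
    calc _ ≤ |(-p * (|x + s| - |x|))| := le_abs_self _
      _ = |p| * |(|x + s| - |x|)| := by rw [abs_mul, abs_neg]
      _ ≤ _ := by gcongr
  linarith

theorem comp_neg (h : AbsBdd p u) : AbsBdd p (fun x => u (-x)) := by
  obtain ⟨C, hC⟩ := h
  exact ⟨C, fun x => by simpa using hC (-x)⟩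

theorem average (h : AbsBdd p u) : AbsBdd p (fun x => 2 * u x + u (x + 1) + u (x - 1)) :=
  ((h.const_mul 2).add (h.comp_add 1)).add (by simpa [sub_eq_add_neg] using h.comp_add (-1))

theorem expBdd (h : AbsBdd p u) (hq : 0 ≤ q) (hpq : q ≤ p) : ExpBdd q u := by
  obtain ⟨C, hC0, hC⟩ := h.exists_nonneg
  exact ExpBdd.of_exp_abs hq hpq hC0 hC

theorem expL2 (h : AbsBdd p u) (hu : Continuous u) (hq : |q| < p) : ExpL2 q u := by
  obtain ⟨C, hC⟩ := h
  exact ExpL2.of_exp_abs hq hu.aestronglyMeasurable (Eventually.of_forall hC)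

theorem integrable (h : AbsBdd p u) (hu : Continuous u) (hp : 0 < p) : Integrable u volume := by
  obtain ⟨C, hC⟩ := h
  exact integrable_of_exp_abs hp hu.aestronglyMeasurable (Eventually.of_forall hC)

end AbsBdd

theorem ExpBdd.absBdd {q : ℝ} (hq : 0 ≤ q) {u : ℝ → ℂ} (h : ExpBdd q u) : AbsBdd (-q) u := by
  obtain ⟨C, hC0, hC⟩ := h.exists_nonneg
  refine ⟨C, fun x => (hC x).trans (mul_le_mul_of_nonneg_left (Real.exp_le_exp.mpr ?_) hC0)⟩
  nlinarith [mul_le_mul_of_nonneg_left (neg_le_abs x) hq]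

theorem AbsBdd.of_two_sided {q : ℝ} {u : ℝ → ℂ} (h : ExpBdd q u)
    (h' : ExpBdd q (fun x => u (-x))) : AbsBdd q u := by
  obtain ⟨C, hC0, hC⟩ := h.exists_nonneg
  obtain ⟨D, hD0, hD⟩ := h'.exists_nonneg
  refine ⟨C + D, fun x => ?_⟩
  rcases le_total 0 x with hx | hx
  · rw [abs_of_nonneg hx, add_mul]
    exact (hC x).trans (le_add_of_nonneg_right (by positivity))
  · rw [abs_of_nonpos hx, add_mul]
    have := hD (-x)
    rw [neg_neg] at this
    exact this.trans (le_add_of_nonneg_left (by positivity))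

theorem absBdd_wave (ω : ℝ) : AbsBdd 0 (wave ω) := ⟨1, by simp [norm_wave]⟩

/-- `u ~ a e^{iωx} + b e^{-iωx}` together with its derivative, with errors `O(e^{-qx})`. -/
structure ExpAsymp (q ω : ℝ) (u u₁ : ℝ → ℂ) (a b : ℂ) : Prop where
  fst : ExpBdd q (fun x => u x - (a * wave ω x + b * wave (-ω) x))
  snd : ExpBdd q (fun x => u₁ x - Complex.I * ω * (a * wave ω x - b * wave (-ω) x))

namespace ExpAsymp

variable {q ω : ℝ} {u u₁ v v₁ : ℝ → ℂ} {a b a' b' : ℂ}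

theorem of_expBdd (h : ExpBdd q u) (h₁ : ExpBdd q u₁) : ExpAsymp q ω u u₁ 0 0 :=
  ⟨by simpa using h, by simpa using h₁⟩

theorem expBdd (h : ExpAsymp q ω u u₁ 0 0) : ExpBdd q u := by simpa using h.fst

theorem add (h : ExpAsymp q ω u u₁ a b) (h' : ExpAsymp q ω v v₁ a' b') :
    ExpAsymp q ω (fun x => u x + v x) (fun x => u₁ x + v₁ x) (a + a') (b + b') :=
  ⟨(h.fst.add h'.fst).congr fun x => by ring, (h.snd.add h'.snd).congr fun x => by ring⟩

theorem const_mul (h : ExpAsymp q ω u u₁ a b) (k : ℂ) :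
    ExpAsymp q ω (fun x => k * u x) (fun x => k * u₁ x) (k * a) (k * b) :=
  ⟨(h.fst.const_mul k).congr fun x => by ring, (h.snd.const_mul k).congr fun x => by ring⟩

theorem sub (h : ExpAsymp q ω u u₁ a b) (h' : ExpAsymp q ω v v₁ a' b') :
    ExpAsymp q ω (fun x => u x - v x) (fun x => u₁ x - v₁ x) (a - a') (b - b') :=
  ⟨(h.fst.sub h'.fst).congr fun x => by ring, (h.snd.sub h'.snd).congr fun x => by ring⟩

theorem conj (h : ExpAsymp q ω u u₁ a b) :
    ExpAsymp q ω (fun x => (starRingEnd ℂ) (u x)) (fun x => (starRingEnd ℂ) (u₁ x))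
      ((starRingEnd ℂ) b) ((starRingEnd ℂ) a) := by
  refine ⟨h.fst.conj.congr fun x => ?_, h.snd.conj.congr fun x => ?_⟩
  · simp only [map_sub, map_add, map_mul, conj_wave, neg_neg]
    ring
  · simp only [map_sub, map_mul, conj_wave, neg_neg, Complex.conj_I, Complex.conj_ofReal]
    ring

theorem average (h : ExpAsymp q ω u u₁ a b) :
    ExpAsymp q ω (fun x => 2 * u x + u (x + 1) + u (x - 1))
      (fun x => 2 * u₁ x + u₁ (x + 1) + u₁ (x - 1))
      ((2 + 2 * Real.cos ω) * a) ((2 + 2 * Real.cos ω) * b) := by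
  have e : ∀ ω' x, wave ω' (x - 1) = wave ω' x * wave (-ω') 1 := fun ω' x => by
    rw [sub_eq_add_neg, wave_add, wave_neg]
  have hc := wave_one_add ω
  refine ⟨h.fst.average.congr fun x => ?_, h.snd.average.congr fun x => ?_⟩
  · simp only [e, wave_add _ x 1, neg_neg]
    linear_combination (-(a * wave ω x) - b * wave (-ω) x) * hc
  · simp only [e, wave_add _ x 1, neg_neg]
    linear_combination (-(Complex.I * ω * (a * wave ω x - b * wave (-ω) x))) * hc

theorem absBdd_zero_of_nonneg (hq : 0 ≤ q) (h : ExpAsymp q ω u u₁ a b) :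
    ∃ C, ∀ x, 0 ≤ x → ‖u x‖ ≤ C ∧ ‖u₁ x‖ ≤ C := by
  obtain ⟨C, hC0, hC⟩ := h.fst.exists_nonneg
  obtain ⟨D, hD0, hD⟩ := h.snd.exists_nonneg
  have he : ∀ x : ℝ, 0 ≤ x → Real.exp (-q * x) ≤ 1 := fun x hx =>
    Real.exp_le_one_iff.mpr (by nlinarith)
  have hP : ∀ x, ‖a * wave ω x + b * wave (-ω) x‖ ≤ ‖a‖ + ‖b‖ := fun x =>
    (norm_add_le _ _).trans (by simp [norm_wave])
  have hQ : ∀ x, ‖Complex.I * ω * (a * wave ω x - b * wave (-ω) x)‖ ≤ |ω| * (‖a‖ + ‖b‖) := by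
    intro x
    rw [norm_mul, norm_mul, Complex.norm_I, one_mul, Complex.norm_real, Real.norm_eq_abs]
    gcongr
    exact (norm_sub_le _ _).trans (by simp [norm_wave])
  have h1 : 0 ≤ ‖a‖ + ‖b‖ := by positivity
  have h2 : 0 ≤ |ω| * (‖a‖ + ‖b‖) := by positivity
  refine ⟨C + D + (‖a‖ + ‖b‖) + |ω| * (‖a‖ + ‖b‖), fun x hx => ⟨?_, ?_⟩⟩
  · have := norm_le_norm_sub_add (u x) (a * wave ω x + b * wave (-ω) x)
    have h3 := (hC x).trans (mul_le_of_le_one_right hC0 (he x hx))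
    linarith [hP x]
  · have := norm_le_norm_sub_add (u₁ x) (Complex.I * ω * (a * wave ω x - b * wave (-ω) x))
    have h3 := (hD x).trans (mul_le_of_le_one_right hD0 (he x hx))
    linarith [hQ x]

end ExpAsymp

/-- The amplitudes of a function vanishing at `+∞` with its derivative are zero. -/
theorem amplitudes_eq_zero {ω : ℝ} (hω : ω ≠ 0) {a b : ℂ}
    (h : Tendsto (fun x => a * wave ω x + b * wave (-ω) x) atTop (𝓝 0))
    (h₁ : Tendsto (fun x => Complex.I * ω * (a * wave ω x - b * wave (-ω) x)) atTop (𝓝 0)) :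
    a = 0 ∧ b = 0 := by
  have hI : Complex.I * ω ≠ 0 := mul_ne_zero Complex.I_ne_zero (by exact_mod_cast hω)
  have h2 := h₁.const_mul (Complex.I * ω)⁻¹
  simp only [inv_mul_cancel_left₀ hI, mul_zero] at h2
  have key : ∀ (k : ℂ) (ω' : ℝ), Tendsto (fun x => k * wave ω' x) atTop (𝓝 0) → k = 0 := by
    intro k ω' hk
    have := hk.norm
    simp only [norm_mul, norm_wave, mul_one, norm_zero] at this
    exact norm_eq_zero.mp (tendsto_nhds_unique tendsto_const_nhds this)
  constructor
  · refine key a ω ?_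
    have := (h.add h2).const_mul (1 / 2)
    simp only [add_zero, mul_zero] at this
    exact this.congr fun x => by ring
  · refine key b (-ω) ?_
    have := (h.sub h2).const_mul (1 / 2)
    simp only [sub_zero, mul_zero] at this
    exact this.congr fun x => by ring

theorem ExpBdd.of_tailMass {p : ℝ} (hp : 0 < p) (hp1 : p < 1) {f u : ℝ → ℂ} (hf : ExpL2 p f)
    {A : ℝ≥0∞} (hA : A ≠ ∞) (h : ∀ x, ‖u x‖ₑ ≤ A * tailMass f x) : ExpBdd p u := by
  obtain ⟨C, hC0, hC⟩ := tailMass_bound hp hp1 hf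
  refine ⟨A.toReal * C, fun x => ?_⟩
  have h3 : ‖u x‖ₑ ≤ A * ENNReal.ofReal (C * Real.exp (-p * x)) :=
    (h x).trans (by gcongr; exact hC x)
  have h4 := ENNReal.toReal_mono (ENNReal.mul_ne_top hA ENNReal.ofReal_ne_top) h3
  rwa [toReal_enorm, ENNReal.toReal_mul, ENNReal.toReal_ofReal (by positivity),
    ← mul_assoc] at h4

/-- Solutions of `B_c u = f` for localized `f`. -/
theorem exists_expAsymp {u u₁ u₂ f : ℝ → ℂ} {c ω q : ℝ} (hc : 1 < |c|) (h0 : 0 < ω)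
    (h1 : ω < 3 / 2) (hz : symbolB c ω = 0) (hq0 : 0 < q) (hq1 : q < 1) (h : AC u u₁)
    (h₁ : AC u₁ u₂) (hf : repB c u u₂ =ᵐ[volume] f) (hi : Integrable f volume)
    (h2 : ExpL2 q f) (hM : AbsBdd (-1) u) : ∃ a b, ExpAsymp q ω u u₁ a b := by
  obtain ⟨M, hM⟩ := hM
  obtain ⟨a, b, A, hA, hb⟩ := exists_asymptotics hc h0 h1 hz h h₁ hf hi (M := M)
    (by simpa using hM)
  exact ⟨a, b, ExpBdd.of_tailMass hq0 hq1 h2 hA fun x => (hb x).1,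
    ExpBdd.of_tailMass hq0 hq1 h2 hA fun x => (hb x).2⟩

/-- The bilinear flux of the pair `(L_c, L_c^*)`. -/
def flux (c : ℝ) (m f f₁ v v₁ : ℝ → ℂ) (x : ℝ) : ℂ :=
  (c : ℂ) ^ 2 * (f₁ x * v x - f x * v₁ x) +
    ∫ y in x..(x + 1), (m y * f y * v (y - 1) - m (y - 1) * f (y - 1) * v y)

/-- A nonlocal Wronskian identity: differentiating the integral over the moving unit interval yields
the shifted terms of both operators, while the local terms `2 m f v` cancel. -/
theorem AC.flux {c : ℝ} {m f f₁ f₂ v v₁ v₂ : ℝ → ℂ} (hm : Continuous m) (hf : AC f f₁)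
    (hf₁ : AC f₁ f₂) (hv : AC v v₁) (hv₁ : AC v₁ v₂) :
    AC (JostSolution.flux c m f f₁ v v₁)
      (fun x => repL c m f f₂ x * v x - f x * repLstar c m v v₂ x) := by
  set k : ℝ → ℂ := fun y => m y * f y * v (y - 1) - m (y - 1) * f (y - 1) * v y with hk
  have hfc := hf.continuous
  have hvc := hv.continuous
  have kc : Continuous k := by fun_prop
  have hK := AC.primitive kc.locallyIntegrable 0 0
  have h2 := ((hf₁.mul hv).sub (hf.mul hv₁)).const_mul ((c : ℂ) ^ 2)
  have h3 := (h2.add ((hK.comp_add 1).sub hK)).congr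
    (z := fun x => repL c m f f₂ x * v x - f x * repLstar c m v v₂ x)
    (Eventually.of_forall fun x => by
      simp only [hk, repL, repLstar, add_sub_cancel_right]
      ring)
  convert h3 using 1
  funext x
  have := intervalIntegral.integral_interval_sub_left (μ := volume) (f := k)
    (kc.intervalIntegrable 0 (x + 1)) (kc.intervalIntegrable 0 x)
  simp only [zero_add]
  rw [this]
  rfl

theorem tendsto_mul_sub_mul {X Y P Q : ℝ → ℂ} {B : ℝ}
    (hX : Tendsto (fun x => X x - P x) atTop (𝓝 0))
    (hY : Tendsto (fun x => Y x - Q x) atTop (𝓝 0)) (hP : ∀ x, ‖P x‖ ≤ B)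
    (hQ : ∀ x, ‖Q x‖ ≤ B) : Tendsto (fun x => X x * Y x - P x * Q x) atTop (𝓝 0) := by
  have bz : ∀ {R Z : ℝ → ℂ}, Tendsto Z atTop (𝓝 0) → (∀ x, ‖R x‖ ≤ B) →
      Tendsto (fun x => R x * Z x) atTop (𝓝 0) := by
    intro R Z hZ hR
    refine squeeze_zero_norm (a := fun x => B * ‖Z x‖) (fun x => ?_)
      (by simpa using hZ.norm.const_mul B)
    rw [norm_mul]
    gcongr
    exact hR x
  have := ((hX.mul hY).add (bz hY hP)).add (bz hX hQ)
  simp only [mul_zero, add_zero] at this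
  exact this.congr fun x => by ring

theorem tendsto_integral_unit {k : ℝ → ℂ} {κ : ℂ} (hk : Continuous k)
    (h : Tendsto k atTop (𝓝 κ)) : Tendsto (fun x => ∫ y in x..(x + 1), k y) atTop (𝓝 κ) := by
  rw [Metric.tendsto_atTop] at h ⊢
  intro ε hε
  obtain ⟨N, hN⟩ := h (ε / 2) (by linarith)
  refine ⟨N, fun x hx => ?_⟩
  have e : (∫ y in x..(x + 1), k y) - κ = ∫ y in x..(x + 1), (k y - κ) := by
    rw [intervalIntegral.integral_sub (hk.intervalIntegrable _ _) intervalIntegrable_const]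
    simp
  rw [dist_eq_norm, e]
  refine (intervalIntegral.norm_integral_le_of_norm_le_const (C := ε / 2) fun y hy => ?_).trans_lt
    (by simp; linarith)
  rw [Set.uIoc_of_le (by linarith)] at hy
  rw [← dist_eq_norm]
  exact (hN y (by linarith [hy.1])).le

/-- The flux at `+∞` in terms of the amplitudes. -/
theorem flux_tendsto {c q ω : ℝ} (hq : 0 < q) {m f f₁ v v₁ : ℝ → ℂ} {a b α β : ℂ}
    (hmc : Continuous m) (hfc : Continuous f) (hvc : Continuous v)
    (hm : Tendsto m atTop (𝓝 1)) (hf : ExpAsymp q ω f f₁ a b) (hv : ExpAsymp q ω v v₁ α β) :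
    Tendsto (flux c m f f₁ v v₁) atTop
      (𝓝 (2 * Complex.I * ((c : ℂ) ^ 2 * ω + Real.sin ω) * (a * β - b * α))) := by
  have hs : ∀ {Z : ℝ → ℂ} {l : ℂ}, Tendsto Z atTop (𝓝 l) →
      Tendsto (fun x => Z (x - 1)) atTop (𝓝 l) := fun hZ =>
    hZ.comp (tendsto_atTop_add_const_right _ (-1) tendsto_id)
  set P : ℂ → ℂ → ℝ → ℂ := fun a b x => a * wave ω x + b * wave (-ω) x with hP
  set Q : ℂ → ℂ → ℝ → ℂ := fun a b x => Complex.I * ω * (a * wave ω x - b * wave (-ω) x) with hQ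
  set B : ℝ := (1 + |ω|) * (‖a‖ + ‖b‖ + ‖α‖ + ‖β‖) + 1 with hB
  have base : ∀ a b x, ‖P a b x‖ ≤ ‖a‖ + ‖b‖ := fun a b x =>
    (norm_add_le _ _).trans (by simp [norm_wave])
  have base' : ∀ a b x, ‖Q a b x‖ ≤ |ω| * (‖a‖ + ‖b‖) := fun a b x => by
    rw [hQ, norm_mul, norm_mul, Complex.norm_I, one_mul, Complex.norm_real, Real.norm_eq_abs]
    gcongr
    exact (norm_sub_le _ _).trans (by simp [norm_wave])
  have h0 := norm_nonneg a
  have h1 := norm_nonneg b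
  have h2 := norm_nonneg α
  have h3 := norm_nonneg β
  have h4 := abs_nonneg ω
  have hB1 : (1 : ℝ) ≤ B := by
    rw [hB]
    linarith [mul_nonneg (by linarith : 0 ≤ 1 + |ω|)
      (by linarith : 0 ≤ ‖a‖ + ‖b‖ + ‖α‖ + ‖β‖)]
  have bPf : ∀ x, ‖P a b x‖ ≤ B := fun x => (base a b x).trans (by rw [hB]; nlinarith)
  have bPv : ∀ x, ‖P α β x‖ ≤ B := fun x => (base α β x).trans (by rw [hB]; nlinarith)
  have bQf : ∀ x, ‖Q a b x‖ ≤ B := fun x => (base' a b x).trans (by rw [hB]; nlinarith)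
  have bQv : ∀ x, ‖Q α β x‖ ≤ B := fun x => (base' α β x).trans (by rw [hB]; nlinarith)
  have tf : Tendsto (fun x => f x - P a b x) atTop (𝓝 0) := hf.fst.tendsto hq
  have tf₁ : Tendsto (fun x => f₁ x - Q a b x) atTop (𝓝 0) := hf.snd.tendsto hq
  have tv : Tendsto (fun x => v x - P α β x) atTop (𝓝 0) := hv.fst.tendsto hq
  have tv₁ : Tendsto (fun x => v₁ x - Q α β x) atTop (𝓝 0) := hv.snd.tendsto hq
  have tm : Tendsto (fun x => m x - 1) atTop (𝓝 0) := by simpa using hm.sub_const 1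
  have tmf : Tendsto (fun x => m x * f x - P a b x) atTop (𝓝 0) := by
    simpa using tendsto_mul_sub_mul tm tf (P := fun _ => 1) (by simpa using hB1) bPf
  have ww := wave_mul_neg ω
  have A1 := tendsto_mul_sub_mul tf₁ tv bQf bPv
  have A2 := tendsto_mul_sub_mul tf tv₁ bPf bQv
  have A3 : Tendsto (fun x => f₁ x * v x - f x * v₁ x) atTop
      (𝓝 (2 * Complex.I * ω * (a * β - b * α))) := by
    have := (A1.sub A2).add_const (2 * Complex.I * ω * (a * β - b * α))
    simp only [sub_zero, zero_add] at this
    refine this.congr fun x => ?_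
    simp only [hP, hQ]
    linear_combination (-(2 * Complex.I * ω * (a * β - b * α))) * ww x
  have B1 := tendsto_mul_sub_mul tmf (hs tv) bPf (fun x => bPv (x - 1))
  have B2 := tendsto_mul_sub_mul (hs tmf) tv (fun x => bPf (x - 1)) bPv
  have e : ∀ ω' x, wave ω' (x - 1) = wave ω' x * wave (-ω') 1 := fun ω' x => by
    rw [sub_eq_add_neg, wave_add, wave_neg]
  have B3 : Tendsto (fun y => m y * f y * v (y - 1) - m (y - 1) * f (y - 1) * v y) atTop
      (𝓝 (2 * Complex.I * Real.sin ω * (a * β - b * α))) := by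
    have := (B1.sub B2).add_const (2 * Complex.I * Real.sin ω * (a * β - b * α))
    simp only [sub_zero, zero_add] at this
    refine this.congr fun x => ?_
    simp only [hP, e, neg_neg]
    linear_combination (-((wave ω 1 - wave (-ω) 1) * (a * β - b * α))) * ww x -
      (a * β - b * α) * wave_one_sub ω
  have C := (A3.const_mul ((c : ℂ) ^ 2)).add (tendsto_integral_unit (by fun_prop) B3)
  refine Tendsto.congr (fun x => rfl) (C.trans (le_of_eq ?_))
  congr 1
  ring

/-- Reflection preserves both operators, because `m` is even, and reverses the flux. It gives access
to the limit at `-∞`, and makes the flux of two even functions odd. -/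
theorem flux_neg {c : ℝ} {m : ℝ → ℂ} (hm : ∀ x, m (-x) = m x) (f f₁ v v₁ : ℝ → ℂ) (x : ℝ) :
    flux c m f f₁ v v₁ (-x) =
      -flux c m (fun y => f (-y)) (fun y => -f₁ (-y)) (fun y => v (-y)) (fun y => -v₁ (-y)) x := by
  simp only [flux]
  set k : ℝ → ℂ := fun y => m y * f y * v (y - 1) - m (y - 1) * f (y - 1) * v y with hk
  have e : ∀ y, m y * f (-y) * v (-(y - 1)) - m (y - 1) * f (-(y - 1)) * v (-y) =
      -k (1 - y) := by
    intro y
    have e1 : m (1 - y) = m (y - 1) := by rw [← hm]; ring_nf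
    simp only [hk]
    rw [show 1 - y - 1 = -y by ring, show -(y - 1) = 1 - y by ring, hm, e1]
    ring
  simp only [e, intervalIntegral.integral_neg, intervalIntegral.integral_comp_sub_left]
  rw [show 1 - (x + 1) = -x by ring, show 1 - x = -x + 1 by ring]
  ring

theorem repL_neg {c : ℝ} {m : ℝ → ℂ} (hm : ∀ x, m (-x) = m x) (u u₂ : ℝ → ℂ) (x : ℝ) :
    repL c m (fun y => u (-y)) (fun y => u₂ (-y)) x = repL c m u u₂ (-x) := by
  have e1 : m (x + 1) = m (-x - 1) := by rw [← hm]; ring_nf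
  have e2 : m (x - 1) = m (-x + 1) := by rw [← hm]; ring_nf
  simp only [repL]
  rw [hm, e1, e2, show -(x + 1) = -x - 1 by ring, show -(x - 1) = -x + 1 by ring]
  ring

theorem repLstar_neg {c : ℝ} {m : ℝ → ℂ} (hm : ∀ x, m (-x) = m x) (u u₂ : ℝ → ℂ) (x : ℝ) :
    repLstar c m (fun y => u (-y)) (fun y => u₂ (-y)) x = repLstar c m u u₂ (-x) := by
  simp only [repLstar]
  rw [hm, show -(x + 1) = -x - 1 by ring, show -(x - 1) = -x + 1 by ring]
  ring

theorem AC.comp_neg_two {u₁ u₂ : ℝ → ℂ} (h₁ : AC u₁ u₂) :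
    AC (fun x => -u₁ (-x)) (fun x => u₂ (-x)) := by
  simpa using h₁.comp_neg.neg

theorem AC.deriv_eq {u u₁ v₁ : ℝ → ℂ} (h : AC u u₁) (h' : AC u v₁) (hc : Continuous u₁)
    (hc' : Continuous v₁) (x : ℝ) : u₁ x = v₁ x :=
  eq_of_ae_eq hc hc' (h.unique h') x

end JostSolution

end

/-! ### The Jost solution and the odd kernel element of `L_c^*` -/

open MeasureTheory Filter Topology

noncomputable section

namespace JostSolution

open scoped ENNReal

/-- The coefficient `1 + 2ς`. -/
def coeff (s : ℝ → ℂ) (x : ℝ) : ℂ := 1 + 2 * s x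

/-- The standing assumptions on the linearised operators, for a continuous representative `s`
of the profile. -/
structure LinearSetting (c ω q qς : ℝ) (s : ℝ → ℂ) : Prop where
  speed : 1 < |c|
  freq_pos : 0 < ω
  freq_lt : ω < 3 / 2
  freq_zero : symbolB c ω = 0
  rate_pos : 0 < q
  rate_lt_one : q < 1
  rate_lt : 2 * q < qς
  cont : Continuous s
  even : ∀ x, s (-x) = s x
  real : ∀ x, (starRingEnd ℂ) (s x) = s x
  bound : AbsBdd qς s
  solvable : AdjointSolvable c q (coeff s)

namespace LinearSetting

variable {c ω q qς : ℝ} {s : ℝ → ℂ}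

theorem speed_ne_zero (S : LinearSetting c ω q qς s) : c ≠ 0 := by
  rintro rfl
  have := S.speed
  norm_num at this

theorem coeff_continuous (S : LinearSetting c ω q qς s) : Continuous (coeff s) :=
  continuous_const.add (continuous_const.mul S.cont)

theorem coeff_even (S : LinearSetting c ω q qς s) (x : ℝ) : coeff s (-x) = coeff s x := by
  simp [coeff, S.even]

theorem coeff_conj (S : LinearSetting c ω q qς s) (x : ℝ) :
    (starRingEnd ℂ) (coeff s x) = coeff s x := by
  simp only [coeff, map_add, map_mul, map_one, Complex.conj_ofNat, S.real]

theorem coeff_bounded (S : LinearSetting c ω q qς s) : ∃ B, ∀ x, ‖coeff s x‖ ≤ B := by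
  obtain ⟨C, hC⟩ := S.bound.mono (q := 0) (by linarith [S.rate_pos, S.rate_lt])
  refine ⟨1 + 2 * C, fun x => (norm_add_le _ _).trans ?_⟩
  have := hC x
  rw [norm_mul]
  simp at this ⊢
  linarith

theorem coeff_tendsto (S : LinearSetting c ω q qς s) : Tendsto (coeff s) atTop (𝓝 1) := by
  have := ((S.bound.expBdd S.rate_pos.le (by linarith [S.rate_pos, S.rate_lt])).tendsto
    S.rate_pos).const_mul 2
  rw [mul_zero] at this
  have h1 := this.const_add 1
  rwa [add_zero] at h1

theorem sq_freq (S : LinearSetting c ω q qς s) :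
    (c : ℂ) ^ 2 * (ω : ℂ) ^ 2 = 2 + 2 * (Real.cos ω : ℂ) := by
  have h := S.freq_zero
  unfold symbolB at h
  have h' : c ^ 2 * ω ^ 2 = 2 + 2 * Real.cos ω := by linarith
  exact_mod_cast congrArg (fun t : ℝ => (t : ℂ)) h'

theorem average_ne_zero (S : LinearSetting c ω q qς s) : (2 + 2 * (Real.cos ω : ℂ)) ≠ 0 := by
  rw [← S.sq_freq]
  have h1 : (c : ℂ) ≠ 0 := by exact_mod_cast S.speed_ne_zero
  have h2 : (ω : ℂ) ≠ 0 := by exact_mod_cast S.freq_pos.ne'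
  exact mul_ne_zero (pow_ne_zero 2 h1) (pow_ne_zero 2 h2)

theorem flux_const_ne_zero (S : LinearSetting c ω q qς s) :
    2 * Complex.I * ((c : ℂ) ^ 2 * ω + Real.sin ω) ≠ 0 := by
  have h1 : 0 < Real.sin ω := Real.sin_pos_of_pos_of_lt_pi S.freq_pos
    (by linarith [S.freq_lt, Real.pi_gt_three])
  have h2 : 0 < c ^ 2 * ω + Real.sin ω := by
    have := S.freq_pos
    positivity
  have h3 : ((c : ℂ) ^ 2 * ω + Real.sin ω) ≠ 0 := by exact_mod_cast h2.ne'
  exact mul_ne_zero (by simp) h3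

/-- Asymptotics of solutions of `L_c^* u = 0` of moderate growth. -/
theorem exists_expAsymp_of_repLstar (S : LinearSetting c ω q qς s) {u u₁ u₂ : ℝ → ℂ}
    (h : AC u u₁) (h₁ : AC u₁ u₂) (hu : AbsBdd (-q) u)
    (he : repLstar c (coeff s) u u₂ =ᵐ[volume] 0) : ∃ a b, ExpAsymp q ω u u₁ a b := by
  have hq := S.rate_pos
  have hq2 := S.rate_lt
  -- Here `2q < qς` enters: `s` decays at rate `qς` and `u` grows at rate at most `q`, so the
  -- product decays at rate `qς - q > q`.
  have hb := (S.bound.mul hu.average).const_mul (-2)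
  have hfc : Continuous (fun x => -2 * (s x * (2 * u x + u (x + 1) + u (x - 1)))) :=
    continuous_const.mul (S.cont.mul h.average.continuous)
  refine exists_expAsymp S.speed S.freq_pos S.freq_lt S.freq_zero hq S.rate_lt_one h h₁
    (f := fun x => -2 * (s x * (2 * u x + u (x + 1) + u (x - 1)))) ?_
    (hb.integrable hfc (by linarith)) (hb.expL2 hfc (by rw [abs_of_pos hq]; linarith))
    (hu.mono (by linarith [S.rate_lt_one]))
  filter_upwards [he] with x hx
  simp only [repLstar, coeff, Pi.zero_apply] at hx
  simp only [repB]
  linear_combination hx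

/-- The forcing term obtained by moving the localized part of `L_c` to the right-hand side. -/
theorem repB_of_repL {u u₂ g : ℝ → ℂ} (he : repL c (coeff s) u u₂ =ᵐ[volume] g) :
    repB c u u₂ =ᵐ[volume] fun x => g x + -2 * (2 * (s x * u x) + s (x + 1) * u (x + 1) +
      s (x - 1) * u (x - 1)) := by
  filter_upwards [he] with x hx
  simp only [repL, coeff] at hx
  simp only [repB]
  linear_combination hx

/-- Asymptotics of solutions of `L_c u = g` of moderate growth. -/
theorem exists_expAsymp_of_repL (S : LinearSetting c ω q qς s) {u u₁ u₂ g : ℝ → ℂ}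
    (h : AC u u₁) (h₁ : AC u₁ u₂) (hu : AbsBdd (-q) u) (hg : Integrable g volume)
    (hg2 : ExpL2 q g) (he : repL c (coeff s) u u₂ =ᵐ[volume] g) :
    ∃ a b, ExpAsymp q ω u u₁ a b := by
  have hq := S.rate_pos
  have hq2 := S.rate_lt
  have hb := ((S.bound.mul hu).average).const_mul (-2)
  have huc := h.continuous
  have hsc := S.cont
  have hfc : Continuous (fun x => -2 * (2 * (s x * u x) + s (x + 1) * u (x + 1) +
      s (x - 1) * u (x - 1))) := by fun_prop
  exact exists_expAsymp S.speed S.freq_pos S.freq_lt S.freq_zero hq S.rate_lt_one h h₁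
    (repB_of_repL he) (hg.add (hb.integrable hfc (by linarith)))
    (hg2.add (hb.expL2 hfc (by rw [abs_of_pos hq]; linarith)))
    (hu.mono (by linarith [S.rate_lt_one]))

/-- The Jost solution with `J ~ e^{iωx}` at `+∞`. -/
theorem exists_jost (S : LinearSetting c ω q qς s) :
    ∃ J J₁ J₂, AC J J₁ ∧ AC J₁ J₂ ∧ ExpAsymp q ω J J₁ 1 0 ∧ AbsBdd (-q) J ∧
      repLstar c (coeff s) J J₂ =ᵐ[volume] 0 := by
  have hq := S.rate_pos
  -- `B_c` annihilates the wave, so `L_c^* e^{iωx} = 2ς(2 + 2 cos ω)e^{iωx} = 2c²ω² ς e^{iωx}`; the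
  -- correction `v` removes this localized remainder.
  obtain ⟨v, v₁, v₂, hv, hv₁, hb, hb₁, he⟩ := S.solvable.solve
    (g := fun x => -(2 * (c : ℂ) ^ 2 * (ω : ℂ) ^ 2) * (s x * wave ω x))
    (continuous_const.mul (S.cont.mul (continuous_wave ω)))
    (((S.bound.mul (absBdd_wave ω)).const_mul _).expBdd hq.le (by linarith [S.rate_lt]))
  refine ⟨_, _, _, (AC.wave ω).add hv, (AC.wave_deriv ω).add hv₁,
    ⟨hb.congr fun x => by ring, hb₁.congr fun x => by ring⟩,
    ((absBdd_wave ω).mono (by linarith)).add (hb.absBdd hq.le), ?_⟩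
  filter_upwards [he] with x hx
  simp only [repLstar, Pi.zero_apply] at hx ⊢
  have e : wave ω (x - 1) = wave ω x * wave (-ω) 1 := by
    rw [sub_eq_add_neg, wave_add, wave_neg]
  rw [e, wave_add]
  simp only [coeff] at hx ⊢
  linear_combination hx + (1 + 2 * s x) * wave ω x * wave_one_add ω -
    (1 + 2 * s x) * wave ω x * S.sq_freq

theorem repLstar_conj (S : LinearSetting c ω q qς s) {u u₂ : ℝ → ℂ}
    (he : repLstar c (coeff s) u u₂ =ᵐ[volume] 0) :
    repLstar c (coeff s) (fun x => (starRingEnd ℂ) (u x)) (fun x => (starRingEnd ℂ) (u₂ x))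
      =ᵐ[volume] 0 := by
  filter_upwards [he] with x hx
  have := congrArg (starRingEnd ℂ) hx
  simp only [repLstar, map_add, map_mul, map_pow, Complex.conj_ofReal, S.coeff_conj,
    Complex.conj_ofNat, Pi.zero_apply, map_zero] at this ⊢
  exact this

theorem repLstar_comb {m u u₂ v v₂ : ℝ → ℂ} (he : repLstar c m u u₂ =ᵐ[volume] 0)
    (hv : repLstar c m v v₂ =ᵐ[volume] 0) (k : ℂ) :
    repLstar c m (fun x => u x + k * v x) (fun x => u₂ x + k * v₂ x) =ᵐ[volume] 0 := by
  filter_upwards [he, hv] with x hx hy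
  simp only [repLstar, Pi.zero_apply] at hx hy ⊢
  linear_combination hx + k * hy

theorem repL_comb {m u u₂ v v₂ g g' : ℝ → ℂ} (he : repL c m u u₂ =ᵐ[volume] g)
    (hv : repL c m v v₂ =ᵐ[volume] g') (k : ℂ) :
    repL c m (fun x => u x + k * v x) (fun x => u₂ x + k * v₂ x) =ᵐ[volume]
      fun x => g x + k * g' x := by
  filter_upwards [he, hv] with x hx hy
  simp only [repL] at hx hy ⊢
  linear_combination hx + k * hy

theorem repLstar_reflect (S : LinearSetting c ω q qς s) {u u₂ : ℝ → ℂ}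
    (he : repLstar c (coeff s) u u₂ =ᵐ[volume] 0) :
    repLstar c (coeff s) (fun x => u (-x)) (fun x => u₂ (-x)) =ᵐ[volume] 0 := by
  filter_upwards [ae_reflect he] with x hx
  rw [repLstar_neg S.coeff_even, hx]
  rfl

/-- `(2 + A)` maps the kernel of `L_c^*` into that of `L_c`. -/
theorem repL_average_eq_zero {m u u₂ : ℝ → ℂ} (he : repLstar c m u u₂ =ᵐ[volume] 0) :
    repL c m (fun x => 2 * u x + u (x + 1) + u (x - 1))
      (fun x => 2 * u₂ x + u₂ (x + 1) + u₂ (x - 1)) =ᵐ[volume] 0 := by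
  filter_upwards [he, ae_shift he 1, ae_shift he (-1)] with x e1 e2 e3
  rw [← sub_eq_add_neg] at e3
  have := repL_average c m (fun _ => 0) (fun _ => 0) u u₂ x
  simp only [zero_add] at this
  rw [this, e1, e2, e3]
  simp

/-- No Jost solution is even. -/
theorem jost_not_even (S : LinearSetting c ω q qς s) {J J₁ J₂ : ℝ → ℂ} (h : AC J J₁)
    (h₁ : AC J₁ J₂) (hJ : ExpAsymp q ω J J₁ 1 0)
    (he : repLstar c (coeff s) J J₂ =ᵐ[volume] 0) : ¬ ∀ x, J (-x) = J x := by
  intro hev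
  -- The partner in the flux is `(2 + A)` of the conjugate of `J`. It lies in the kernel of `L_c`
  -- and carries the opposite wave; `(2 + A)J` itself would only give the limit zero.
  have hf := h.conj.average
  have hf₁ := h₁.conj.average
  have hfe := repL_average_eq_zero (S.repLstar_conj he)
  have odd : ∀ {u u₁ : ℝ → ℂ}, AC u u₁ → Continuous u₁ → (∀ x, u (-x) = u x) →
      (fun x => -u₁ (-x)) = u₁ := by
    intro u u₁ hu hc hx
    funext x
    have hn := hu.comp_neg
    simp only [hx] at hn
    exact hn.deriv_eq hu (hc.comp continuous_neg).neg hc x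
  have hfev : ∀ x, (fun x => 2 * (starRingEnd ℂ) (J x) + (starRingEnd ℂ) (J (x + 1)) +
      (starRingEnd ℂ) (J (x - 1))) (-x) = (fun x => 2 * (starRingEnd ℂ) (J x) +
        (starRingEnd ℂ) (J (x + 1)) + (starRingEnd ℂ) (J (x - 1))) x := by
    intro x
    simp only
    rw [hev x, show -x + 1 = -(x - 1) by ring, show -x - 1 = -(x + 1) by ring, hev, hev]
    ring
  have hΦ := AC.flux (c := c) S.coeff_continuous hf hf₁ h h₁
  have hΦ0 := hΦ.congr (z := fun _ => 0) (by
    filter_upwards [hfe, he] with x e1 e2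
    rw [e1, e2]
    simp)
  have hlim := flux_tendsto (c := c) S.rate_pos S.coeff_continuous hf.continuous h.continuous
    S.coeff_tendsto hJ.conj.average hJ
  -- For two even functions the flux vanishes at `0`, hence everywhere since it is constant, which
  -- contradicts the nonzero limit at `+∞`.
  have h0 := flux_neg (c := c) S.coeff_even (fun x => 2 * (starRingEnd ℂ) (J x) +
    (starRingEnd ℂ) (J (x + 1)) + (starRingEnd ℂ) (J (x - 1)))
    (fun x => 2 * (starRingEnd ℂ) (J₁ x) +
    (starRingEnd ℂ) (J₁ (x + 1)) + (starRingEnd ℂ) (J₁ (x - 1))) J J₁ 0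
  rw [odd hf hf₁.continuous hfev, odd h h₁.continuous hev, funext hfev, funext hev, neg_zero] at h0
  have h00 := self_eq_neg.mp h0
  have hc : flux c (coeff s) (fun x => 2 * (starRingEnd ℂ) (J x) +
    (starRingEnd ℂ) (J (x + 1)) + (starRingEnd ℂ) (J (x - 1)))
    (fun x => 2 * (starRingEnd ℂ) (J₁ x) +
    (starRingEnd ℂ) (J₁ (x + 1)) + (starRingEnd ℂ) (J₁ (x - 1))) J J₁ = fun _ => 0 := by
    funext x
    have := hΦ0.2 0 x
    rw [h00] at this
    simpa using this
  rw [hc] at hlim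
  have := tendsto_nhds_unique hlim tendsto_const_nhds
  simp only [map_zero, map_one, mul_zero, zero_sub, mul_one, mul_neg, neg_eq_zero] at this
  exact mul_ne_zero S.flux_const_ne_zero S.average_ne_zero this

/-- A real odd solution of `L_c^* v = 0`, normalized at `+∞`. -/
theorem exists_odd_solution (S : LinearSetting c ω q qς s) :
    ∃ v v₁ v₂ : ℝ → ℂ, ∃ α : ℂ, AC v v₁ ∧ AC v₁ v₂ ∧
      repLstar c (coeff s) v v₂ =ᵐ[volume] 0 ∧ (∀ x, v (-x) = -v x) ∧
      (∀ x, (starRingEnd ℂ) (v x) = v x) ∧ ‖α‖ = 1 / 2 ∧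
      ExpAsymp q ω v v₁ α ((starRingEnd ℂ) α) ∧ (∃ B, ∀ x, ‖v x‖ ≤ B) ∧ ∃ B, ∀ x, ‖v₁ x‖ ≤ B := by
  obtain ⟨J, J₁, J₂, h, h₁, hJ, hb, he⟩ := S.exists_jost
  have hr := S.repLstar_reflect he
  obtain ⟨a, b, hR⟩ := S.exists_expAsymp_of_repLstar h.comp_neg h₁.comp_neg_two hb.comp_neg hr
  -- the odd part, rotated and made real
  have key : ∃ k : ℂ, ∃ x, k * (J x - J (-x)) + (starRingEnd ℂ) (k * (J x - J (-x))) ≠ 0 := by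
    by_contra! hk
    refine S.jost_not_even h h₁ hJ he fun x => ?_
    have k1 := hk 1 x
    have k2 := hk Complex.I x
    simp only [map_mul, Complex.conj_I, one_mul] at k1 k2
    have k3 : 2 * Complex.I * (J x - J (-x)) = 0 := by linear_combination k2 + Complex.I * k1
    have := (mul_eq_zero.mp k3).resolve_left (by simp)
    exact (sub_eq_zero.mp this).symm
  obtain ⟨k, x₀, hx₀⟩ := key
  have hw := (h.sub h.comp_neg).const_mul k
  have hw₁ := (h₁.sub h₁.comp_neg_two).const_mul k
  have hwe : repLstar c (coeff s) (fun x => k * (J x - J (-x))) (fun x => k * (J₂ x - J₂ (-x)))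
      =ᵐ[volume] 0 := by
    filter_upwards [repLstar_comb he hr (-1)] with x hx
    simp only [repLstar, Pi.zero_apply] at hx ⊢
    linear_combination k * hx
  have hv := hw.add hw.conj
  have hv₁ := hw₁.add hw₁.conj
  have hve := repLstar_comb hwe (S.repLstar_conj hwe) 1
  simp only [one_mul] at hve
  have hA := (hJ.sub hR).const_mul k
  have hvA := hA.add hA.conj
  have hodd : ∀ x, k * (J (-x) - J (- -x)) + (starRingEnd ℂ) (k * (J (-x) - J (- -x))) =
      -(k * (J x - J (-x)) + (starRingEnd ℂ) (k * (J x - J (-x)))) := by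
    intro x
    simp only [neg_neg, map_mul, map_sub]
    ring
  set α : ℂ := k * (1 - a) + (starRingEnd ℂ) (k * (0 - b)) with hα
  have hα2 : k * (0 - b) + (starRingEnd ℂ) (k * (1 - a)) = (starRingEnd ℂ) α := by
    rw [hα, map_add, Complex.conj_conj, add_comm]
  rw [hα2] at hvA
  -- With vanishing amplitudes the solution would be `O(e^{-qx})` on the whole line, hence zero by
  -- uniqueness for `L_c^*`.
  have hα0 : α ≠ 0 := by
    intro h0
    rw [h0, map_zero] at hvA
    exact hx₀ (S.solvable.unique hv hv₁ hvA.expBdd hve x₀)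
  have hn : (0 : ℝ) < 2 * ‖α‖ := by positivity
  -- Scaling to `|α| = 1/2` gives `2 Re (α e^{iωx})` unit amplitude.
  set t : ℂ := ((2 * ‖α‖ : ℝ) : ℂ)⁻¹ with ht
  have htc : (starRingEnd ℂ) t = t := by rw [ht, map_inv₀, Complex.conj_ofReal]
  have htn : ‖t‖ = (2 * ‖α‖)⁻¹ := by rw [ht, norm_inv, Complex.norm_real, Real.norm_of_nonneg hn.le]
  have hfin := hvA.const_mul t
  rw [show t * (starRingEnd ℂ) α = (starRingEnd ℂ) (t * α) by rw [map_mul, htc]] at hfin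
  have hV := hv.const_mul t
  have hV₁ := hv₁.const_mul t
  have hVodd : ∀ x, t * (k * (J (-x) - J (- -x)) + (starRingEnd ℂ) (k * (J (-x) - J (- -x)))) =
      -(t * (k * (J x - J (-x)) + (starRingEnd ℂ) (k * (J x - J (-x))))) := by
    intro x
    rw [hodd]; ring
  -- The asymptotics give boundedness for `x ≥ 0` only; parity covers the other half-line.
  obtain ⟨B, hB⟩ := hfin.absBdd_zero_of_nonneg S.rate_pos.le
  refine ⟨_, _, _, t * α, hV, hV₁, ?_, hVodd, ?_, ?_, hfin, ⟨B, fun x => ?_⟩, ⟨B, fun x => ?_⟩⟩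
  · filter_upwards [hve] with x hx
    simp only [repLstar, Pi.zero_apply] at hx ⊢
    linear_combination t * hx
  · intro x
    rw [map_mul, htc, map_add, Complex.conj_conj, add_comm]
  · rw [norm_mul, htn]
    field_simp
  · rcases le_total 0 x with hx | hx
    · exact (hB x hx).1
    · have := (hB (-x) (by linarith)).1
      rwa [hVodd, norm_neg] at this
  · rcases le_total 0 x with hx | hx
    · exact (hB x hx).2
    · have h1 := (hB (-x) (by linarith)).2
      have hn' := hV.comp_neg
      simp only [hVodd] at hn'
      have e := hn'.deriv_eq hV.neg ((hV₁.continuous.comp continuous_neg).neg) hV₁.continuous.neg x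
      rw [neg_inj] at e
      rwa [e] at h1

end LinearSetting

end JostSolution

end

/-! ### Green's identity, odd localized solutions and their decay -/

open MeasureTheory Filter Topology

noncomputable section

namespace JostSolution

open scoped ENNReal

theorem ExpL2.reflect {q : ℝ} {u : ℝ → ℂ} (h : ExpL2 q u) : ExpL2 (-q) (fun x => u (-x)) := by
  have := MemLp.comp_measurePreserving h (Measure.measurePreserving_neg (volume : Measure ℝ))
  refine this.ae_eq (Eventually.of_forall fun x => ?_)
  simp

/-- The weight satisfies `cosh^q x ≤ e^{q|x|} ≤ e^{qx} + e^{-qx}`. -/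
theorem memLp_coshMul_of_expL2 {q : ℝ} (hq : 0 ≤ q) {u : ℝ → ℂ} (hu : Continuous u)
    (h : ExpL2 q u) (h' : ExpL2 (-q) u) : MemLp (coshMul q u) 2 volume := by
  refine (h.norm.add h'.norm).of_le ((continuous_cosh_rpow q).mul hu).aestronglyMeasurable
    (Eventually.of_forall fun x => ?_)
  have hp : 0 ≤ Real.cosh x ^ q := Real.rpow_nonneg (Real.cosh_pos x).le _
  simp only [Pi.add_apply, coshMul]
  rw [Real.norm_of_nonneg (by positivity), norm_mul, norm_mul, norm_mul, Complex.norm_real,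
    Complex.norm_real, Complex.norm_real, Real.norm_of_nonneg hp,
    Real.norm_of_nonneg (Real.exp_pos _).le, Real.norm_of_nonneg (Real.exp_pos _).le, ← add_mul]
  gcongr
  have h1 : Real.cosh x ≤ Real.exp |x| := by
    rw [← Real.cosh_abs, Real.cosh_eq]
    have : Real.exp (-|x|) ≤ Real.exp |x| := Real.exp_le_exp.mpr (by linarith [abs_nonneg x])
    linarith
  calc Real.cosh x ^ q ≤ Real.exp |x| ^ q := Real.rpow_le_rpow (Real.cosh_pos x).le h1 hq
    _ = Real.exp (q * |x|) := by rw [← Real.exp_mul, mul_comm]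
    _ ≤ _ := by
      rcases le_total 0 x with hx | hx
      · rw [abs_of_nonneg hx]
        exact le_add_of_nonneg_right (Real.exp_pos _).le
      · rw [abs_of_nonpos hx, mul_neg, ← neg_mul]
        exact le_add_of_nonneg_left (Real.exp_pos _).le

theorem memLp_of_coshMul {q : ℝ} (hq : 0 ≤ q) {f : ℝ → ℂ} (h : MemLp (coshMul q f) 2 volume) :
    MemLp f 2 volume := by
  refine h.of_le (coshMul_aestronglyMeasurable h.1) (Eventually.of_forall fun x => ?_)
  rw [norm_eq_coshMul q f]
  exact mul_le_of_le_one_left (norm_nonneg _)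
    (Real.rpow_le_one_of_one_le_of_nonpos (Real.one_le_cosh x) (by linarith))

theorem AC.deriv_even {u u₁ : ℝ → ℂ} (h : AC u u₁) (hc : Continuous u₁)
    (ho : ∀ x, u (-x) = -u x) (x : ℝ) : u₁ (-x) = u₁ x := by
  have hn := h.comp_neg
  simp only [ho] at hn
  exact neg_inj.mp (hn.deriv_eq h.neg ((hc.comp continuous_neg).neg) hc.neg x)

theorem ExpL2.of_tailMass {p : ℝ} (hp : 0 < p) (hp1 : p < 1) {f u : ℝ → ℂ} (hu : Continuous u)
    (hf : ExpL2 p f) {A : ℝ≥0∞} (hA : A ≠ ∞) (h : ∀ x, ‖u x‖ₑ ≤ A * tailMass f x) :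
    ExpL2 p u := by
  refine (memLp_two_iff_lintegral
    ((continuous_exp_complex p).mul hu).aestronglyMeasurable).mpr ?_
  have hle : ∫⁻ x, ‖(Real.exp (p * x) : ℂ) * u x‖ₑ ^ 2 ≤
      A ^ 2 * ∫⁻ x, (ENNReal.ofReal (Real.exp (p * x)) * tailMass f x) ^ 2 := by
    rw [← lintegral_const_mul' _ _ (ENNReal.pow_ne_top hA)]
    refine lintegral_mono fun x => ?_
    simp only
    rw [enorm_exp_mul, ← mul_pow]
    refine pow_le_pow_left' ?_ 2
    calc _ ≤ ENNReal.ofReal (Real.exp (p * x)) * (A * tailMass f x) := by gcongr; exact h x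
      _ = _ := by ring
  exact (hle.trans_lt (ENNReal.mul_lt_top (ENNReal.pow_lt_top hA.lt_top)
    (lintegral_tailMass_sq_ne_top hp hp1 hf).lt_top)).ne

namespace LinearSetting

variable {c ω q qς : ℝ} {s : ℝ → ℂ}

/-- Green's identity on the whole line. -/
theorem integral_mul_eq (S : LinearSetting c ω q qς s) {f f₁ f₂ g v v₁ v₂ : ℝ → ℂ}
    {a b a' b' α β : ℂ} (hf : AC f f₁) (hf₁ : AC f₁ f₂) (hv : AC v v₁) (hv₁ : AC v₁ v₂)
    (he : repL c (coeff s) f f₂ =ᵐ[volume] g) (hve : repLstar c (coeff s) v v₂ =ᵐ[volume] 0)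
    (ho : ∀ x, v (-x) = -v x) (hA : ExpAsymp q ω f f₁ a b)
    (hA' : ExpAsymp q ω (fun x => f (-x)) (fun x => -f₁ (-x)) a' b')
    (hvA : ExpAsymp q ω v v₁ α β) (hi : Integrable (fun x => g x * v x) volume) :
    ∫ x, g x * v x = 2 * Complex.I * ((c : ℂ) ^ 2 * ω + Real.sin ω) * (a * β - b * α) -
      2 * Complex.I * ((c : ℂ) ^ 2 * ω + Real.sin ω) * (a' * β - b' * α) := by
  have hΦ := (AC.flux (c := c) S.coeff_continuous hf hf₁ hv hv₁).congr
    (z := fun x => g x * v x) (by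
      filter_upwards [he, hve] with x e1 e2
      rw [e1, e2]
      simp)
  have l1 := flux_tendsto (c := c) S.rate_pos S.coeff_continuous hf.continuous hv.continuous
    S.coeff_tendsto hA hvA
  have l2 := flux_tendsto (c := c) S.rate_pos S.coeff_continuous
    (hf.continuous.comp continuous_neg) hv.neg.continuous
    S.coeff_tendsto hA' (v := fun x => -v x) (v₁ := fun x => -v₁ x) (α := -α) (β := -β) (by
      simpa using hvA.const_mul (-1))
  -- The flux at `-∞` is minus that of the reflected pair at `+∞`; reflection turns the odd `v` into
  -- `-v`, and the two signs cancel.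
  have l3 : Tendsto (fun x => flux c (coeff s) f f₁ v v₁ (-x)) atTop
      (𝓝 (2 * Complex.I * ((c : ℂ) ^ 2 * ω + Real.sin ω) * (a' * β - b' * α))) := by
    have e : ∀ x, flux c (coeff s) f f₁ v v₁ (-x) = -flux c (coeff s) (f ∘ fun a => -a)
        (fun x => -f₁ (-x)) (fun x => -v x) (fun x => -v₁ x) x := by
      intro x
      rw [flux_neg S.coeff_even]
      simp only [ho, hv.deriv_even hv₁.continuous ho]
      rfl
    simp only [e]
    refine l2.neg.trans (le_of_eq ?_)
    congr 1
    ring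
  refine tendsto_nhds_unique (intervalIntegral_tendsto_integral hi tendsto_neg_atTop_atBot
    tendsto_id) ((l1.sub l3).congr fun x => ?_)
  exact hΦ.2 (-x) x

/-- Solvability of `L_c u = g` in odd localized functions, at the base rate. -/
theorem exists_odd_localized (S : LinearSetting c ω q qς s) {v v₁ v₂ g : ℝ → ℂ} {α : ℂ}
    (hv : AC v v₁) (hv₁ : AC v₁ v₂) (hve : repLstar c (coeff s) v v₂ =ᵐ[volume] 0)
    (ho : ∀ x, v (-x) = -v x) (hα : α ≠ 0) (hvA : ExpAsymp q ω v v₁ α ((starRingEnd ℂ) α))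
    (hg : Integrable g volume) (hg2 : ExpL2 q g) (hgo : AEOdd g)
    (hi : Integrable (fun x => g x * v x) volume) (h0 : ∫ x, g x * v x = 0) :
    ∃ u u₁ u₂, AC u u₁ ∧ AC u₁ u₂ ∧ repL c (coeff s) u u₂ =ᵐ[volume] g ∧
      (∀ x, u (-x) = -u x) ∧ AbsBdd q u ∧ ExpBdd q u₁ := by
  have hq := S.rate_pos
  obtain ⟨B, hB⟩ := S.coeff_bounded
  obtain ⟨C, hC0, hC⟩ := tailMass_bound hq S.rate_lt_one hg2
  obtain ⟨u, u₁, u₂, hu, hu₁, hb, hb₁, he⟩ := S.solvable.repL_solve S.speed_ne_zero hq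
    S.coeff_continuous hB hg.locallyIntegrable hC0
    fun x => (lintegral_Ioi_enorm_le_tailMass g x).trans (hC x)
  -- As `g` is odd, `-u(-x)` is a second solution, decaying at `-∞` and of moderate growth at `+∞`.
  have hF : AC (fun x => -u (-x)) (fun x => u₁ (-x)) := by simpa using hu.comp_neg.neg
  have hF₁ : AC (fun x => u₁ (-x)) (fun x => -u₂ (-x)) := hu₁.comp_neg
  have hFe : repL c (coeff s) (fun x => -u (-x)) (fun x => -u₂ (-x)) =ᵐ[volume] g := by
    filter_upwards [ae_reflect he, hgo] with x e1 e2
    have := repL_neg (c := c) S.coeff_even u u₂ x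
    rw [e1, e2] at this
    simp only [repL] at this ⊢
    linear_combination -this
  obtain ⟨a, b, hA⟩ := S.exists_expAsymp_of_repL hF hF₁ (by
    simpa using ((hb.absBdd hq.le).comp_neg).const_mul (-1)) hg hg2 hFe
  have hA' : ExpAsymp q ω (fun x => -u (- -x)) (fun x => -u₁ (- -x)) 0 0 :=
    ExpAsymp.of_expBdd (by simpa using hb.neg) (by simpa using hb₁.neg)
  have hflux := S.integral_mul_eq hF hF₁ hv hv₁ hFe hve ho hA hA' hvA hi
  rw [h0, zero_mul, zero_mul, sub_self, mul_zero, sub_zero, eq_comm, mul_eq_zero,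
    or_iff_right S.flux_const_ne_zero, sub_eq_zero] at hflux
  have hκ := S.average_ne_zero
  -- Vanishing flux says that the amplitudes `a, b` are proportional to `α` and its conjugate. Since
  -- `(2 + A)v` lies in the kernel of `L_c` with amplitudes `2 + 2 cos ω` times those of `v`,
  -- subtracting `μ` times it removes both `a` and `b`.
  set μ : ℂ := a / (α * (2 + 2 * Real.cos ω)) with hμ
  have hμa : μ * ((2 + 2 * (Real.cos ω : ℂ)) * α) = a := by
    rw [hμ, mul_comm _ α, div_mul_cancel₀ _ (mul_ne_zero hα hκ)]
  have hμb : μ * ((2 + 2 * (Real.cos ω : ℂ)) * (starRingEnd ℂ) α) = b :=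
    mul_right_cancel₀ hα (by linear_combination (starRingEnd ℂ) α * hμa + hflux)
  have hD := hA.add (hvA.average.const_mul (-μ))
  rw [neg_mul, neg_mul, hμa, hμb, add_neg_cancel, add_neg_cancel] at hD
  have hDe := repL_comb hFe (repL_average_eq_zero hve) (-μ)
  have hE := repL_comb hDe he (-1)
  have hz := S.solvable.repL_unique S.speed_ne_zero hq S.coeff_continuous hB
    ((hF.add (hv.average.const_mul (-μ))).add (hu.const_mul (-1)))
    ((hF₁.add (hv₁.average.const_mul (-μ))).add (hu₁.const_mul (-1)))
    (hD.expBdd.add (hb.const_mul (-1))) (hE.trans (Eventually.of_forall fun x => by simp))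
  -- `hz` equates `-u(-x) - u(x)`, which is even, with `μ (2 + A)v`, which is odd; both are zero.
  have hodd : ∀ x, u (-x) = -u x := by
    intro x
    have h1 := hz x
    have h2 := hz (-x)
    simp only [neg_neg] at h2
    rw [show -x + 1 = -(x - 1) by ring, show -x - 1 = -(x + 1) by ring, ho, ho, ho] at h2
    linear_combination (-1 / 2) * h1 - (1 / 2) * h2
  exact ⟨u, u₁, u₂, hu, hu₁, he, hodd, AbsBdd.of_two_sided hb (by simpa [hodd] using hb.neg), hb₁⟩

/-- The forcing obtained by moving the localized part of `L_c` to the right. -/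
def forcing (s g u : ℝ → ℂ) (x : ℝ) : ℂ :=
  g x + -2 * (2 * (s x * u x) + s (x + 1) * u (x + 1) + s (x - 1) * u (x - 1))

theorem forcing_expL2 (S : LinearSetting c ω q qς s) {g u : ℝ → ℂ} {p p' : ℝ} (hu : Continuous u)
    (hb : AbsBdd p u) (hg : ExpL2 p' g) (hp : 0 ≤ p') (hp' : p' < qς + p) :
    ExpL2 p' (forcing s g u) := by
  have h := ((S.bound.mul hb).average).const_mul (-2)
  have hsc := S.cont
  have hfc : Continuous (fun x => -2 * (2 * (s x * u x) + s (x + 1) * u (x + 1) +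
      s (x - 1) * u (x - 1))) := by fun_prop
  exact hg.add (h.expL2 hfc (by rwa [abs_of_nonneg hp]))

/-- Since `u` and `u₁` tend to zero at `+∞`, the amplitudes in `exists_asymptotics` vanish and only
the tail of the forcing remains. This estimate drives the bootstrap on the decay rate. -/
theorem exists_tailMass_bound (S : LinearSetting c ω q qς s) {u u₁ u₂ g : ℝ → ℂ} (hu : AC u u₁)
    (hu₁ : AC u₁ u₂) (hb : AbsBdd q u) (hb₁ : ExpBdd q u₁)
    (he : repL c (coeff s) u u₂ =ᵐ[volume] g) (hg : Integrable g volume) (hg2 : ExpL2 q g) :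
    ∃ A : ℝ≥0∞, A ≠ ∞ ∧ ∀ x, ‖u x‖ₑ ≤ A * tailMass (forcing s g u) x ∧
      ‖u₁ x‖ₑ ≤ A * tailMass (forcing s g u) x := by
  have hq := S.rate_pos
  have hqς := S.rate_lt
  have hsc := S.cont
  have huc := hu.continuous
  have h2 := S.forcing_expL2 huc hb hg2 hq.le (by linarith)
  have hfc : Continuous (fun x => -2 * (2 * (s x * u x) + s (x + 1) * u (x + 1) +
      s (x - 1) * u (x - 1))) := by fun_prop
  have hI : Integrable (forcing s g u) volume :=
    hg.add ((((S.bound.mul hb).average).const_mul (-2)).integrable hfc (by linarith))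
  obtain ⟨M, hM⟩ := hb.mono (q := -1) (by linarith)
  obtain ⟨a, b, A, hA, hAb⟩ := exists_asymptotics S.speed S.freq_pos S.freq_lt S.freq_zero hu hu₁
    (repB_of_repL he) hI (M := M) (by simpa using hM)
  have key : ∀ {z : ℝ → ℂ}, (∀ x, ‖z x‖ₑ ≤ A * tailMass (forcing s g u) x) → ExpBdd q z :=
    fun hz => ExpBdd.of_tailMass hq S.rate_lt_one h2 hA hz
  have t1 : Tendsto (fun x => a * wave ω x + b * wave (-ω) x) atTop (𝓝 0) :=
    (((hb.expBdd hq.le le_rfl).sub (key fun x => (hAb x).1)).tendsto hq).congr fun x => by ring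
  have t2 : Tendsto (fun x => Complex.I * ω * (a * wave ω x - b * wave (-ω) x)) atTop (𝓝 0) :=
    ((hb₁.sub (key fun x => (hAb x).2)).tendsto hq).congr fun x => by ring
  obtain ⟨rfl, rfl⟩ := amplitudes_eq_zero S.freq_pos.ne' t1 t2
  exact ⟨A, hA, fun x => by
    have := hAb x
    simp only [zero_mul, add_zero, sub_zero, mul_zero] at this
    exact this⟩

/-- Odd localized solutions of `L_c u = g` inherit the decay of `g`. -/
theorem memLp_coshMul (S : LinearSetting c ω q qς s) {u u₁ u₂ g : ℝ → ℂ} (hu : AC u u₁)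
    (hu₁ : AC u₁ u₂) (hb : AbsBdd q u) (hb₁ : ExpBdd q u₁) (ho : ∀ x, u (-x) = -u x)
    (he : repL c (coeff s) u u₂ =ᵐ[volume] g) {q' : ℝ} (hq' : q ≤ q') (hq1 : q' < 1)
    (hg : MemLp (coshMul q' g) 2 volume) :
    MemLp (coshMul q' u) 2 volume ∧ MemLp (coshMul q' u₁) 2 volume := by
  have hq := S.rate_pos
  have hqς := S.rate_lt
  have hq0 : 0 < q' := by linarith
  have gL : ∀ {p}, 0 ≤ p → p ≤ q' → ExpL2 p g := fun h1 h2 =>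
    ExpL2.of_coshMul (by rwa [abs_of_nonneg h1]) hg
  obtain ⟨A, hA, hbd⟩ := S.exists_tailMass_bound hu hu₁ hb hb₁ he (integrable_of_coshMul hq0 hg)
    (gL hq.le hq')
  -- Bootstrap on the rate: in the forcing, the factor `s` improves the rate of `u` by `qς`, so
  -- increments of `qς / 2` keep the required inequality strict. The rate is capped at that of `g`.
  have step : ∀ n : ℕ, AbsBdd (min q' (q + n * (qς / 2))) u := by
    intro n
    induction n with
    | zero => exact hb.mono (by simp)
    | succ n ih =>
      set p := min q' (q + n * (qς / 2)) with hp
      set p' := min q' (q + (n + 1 : ℕ) * (qς / 2)) with hp'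
      have n0 : (0 : ℝ) ≤ n * (qς / 2) := by
        have : 0 ≤ qς / 2 := by linarith
        positivity
      have e1 : p' ≤ q' := min_le_left _ _
      have e2 : 0 < p' := lt_min hq0 (by push_cast; linarith)
      have e3 : p' < qς + p := by
        rcases min_choice q' (q + n * (qς / 2)) with h | h
        · rw [hp, h]; linarith
        · rw [hp, h]
          refine (min_le_right _ _).trans_lt ?_
          push_cast
          linarith
      have h1 : ExpBdd p' u := ExpBdd.of_tailMass e2 (e1.trans_lt hq1)
        (S.forcing_expL2 hu.continuous ih (gL e2.le e1) e2.le e3) hA fun x => (hbd x).1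
      exact AbsBdd.of_two_sided h1 (by simpa [ho] using h1.neg)
  obtain ⟨n, hn⟩ := exists_nat_gt (q' / (qς / 2))
  have hpos : 0 < qς / 2 := by linarith
  have hlast : AbsBdd q' u := (step n).mono (le_min le_rfl (by
    rw [div_lt_iff₀ hpos] at hn
    linarith))
  have hF := S.forcing_expL2 hu.continuous hlast (gL hq0.le le_rfl) hq0.le (by linarith)
  have f0 := ExpL2.of_tailMass hq0 hq1 hu.continuous hF hA fun x => (hbd x).1
  have f1 := ExpL2.of_tailMass hq0 hq1 hu₁.continuous hF hA fun x => (hbd x).2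
  refine ⟨memLp_coshMul_of_expL2 hq0.le hu.continuous f0 ?_,
    memLp_coshMul_of_expL2 hq0.le hu₁.continuous f1 ?_⟩
  · have := f0.reflect.const_mul (-1)
    simpa [ho] using this
  · have := f1.reflect
    simpa [hu.deriv_even hu₁.continuous ho] using this

end LinearSetting

end JostSolution

end

/-! ### Fredholm alternative, pairing bound and the main theorem -/

open MeasureTheory Filter Topology

noncomputable section

namespace JostSolution

open scoped ENNReal

/-- The real asymptotic profile of a normalized real solution. -/
theorem re_amplitude {ω : ℝ} (hω : ω ≠ 0) {α : ℂ} (hα : ‖α‖ = 1 / 2) (x : ℝ) :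
    (α * wave ω x + (starRingEnd ℂ) α * wave (-ω) x).re =
      Real.sin (ω * (x + (α.arg + Real.pi / 2) / ω)) ∧
    (Complex.I * ω * (α * wave ω x - (starRingEnd ℂ) α * wave (-ω) x)).re =
      ω * Real.cos (ω * (x + (α.arg + Real.pi / 2) / ω)) := by
  have e : α * wave ω x = ((1 / 2 : ℝ) : ℂ) * Complex.exp ((α.arg + ω * x : ℝ) * Complex.I) := by
    conv_lhs => rw [← Complex.norm_mul_exp_arg_mul_I α]
    rw [hα, wave, mul_assoc, ← Complex.exp_add]
    push_cast
    ring_nf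
  have e' : (starRingEnd ℂ) α * wave (-ω) x = (starRingEnd ℂ) (α * wave ω x) := by
    rw [map_mul, conj_wave]
  have arg : ω * (x + (α.arg + Real.pi / 2) / ω) = α.arg + ω * x + Real.pi / 2 := by
    field_simp
    ring
  rw [arg, Real.sin_add_pi_div_two, Real.cos_add_pi_div_two, e', e]
  constructor
  · rw [Complex.add_re, Complex.conj_re, Complex.re_ofReal_mul, Complex.exp_ofReal_mul_I_re]
    ring
  · rw [Complex.sub_conj, Complex.im_ofReal_mul, Complex.exp_ofReal_mul_I_im]
    have : Complex.I * ω * (((2 * (1 / 2 * Real.sin (α.arg + ω * x)) : ℝ) : ℂ) * Complex.I) =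
        ((ω * -Real.sin (α.arg + ω * x) : ℝ) : ℂ) := by
      push_cast
      linear_combination (ω * Complex.sin (α.arg + ω * x)) * Complex.I_sq
    rw [this, Complex.ofReal_re]

theorem IsSolitaryWave.linearSetting {c qς qL ω : ℝ} {ς : ℝ → ℝ} {s : ℝ → ℂ} (hc : 1 < |c|)
    (hω : IsCriticalFrequency c ω) (hω1 : ω < 3 / 2) (h0 : 0 < qL) (h1 : qL < min (qς / 2) 1)
    (hI : AdjointInvertible c ς qL) (hs : ∀ᵐ x, (ς x : ℂ) = s x) (hsm : ∀ n, SmoothBdd n s)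
    (hse : ∀ x, s (-x) = s x) (hsr : ∀ x, (starRingEnd ℂ) (s x) = s x)
    (hb : AbsBdd qς s) : LinearSetting c ω qL qς s := by
  have hc0 : c ≠ 0 := by
    rintro rfl
    norm_num at hc
  obtain ⟨B, hB⟩ := ((SmoothBdd.const 1 0).add ((hsm 0).const_mul 2)).bounded
  exact
    { speed := hc
      freq_pos := hω.1
      freq_lt := hω1
      freq_zero := hω.2.1
      rate_pos := h0
      rate_lt_one := h1.trans_le (min_le_right _ _)
      rate_lt := by linarith [h1.trans_le (min_le_left _ _)]
      cont := (hsm 0).continuous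
      even := hse
      real := hsr
      bound := hb
      solvable := hI.solvable hc0 h0.le hs hB }

theorem MemHq.exists_rep {q r : ℝ} (hq : 0 ≤ q) (hr : 0 ≤ r) {f : ℝ → ℂ}
    (h : MemHq q (r + 2) f) :
    ∃ u u₁ u₂, u =ᵐ[volume] f ∧ AC u u₁ ∧ AC u₁ u₂ ∧ AbsBdd q u ∧ AbsBdd q u₁ := by
  obtain ⟨u, u₁, u₂, hu, h0, h1, C, -, b0, b1⟩ :=
    exists_bound_weighted hq (h.2.mono (by linarith : (2 : ℝ) ≤ r + 2))
  exact ⟨u, u₁, u₂, hu, h0, h1, ⟨C, b0⟩, ⟨C, b1⟩⟩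

theorem opL_memO {c r q : ℝ} (hr : 0 ≤ r) {ς : ℝ → ℝ} {s f : ℝ → ℂ}
    (hs : ∀ᵐ x, (ς x : ℂ) = s x) (hsm : ∀ n, SmoothBdd n s) (hse : ∀ x, s (-x) = s x)
    (h : MemO q (r + 2) f) : MemO q r (opL c ς f) := by
  obtain ⟨u, u₁, u₂, hu, h0, h1, -⟩ := MemH.exists_AC_two hr h.1.1
  refine ⟨⟨?_, opL_memH hr hs hsm h.1.2⟩, opL_odd hs hse hu h0 h1 h.2⟩
  have := opL_memH (c := c) (q := 0) hr hs hsm (f := f) (by rw [coshMul_zero]; exact h.1.1)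
  rwa [coshMul_zero] at this

/-- Cauchy–Schwarz with the square-integrable weight `cosh^{-q}`; of the Sobolev norm only its `L²`
part is used. The `+ 1` keeps the constant positive. -/
theorem weighted_pairing_bound {q r B : ℝ} (hq : 0 < q) (hr : 0 ≤ r) {v : ℝ → ℂ}
    (hv : Continuous v) (hB : ∀ x, ‖v x‖ ≤ B) :
    (∀ g, MemO q r g → Integrable (fun x => g x * v x) volume) ∧
      ∃ C : ℝ, 0 < C ∧ ∀ g, MemO q r g → ‖∫ x, g x * v x‖ ≤ C * normHq q r g := by
  have hB0 : 0 ≤ B := (norm_nonneg _).trans (hB 0)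
  refine ⟨fun g hg => (integrable_mul_of_coshMul hq hv hB hg.1.2.memLp).1,
    B * Real.sqrt (∫ x : ℝ, (Real.cosh x ^ (-q)) ^ 2) + 1, by positivity, fun g hg => ?_⟩
  refine (integrable_mul_of_coshMul hq hv hB hg.1.2.memLp).2.trans ?_
  have h1 := sq_norm_integral_le_normH hr hg.1.2
  have h2 : 0 ≤ normHq q r g := Real.sqrt_nonneg _
  calc _ ≤ B * Real.sqrt (∫ x : ℝ, (Real.cosh x ^ (-q)) ^ 2) * normHq q r g := by
        gcongr
        exact h1
    _ ≤ _ := by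
        rw [add_mul, one_mul]
        exact le_add_of_nonneg_right h2

namespace LinearSetting

variable {c ω q qς : ℝ} {s : ℝ → ℂ}

/-- The difference of the two functions is `O(e^{-qx})` at the base rate `q`, where uniqueness for
`L_c` is known. -/
theorem opL_injective (S : LinearSetting c ω q qς s) {ς : ℝ → ℝ}
    (hs : ∀ᵐ x, (ς x : ℂ) = s x) {r q' : ℝ} (hr : 0 ≤ r) (hq' : q ≤ q') {f₁ f₂ : ℝ → ℂ}
    (h₁ : MemHq q' (r + 2) f₁) (h₂ : MemHq q' (r + 2) f₂)
    (he : opL c ς f₁ =ᵐ[volume] opL c ς f₂) : f₁ =ᵐ[volume] f₂ := by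
  have hq := S.rate_pos
  obtain ⟨u, u₁, u₂, hu, a0, a1, b, -⟩ := h₁.exists_rep (hq.le.trans hq') hr
  obtain ⟨w, w₁, w₂, hw, d0, d1, e, -⟩ := h₂.exists_rep (hq.le.trans hq') hr
  obtain ⟨B, hB⟩ := S.coeff_bounded
  have k1 := repL_comb (c := c) (opL_ae_eq hs hu a0 a1).symm (opL_ae_eq hs hw d0 d1).symm (-1)
  have hz := S.solvable.repL_unique S.speed_ne_zero hq S.coeff_continuous hB
    (a0.add (d0.const_mul (-1))) (a1.add (d1.const_mul (-1)))
    ((b.expBdd hq.le hq').add ((e.expBdd hq.le hq').const_mul (-1))) (k1.trans (by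
      filter_upwards [he] with x hx
      rw [hx]
      simp))
  filter_upwards [hu, hw] with x hx hy
  rw [← hx, ← hy]
  linear_combination hz x

/-- The Fredholm alternative for `L_c` in odd weighted Sobolev spaces. -/
theorem solvable_iff (S : LinearSetting c ω q qς s) {ς : ℝ → ℝ}
    (hs : ∀ᵐ x, (ς x : ℂ) = s x) (hsm : ∀ n, SmoothBdd n s) {v v₁ v₂ : ℝ → ℂ} {α : ℂ}
    (hv : AC v v₁) (hv₁ : AC v₁ v₂) (hve : repLstar c (coeff s) v v₂ =ᵐ[volume] 0)
    (ho : ∀ x, v (-x) = -v x) (hα : α ≠ 0) (hvA : ExpAsymp q ω v v₁ α ((starRingEnd ℂ) α))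
    {B : ℝ} (hB : ∀ x, ‖v x‖ ≤ B) {r q' : ℝ} (hr : 0 ≤ r) (hq' : q ≤ q') (hq1 : q' < 1)
    {g : ℝ → ℂ} (hg : MemO q' r g) :
    (∃ f, MemO q' (r + 2) f ∧ opL c ς f =ᵐ[volume] g) ↔ ∫ x, g x * v x = 0 := by
  have hq := S.rate_pos
  have hq0 : 0 < q' := hq.trans_le hq'
  have hgL := hg.1.2.memLp
  have hi := (integrable_mul_of_coshMul hq0 hv.continuous hB hgL).1
  constructor
  · rintro ⟨f, hf, he⟩
    obtain ⟨u, u₁, u₂, hu, a0, a1, b0, b1⟩ := hf.1.exists_rep hq0.le hr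
    have hue := (opL_ae_eq hs hu a0 a1).symm.trans he
    have hb1 : AbsBdd q' (fun x => -u₁ (-x)) := by simpa using b1.comp_neg.const_mul (-1)
    -- A localized solution has zero amplitudes at both ends, so both boundary fluxes vanish.
    have := S.integral_mul_eq a0 a1 hv hv₁ hue hve ho
      (ExpAsymp.of_expBdd (b0.expBdd hq.le hq') (b1.expBdd hq.le hq'))
      (ExpAsymp.of_expBdd (b0.comp_neg.expBdd hq.le hq') (hb1.expBdd hq.le hq')) hvA hi
    simpa using this
  · intro h0
    obtain ⟨u, u₁, u₂, hu, hu₁, he, hodd, hb, hb₁⟩ := S.exists_odd_localized hv hv₁ hve ho hα hvA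
      (integrable_of_coshMul hq0 hgL) (ExpL2.of_coshMul (by rwa [abs_of_pos hq]) hgL) hg.2 hi h0
    obtain ⟨m0, m1⟩ := S.memLp_coshMul hu hu₁ hb hb₁ hodd he hq' hq1 hgL
    have hm : ∀ n, SmoothBdd n (coeff s) := fun n =>
      (SmoothBdd.const 1 n).add ((hsm n).const_mul 2)
    refine ⟨u, ⟨⟨?_, memH_of_repL S.speed_ne_zero hr hm hu hu₁ he m0 m1 hg.1.2⟩,
      Eventually.of_forall hodd⟩, (opL_ae_eq hs (ae_eq_refl _) hu hu₁).trans he⟩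
    -- Membership in the unweighted `H^{r+2}` is a separate clause of `MemHq`; the regularity lemma
    -- is run again with weight exponent zero.
    have := memH_of_repL (q := 0) S.speed_ne_zero hr hm hu hu₁ he
      (by rw [coshMul_zero]; exact memLp_of_coshMul hq0.le m0)
      (by rw [coshMul_zero]; exact memLp_of_coshMul hq0.le m1)
      (by rw [coshMul_zero]; exact hg.1.1)
    rwa [coshMul_zero] at this

theorem memWInf_two (S : LinearSetting c ω q qς s) {v v₁ v₂ : ℝ → ℂ} (hv : AC v v₁)
    (hv₁ : AC v₁ v₂) (hve : repLstar c (coeff s) v v₂ =ᵐ[volume] 0) {B B₁ : ℝ}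
    (hB : ∀ x, ‖v x‖ ≤ B) (hB₁ : ∀ x, ‖v₁ x‖ ≤ B₁) : MemWInf 2 v := by
  obtain ⟨M, hM⟩ := S.coeff_bounded
  have b0 : ExpBdd 0 v := ⟨B, by simpa using hB⟩
  have b1 : ExpBdd 0 v₁ := ⟨B₁, by simpa using hB₁⟩
  obtain ⟨C, hC⟩ := ae_bound_second (g := 0) S.speed_ne_zero hM b0 ⟨0, by simp⟩ hve
  simpa [MemWqInf] using memWqInf_two hv hv₁ b0 b1 hC

end LinearSetting

end JostSolution

end

open JostSolution in
theorem theorem4p1 (c : ℝ) (hc : 1 < |c|)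
    (qς : ℝ) (ς : ℝ → ℝ) (h_wave : IsSolitaryWave c qς ς)
    (qL : ℝ) (hqL_pos : 0 < qL) (hqL_lt : qL < min (qς / 2) 1)
    (h_inv : AdjointInvertible c ς qL) :
    -- injectivity of `L_c : O_q^{r+2} → O_q^r`
    (∀ r q : ℝ, 0 ≤ r → qL ≤ q →
      (∀ f, MemO q (r + 2) f → MemO q r (opL c ς f)) ∧
      (∀ f₁ f₂, MemO q (r + 2) f₁ → MemO q (r + 2) f₂ →
        opL c ς f₁ =ᵐ[volume] opL c ς f₂ → f₁ =ᵐ[volume] f₂)) ∧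
    -- the critical frequency, the Jost solution (its `C¹` representative) and its phase shift
    ∃ (ω : ℝ) (γ : ℝ → ℝ) (ϑ : ℝ),
      IsCriticalFrequency c ω ∧
      γ ≠ 0 ∧ (∀ x, γ (-x) = -γ x) ∧
      ContDiff ℝ 1 γ ∧ MemWInf 2 (fun x => (γ x : ℂ)) ∧
      opLstar c ς (fun x => (γ x : ℂ)) =ᵐ[volume] 0 ∧
      -- solvability condition
      (∀ r q : ℝ, 0 ≤ r → qL ≤ q → q < 1 → ∀ g, MemO q r g →
        ((∃ f, MemO q (r + 2) f ∧ opL c ς f =ᵐ[volume] g) ↔ ∫ x, g x * (γ x : ℂ) = 0)) ∧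
      -- asymptotics at `+∞`
      Tendsto (fun x => |γ x - Real.sin (ω * (x + ϑ))|) atTop (𝓝 0) ∧
      Tendsto (fun x => |deriv γ x - ω * Real.cos (ω * (x + ϑ))|) atTop (𝓝 0) ∧
      -- boundedness of the functional `g ↦ ∫ g γ`
      (∀ q r : ℝ, 0 < q → 0 ≤ r →
        (∀ g, MemO q r g → Integrable (fun x => g x * (γ x : ℂ)) volume) ∧
        ∃ C : ℝ, 0 < C ∧ ∀ g, MemO q r g →
          ‖∫ x, g x * (γ x : ℂ)‖ ≤ C * normHq q r g) := by
  have hc0 : c ≠ 0 := by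
    rintro rfl
    norm_num at hc
  obtain ⟨ω, hω, hω1⟩ := critical_freq_exists hc
  obtain ⟨s, hs, hsm, hse, hsr, Cs, -, hsb⟩ := h_wave.exists_profile hc0
  have S := IsSolitaryWave.linearSetting hc hω hω1 hqL_pos hqL_lt h_inv hs hsm hse hsr ⟨Cs, hsb⟩
  refine ⟨fun r q hr hq => ⟨fun f hf => opL_memO hr hs hsm hse hf,
    fun f₁ f₂ h₁ h₂ he => S.opL_injective hs hr hq h₁.1 h₂.1 he⟩, ?_⟩
  obtain ⟨v, v₁, v₂, α, hv, hv₁, hve, ho, hreal, hα, hvA, ⟨B, hB⟩, B₁, hB₁⟩ :=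
    S.exists_odd_solution
  have hα0 : α ≠ 0 := by
    rintro rfl
    norm_num at hα
  have hγ : ∀ x, (((v x).re : ℝ) : ℂ) = v x := fun x => Complex.conj_eq_iff_re.mp (hreal x)
  have hγ' : (fun x => (((v x).re : ℝ) : ℂ)) = v := funext hγ
  have hd : ∀ x, HasDerivAt (fun x => (v x).re) (v₁ x).re x := fun x =>
    Complex.reCLM.hasFDerivAt.comp_hasDerivAt x (hv.hasDerivAt hv₁.continuous x)
  have hderiv : deriv (fun x => (v x).re) = fun x => (v₁ x).re := funext fun x => (hd x).deriv
  refine ⟨ω, fun x => (v x).re, (α.arg + Real.pi / 2) / ω, hω, ?_, fun x => by simp [ho], ?_, ?_,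
    ?_, ?_, ?_, ?_, ?_⟩
  -- If `γ` vanished, so would its amplitudes, against `|α| = 1/2`.
  · intro h
    have hv0 : ∀ x, v x = 0 := fun x => by rw [← hγ x, congrFun h x]; simp
    have hv10 : ∀ x, v₁ x = 0 := by
      have h2 : AC v (fun _ => 0) := by rw [funext hv0]; exact AC.const 0
      exact fun x => hv.deriv_eq h2 hv₁.continuous continuous_const x
    refine hα0 (amplitudes_eq_zero (ω := ω) hω.1.ne' (b := (starRingEnd ℂ) α) ?_ ?_).1
    · simpa [hv0] using (hvA.fst.tendsto hqL_pos).neg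
    · simpa only [hv10, zero_sub, neg_neg, neg_zero] using (hvA.snd.tendsto hqL_pos).neg
  · refine contDiff_one_iff_deriv.mpr ⟨fun x => (hd x).differentiableAt, ?_⟩
    rw [hderiv]
    exact Complex.continuous_re.comp hv₁.continuous
  · rw [hγ']
    exact S.memWInf_two hv hv₁ hve hB hB₁
  · rw [hγ']
    exact (opLstar_ae_eq hs (ae_eq_refl _) hv hv₁).trans hve
  · intro r q hr hq hq1 g hg
    simp only [hγ]
    exact S.solvable_iff hs hsm hv hv₁ hve ho hα0 hvA hB hr hq hq1 hg
  · have := ((Complex.continuous_re.tendsto 0).comp (hvA.fst.tendsto hqL_pos)).abs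
    simp only [Complex.zero_re, abs_zero] at this
    refine this.congr fun x => ?_
    rw [Function.comp_apply, Complex.sub_re, (re_amplitude hω.1.ne' hα x).1]
  · have := ((Complex.continuous_re.tendsto 0).comp (hvA.snd.tendsto hqL_pos)).abs
    simp only [Complex.zero_re, abs_zero] at this
    refine this.congr fun x => ?_
    rw [hderiv, Function.comp_apply, Complex.sub_re, (re_amplitude hω.1.ne' hα x).2]
  · intro q r hq hr
    simp only [hγ]
    exact weighted_pairing_bound hq hr hv.continuous hB
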